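/- Algorithms are programs, with logarithmic cost, of an imperative language with integer arrays, which may also act on a quantum memory under classical control (Hadamard gates, $\pi/4$-phase gates, reversible arithmetic, measurements) and may call an oracle. They are quantum in general, randomized if they use no Hadamard or phase gates, and deterministic if in addition they use no coins. An algorithm solves a problem in time $t$ if with probability at least $2/3$ it stops after time at most $t$ with a correct output (so with certainty if it is deterministic). A function $f:\mathbb{Z}^k\to X$ to an unstructured set $X$ hides a subgroup $H\subseteq\mathbb{Z}^k$ if $f(x)=f(y)\iff y-x\in H$. An algorithm that has $f$ as an oracle stores values of $f$ in label registers, on which it can compute, and it can read their names bit by bit, but the names have no bounded length. Each evaluation of $f$ at $x\in\mathbb{Z}^k$ (in a superposition, the most expensive $x$ counts) is charged a declared time fee $T_k(x)\in\mathbb{N}$. The fee is pseudo-polynomial if there are real $c,\alpha>0$ and $C,\beta$ with $$c\,(\|x\|_1+k)^\alpha\le T_k(x)\le C\,(\|x\|_1+k)^\beta$$ for all $k$ and all $x\in\mathbb{Z}^k$ with $\|x\|_1+k$ sufficiently large. For $p\in[1,\infty]$ and integers $0<a\le b$, the problem $\mathsf{uSVP}^p_{a,b}$ is: given $a$ and a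 basis of an integer lattice $L\subseteq\mathbb{Z}^k$ (of any rank), find a shortest non-zero vector of $L$ in the $p$-norm, under the promise that there is such a vector $v$ with $\|v\|_p\le a$ and with $\|x\|_p>b$ for every $x\in L$ that is not proportional to $v$. Let $\|L\|_{\mathrm{bit}}$ be the total bit length of the given basis. **Theorem.** Let $T$ be a pseudo-polynomial fee, and let $p\in[1,\infty]$. Suppose that there are a quantum algorithm and a constant $C$ such that, for all $k$, all non-zero $v\in\mathbb{Z}^k$ and all functions $f$ on $\mathbb{Z}^k$ that hide $H=\langle v\rangle$, the algorithm, given $k$ and oracle access to $f$ with fee $T_k$, finds a generator of $H$ in time $C(\|v\|_1+k)^C$, fees included. Then there are a quantum algorithm without oracle and constants $D$, $C'$ such that the algorithm solves $\mathsf{uSVP}^p_{a,b}$ for all $k$, all $0<a\le b$ with $b\ge D(a+k)^D$, and all $L\subseteq\mathbb{Z}^k$ given by a basis, in time $C'(a+k+\|L\|_{\mathrm{bit}})^{C'}$. The same holds with "randomized" or with "deterministic" in place of "quantum" in both the hypothesis and the conclusion. -/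

import Mathlib

open scoped ENNReal

noncomputable section

namespace HSP

/-! ### Integers, vectors, norms -/

/-- Bit length of an integer, one bit for the sign included. It is always positive. -/
def bitSize (z : ℤ) : ℕ := Nat.size z.natAbs + 1

/-- The 1-norm on `ℤ^k`. -/
def norm1 {k : ℕ} (x : Fin k → ℤ) : ℕ := ∑ i, (x i).natAbs

/-- The `p`-norm on `ℤ^k`, for `p ∈ [1, ∞]`. -/
def pNorm (p : ℝ≥0∞) {k : ℕ} (x : Fin k → ℤ) : ℝ :=
  ‖(WithLp.toLp p (fun i => (x i : ℝ)) : PiLp p (fun _ : Fin k => ℝ))‖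

/-! ### Programs

Algorithms are programs of a structured imperative language with arrays of integers, charged by
the logarithmic cost criterion, and with a quantum memory under classical control.

* The classical memory and the quantum memory consist of arrays of integer registers. The name of
  an array is a number that is fixed in the program, the index is computed at run time.
* The quantum memory also has label registers, which hold values of the hiding function. The values
  are elements of an unstructured set, which are named by arbitrary integers: adding, subtracting
  and storing labels is charged independently of their length, while reading bits of a label is
  charged by the number of bits. -/

/-- Binary operations on integers; `le` is the comparison, with values `0` and `1`. -/
inductive BinOp
  | add | sub | mul | div | mod | le

/-- The value of a binary operation (`div` and `mod` are Euclidean, division by `0` gives `0`). -/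
def BinOp.eval : BinOp → ℤ → ℤ → ℤ
  | add, x, y => x + y
  | sub, x, y => x - y
  | mul, x, y => x * y
  | div, x, y => x / y
  | mod, x, y => x % y
  | le, x, y => if x ≤ y then 1 else 0

/-- Classical expressions: constants, array entries `A[i]`, operations. -/
inductive CExp
  | const (z : ℤ)
  | get (A : ℕ) (i : CExp)
  | op (o : BinOp) (d e : CExp)

/-- Quantum expressions: classical expressions, quantum registers `A[i]` with a classical index,
the last `w` bits of a label, the test whether a label has at most `w` bits, operations. -/
inductive QExp
  | classical (e : CExp)
  | get (A : ℕ) (i : CExp)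
  | labelMod (L : ℕ) (i w : CExp)
  | labelLt (L : ℕ) (i w : CExp)
  | op (o : BinOp) (d e : QExp)

/-- Commands. -/
inductive Cmd
  /-- do nothing -/
  | skip
  /-- classical assignment `A[i] := e` -/
  | assign (A : ℕ) (i e : CExp)
  /-- random classical bit `A[i] := 0` or `A[i] := 1` -/
  | coin (A : ℕ) (i : CExp)
  /-- reversible arithmetic `A[i] += e` on quantum registers -/
  | qadd (A : ℕ) (i : CExp) (e : QExp)
  /-- Hadamard gate on the quantum register `A[i]`, as a qubit with basis states `0`, `1` -/
  | hadamard (A : ℕ) (i : CExp)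
  /-- phase gate `diag(1, exp(iπ/4))` on the quantum register `A[i]` -/
  | phase (A : ℕ) (i : CExp)
  /-- classical `D[j] :=` outcome of measuring the quantum register `A[i]` -/
  | measure (D : ℕ) (j : CExp) (A : ℕ) (i : CExp)
  /-- oracle call: label register `L[j] += s f(x)`, with sign `s = ±1`,
  where `x = (A[0], …, A[k-1])` is read from the quantum memory -/
  | query (s : ℤˣ) (A L : ℕ) (j : CExp)
  /-- label registers: `L[i] += s M[j]`, with sign `s = ±1` -/
  | labelAdd (s : ℤˣ) (L : ℕ) (i : CExp) (M : ℕ) (j : CExp)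
  /-- composition -/
  | seq (c d : Cmd)
  /-- branching, on whether `e` is non-zero -/
  | ite (e : CExp) (c d : Cmd)
  /-- loop, as long as `e` is non-zero -/
  | whileDo (e : CExp) (c : Cmd)

/-- The quantum integer register array `A` is not read by the expression. -/
def QExp.Avoids (A : ℕ) : QExp → Prop
  | classical _ => True
  | get B _ => B ≠ A
  | labelMod _ _ _ => True
  | labelLt _ _ _ => True
  | op _ d e => d.Avoids A ∧ e.Avoids A

/-- Every arithmetic command on the quantum memory is reversible, because the array that is
updated is not read. -/
def Cmd.WellFormed : Cmd → Prop
  | qadd A _ e => e.Avoids A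
  | labelAdd _ L _ M _ => L ≠ M
  | seq c d => c.WellFormed ∧ d.WellFormed
  | ite _ c d => c.WellFormed ∧ d.WellFormed
  | whileDo _ c => c.WellFormed
  | _ => True

/-- Kinds of algorithms. -/
inductive Mode
  | deterministic | randomized | quantum

/-- Coins are used by randomized and quantum algorithms, the gates that create superpositions and
phases only by quantum algorithms. Without these gates the quantum memory always is in a basis
state, so that it is one more classical memory. -/
def Cmd.InMode (m : Mode) : Cmd → Prop
  | coin _ _ => m ≠ .deterministic
  | hadamard _ _ => m = .quantum
  | phase _ _ => m = .quantum
  | seq c d => c.InMode m ∧ d.InMode m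
  | ite _ c d => c.InMode m ∧ d.InMode m
  | whileDo _ c => c.InMode m
  | _ => True

/-- The program makes no oracle calls. -/
def Cmd.QueryFree : Cmd → Prop
  | query _ _ _ _ => False
  | seq c d => c.QueryFree ∧ d.QueryFree
  | ite _ c d => c.QueryFree ∧ d.QueryFree
  | whileDo _ c => c.QueryFree
  | _ => True

/-! ### Execution and running time -/

/-- Classical memory: array name, index, value. -/
abbrev Store := ℕ → ℤ → ℤ

/-- Replace one entry of one array. -/
def put {α : Type} (S : ℕ → ℤ → α) (A : ℕ) (i : ℤ) (z : α) : ℕ → ℤ → α :=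
  Function.update S A (Function.update (S A) i z)

/-- Basis states of the quantum memory: integer registers and label registers. -/
@[ext] structure Basis where
  reg : ℕ → ℤ → ℤ
  lab : ℕ → ℤ → ℤ

/-- A branch of a computation: the classical memory, the state vector of the quantum memory, whose
squared norm is the probability of the branch, and the time spent. -/
structure State where
  mem : Store
  amp : Basis →₀ ℂ
  time : ℕ

/-- An oracle: a function on `ℤ^dim` and a time fee for its evaluation at each point. -/
structure Oracle where
  dim : ℕ
  val : (Fin dim → ℤ) → ℤ
  fee : (Fin dim → ℤ) → ℕ

/-- Value of a classical expression. -/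
def CExp.eval (S : Store) : CExp → ℤ
  | const z => z
  | get A i => S A (i.eval S)
  | op o d e => o.eval (d.eval S) (e.eval S)

/-- Cost of a classical expression: the total bit length of all values that occur. -/
def CExp.cost (S : Store) : CExp → ℕ
  | const z => bitSize z
  | get A i => i.cost S + bitSize (S A (i.eval S))
  | op o d e => d.cost S + e.cost S + bitSize (o.eval (d.eval S) (e.eval S))

/-- Value of a quantum expression in a basis state. -/
def QExp.eval (S : Store) (B : Basis) : QExp → ℤ
  | classical e => e.eval S
  | get A i => B.reg A (i.eval S)
  | labelMod L i w => B.lab L (i.eval S) % 2 ^ (w.eval S).toNat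
  | labelLt L i w => if |B.lab L (i.eval S)| < 2 ^ (w.eval S).toNat then 1 else 0
  | op o d e => o.eval (d.eval S B) (e.eval S B)

/-- Cost of a quantum expression in a basis state. -/
def QExp.cost (S : Store) (B : Basis) : QExp → ℕ
  | classical e => e.cost S
  | get A i => i.cost S + bitSize (B.reg A (i.eval S))
  | labelMod _ i w => i.cost S + w.cost S + (w.eval S).toNat + 1
  | labelLt _ i w => i.cost S + w.cost S + (w.eval S).toNat + 1
  | op o d e => d.cost S B + e.cost S B + bitSize (o.eval (d.eval S B) (e.eval S B))

/-- The operation `A[i] += z` on basis states. -/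
def Basis.addReg (A : ℕ) (i z : ℤ) (B : Basis) : Basis :=
  { B with reg := put B.reg A i (B.reg A i + z) }

/-- The operation `L[i] += z` on basis states, for a label register. -/
def Basis.addLab (L : ℕ) (i z : ℤ) (B : Basis) : Basis :=
  { B with lab := put B.lab L i (B.lab L i + z) }

/-- The vector `(A[0], …, A[k-1])` in a basis state. -/
def Basis.vec (B : Basis) (A k : ℕ) : Fin k → ℤ := fun i => B.reg A (i : ℕ)

/-- The Hadamard gate on the register `A[i]`; it fixes the basis states in which the register has
a value other than `0` and `1`. -/
def hadamardGate (A : ℕ) (i : ℤ) (ψ : Basis →₀ ℂ) : Basis →₀ ℂ :=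
  ψ.sum fun B z =>
    if B.reg A i = 0 then
      Finsupp.single B (z / (√2 : ℝ)) + Finsupp.single (B.addReg A i 1) (z / (√2 : ℝ))
    else if B.reg A i = 1 then
      Finsupp.single (B.addReg A i (-1)) (z / (√2 : ℝ)) - Finsupp.single B (z / (√2 : ℝ))
    else Finsupp.single B z

/-- The phase gate on the register `A[i]`. -/
def phaseGate (A : ℕ) (i : ℤ) (ψ : Basis →₀ ℂ) : Basis →₀ ℂ :=
  ψ.sum fun B z =>
    Finsupp.single B (if B.reg A i = 1 then Complex.exp (Real.pi * Complex.I / 4) * z else z)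

/-- Cost of an operation on a superposition: the largest cost over the basis states in it. -/
def supCost (ψ : Basis →₀ ℂ) (t : Basis → ℕ) : ℕ := ψ.support.sup t

/-- At most `n` iterations of a loop; branches that have not left it by then are dropped. -/
def loop (e : CExp) (body : State → Multiset State) : ℕ → State → Multiset State
  | 0, _ => 0
  | n + 1, s =>
    let s' : State := { s with time := s.time + e.cost s.mem }
    if e.eval s.mem = 0 then {s'} else (body s').bind (loop e body n)

open Classical in
/-- The branches in which a program ends, when every loop is cut off after `n` tests. -/
def exec (O : Oracle) (n : ℕ) : Cmd → State → Multiset State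
  | .skip, s => {s}
  | .assign A i e, s =>
    {{ s with
        mem := put s.mem A (i.eval s.mem) (e.eval s.mem)
        time := s.time + i.cost s.mem + e.cost s.mem }}
  | .coin A i, s =>
    ({0, 1} : Multiset ℤ).map fun z =>
      { mem := put s.mem A (i.eval s.mem) z
        amp := (1 / (√2 : ℝ) : ℂ) • s.amp
        time := s.time + i.cost s.mem + 1 }
  | .qadd A i e, s =>
    {{ s with
        amp := s.amp.mapDomain fun B => B.addReg A (i.eval s.mem) (e.eval s.mem B)
        time := s.time + i.cost s.mem + supCost s.amp fun B => e.cost s.mem B }}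
  | .hadamard A i, s =>
    {{ s with
        amp := hadamardGate A (i.eval s.mem) s.amp
        time := s.time + i.cost s.mem + 1 }}
  | .phase A i, s =>
    {{ s with
        amp := phaseGate A (i.eval s.mem) s.amp
        time := s.time + i.cost s.mem + 1 }}
  | .measure D j A i, s =>
    (s.amp.support.image fun B => B.reg A (i.eval s.mem)).val.map fun z =>
      { mem := put s.mem D (j.eval s.mem) z
        amp := s.amp.filter fun B => B.reg A (i.eval s.mem) = z
        time := s.time + j.cost s.mem + i.cost s.mem +
          supCost s.amp fun B => bitSize (B.reg A (i.eval s.mem)) }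
  | .query r A L j, s =>
    {{ s with
        amp := s.amp.mapDomain fun B => B.addLab L (j.eval s.mem) (r * O.val (B.vec A O.dim))
        time := s.time + j.cost s.mem + supCost s.amp fun B => O.fee (B.vec A O.dim) }}
  | .labelAdd r L i M j, s =>
    {{ s with
        amp := s.amp.mapDomain fun B => B.addLab L (i.eval s.mem) (r * B.lab M (j.eval s.mem))
        time := s.time + i.cost s.mem + j.cost s.mem }}
  | .seq c d, s => (exec O n c s).bind (exec O n d)
  | .ite e c d, s =>
    let s' : State := { s with time := s.time + e.cost s.mem }
    if e.eval s.mem = 0 then exec O n d s' else exec O n c s'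
  | .whileDo e c, s => loop e (exec O n c) n s

/-- The initial state: the input in the classical memory, all quantum registers `0`. -/
def start (input : Store) : State :=
  { mem := input, amp := Finsupp.single ⟨fun _ _ => 0, fun _ _ => 0⟩ 1, time := 0 }

/-- The probability of a branch. -/
def State.prob (s : State) : ℝ := s.amp.sum fun _ z => ‖z‖ ^ 2

open Classical in
/-- With probability at least `2/3`, the program stops after time at most `t`, oracle fees
included, with a final memory in which the output is correct. (For deterministic programs there is
only one branch, so that the probability is then `1`.) -/
def Succeeds (O : Oracle) (c : Cmd) (input : Store) (t : ℕ) (correct : Store → Prop) : Prop :=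
  ∃ n : ℕ, (2 / 3 : ℝ) ≤
    (((exec O n c (start input)).filter fun s => s.time ≤ t ∧ correct s.mem).map State.prob).sum

/-- The output vector in `ℤ^k`: the first entries of the classical array `2`. -/
def outputVec (S : Store) (k : ℕ) : Fin k → ℤ := fun i => S 2 (i : ℕ)

/-! ### The hidden subgroup problem -/

/-- The function `f` hides the subgroup `H`. -/
def Hides {G X : Type} [AddGroup G] (f : G → X) (H : AddSubgroup G) : Prop :=
  ∀ x y, f x = f y ↔ ∃ h ∈ H, y = x + h

/-- Pseudo-polynomial query cost: two-sided polynomial bounds in the 1-norm and the dimension. -/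
def PseudoPolynomial (fee : (k : ℕ) → (Fin k → ℤ) → ℕ) : Prop :=
  ∃ (N : ℕ) (c α C β : ℝ), 0 < c ∧ 0 < α ∧
    ∀ (k : ℕ) (x : Fin k → ℤ), N ≤ norm1 x + k →
      c * ((norm1 x + k : ℕ) : ℝ) ^ α ≤ fee k x ∧ (fee k x : ℝ) ≤ C * ((norm1 x + k : ℕ) : ℝ) ^ β

/-- The input of the hidden subgroup problem in `ℤ^k` (apart from the oracle) is `k`. -/
def hspInput (k : ℕ) : Store := put (fun _ _ => 0) 0 0 k

/-- One algorithm finds every hidden subgroup of rank 1 in every `ℤ^k`, in time polynomial in `k`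
and in the 1-norm of a generator, if evaluating the hiding function has the given cost. -/
def RankOneHSPSolvable (m : Mode) (fee : (k : ℕ) → (Fin k → ℤ) → ℕ) : Prop :=
  ∃ Z : Cmd, Z.WellFormed ∧ Z.InMode m ∧ ∃ C : ℕ,
    ∀ (k : ℕ) (v : Fin k → ℤ) (f : (Fin k → ℤ) → ℤ),
      v ≠ 0 → Hides f (AddSubgroup.zmultiples v) →
        Succeeds ⟨k, f, fee k⟩ Z (hspInput k) (C * (norm1 v + k) ^ C)
          (fun S => AddSubgroup.zmultiples (outputVec S k) = AddSubgroup.zmultiples v)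

/-! ### The unique short vector problem -/

/-- The lattice in `ℤ^k` that is generated by given vectors. -/
def latticeOf {k l : ℕ} (M : Fin l → Fin k → ℤ) : AddSubgroup (Fin k → ℤ) :=
  AddSubgroup.closure (Set.range M)

/-- The bit complexity of a list of vectors. -/
def bitComplexity {k l : ℕ} (M : Fin l → Fin k → ℤ) : ℕ := ∑ i, ∑ j, bitSize (M i j)

/-- `v` is a shortest non-zero vector of `L`, in the `p`-norm. -/
def IsShortest (p : ℝ≥0∞) {k : ℕ} (L : AddSubgroup (Fin k → ℤ)) (v : Fin k → ℤ) : Prop :=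
  v ∈ L ∧ v ≠ 0 ∧ ∀ x ∈ L, x ≠ 0 → pNorm p v ≤ pNorm p x

/-- The vector `x` is proportional to `v`. -/
def Proportional {k : ℕ} (x v : Fin k → ℤ) : Prop := ∃ q : ℚ, ∀ i, (x i : ℚ) = q * v i

/-- The promise of the unique short vector problem with parameters `a` and `b`. -/
def UniqueShortPromise (p : ℝ≥0∞) (a b : ℕ) {k : ℕ} (L : AddSubgroup (Fin k → ℤ)) : Prop :=
  ∃ v, IsShortest p L v ∧ pNorm p v ≤ a ∧ ∀ x ∈ L, ¬ Proportional x v → (b : ℝ) < pNorm p x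

/-- The input: the classical array `0` holds `k, l, a`, the classical array `1` holds the basis, one
vector after the other, with entry `j` of vector `i` at the index `i * k + j`. -/
def usvpInput (a : ℕ) {k l : ℕ} (M : Fin l → Fin k → ℤ) : Store := fun A n =>
  if A = 0 then
    if n = 0 then k else if n = 1 then l else if n = 2 then a else 0
  else if A = 1 then
    ∑ i : Fin l, ∑ j : Fin k, if n = (i : ℕ) * k + (j : ℕ) then M i j else 0
  else 0

/-- The oracle that is not called. -/
def noOracle : Oracle := ⟨0, fun _ => 0, fun _ => 0⟩

/-- One algorithm without oracle finds a shortest non-zero vector of every integer lattice, given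
by a basis, that satisfies the promise with a gap `b` that is at least a certain polynomial in `a`
and `k`, in time polynomial in `a`, in `k`, and in the bit complexity of the basis. -/
def USVPSolvable (m : Mode) (p : ℝ≥0∞) : Prop :=
  ∃ A : Cmd, A.WellFormed ∧ A.InMode m ∧ A.QueryFree ∧ ∃ D C : ℕ,
    ∀ (a b k l : ℕ) (M : Fin l → Fin k → ℤ),
      LinearIndependent ℤ M → 0 < a → a ≤ b → D * (a + k) ^ D ≤ b →
        UniqueShortPromise p a b (latticeOf M) →
          Succeeds noOracle A (usvpInput a M) (C * (a + k + bitComplexity M) ^ C)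
            (fun S => IsShortest p (latticeOf M) (outputVec S k))

end HSP

end

/-!
Let `v` be the shortest vector of the lattice `L`. A lattice vector that is proportional to `v` is a
multiple of `v` (otherwise rounding would give a shorter vector), so that it suffices to find the
subgroup `⟨v⟩`, which the given algorithm `Z` does from a function that hides it. The `1`-norm of
`v` is at most `k * a`, hence `Z` needs time at most `T`, a polynomial in `a + k`. By the lower
bound for the fee, it can in this time only evaluate the function in the ball of a radius `R` that
is a polynomial in `T`. If `2 * R ≤ b`, then any two points of the ball that are congruent modulo
`L` are congruent modulo `⟨v⟩`. So a function that hides `L` may be used in place of one that hides `⟨v⟩`: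
on the ball, it coincides with a function that hides `⟨v⟩` on all of `ℤ^k` (`exists_hidingFunction`,
which rests on `exists_hides_extension`), and `Z` cannot tell the difference.

A computable function that hides `L`, at least in the ball, comes from the basis matrix `B`. The
Faddeev–LeVerrier recursion applied to the Gram matrix `B Bᵀ` gives a matrix `N` with integer
entries and an integer `d ≠ 0` with `B Bᵀ N = d` (`mul_leVerrier`). It needs only sums, products and
exact divisions of integers with polynomially many bits. The vector `d⁻¹ N B x` consists of the
coordinates of the orthogonal projection of `x` to the span of `L`. Hence `x` is in `L` if and only
if `d` divides `N B x` and `(d - Bᵀ N B) x = 0`, and for short `x` the equation follows from a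
congruence with a large modulus. All in all, membership of `x` in `L` is expressed by `l + k` linear
congruences with one modulus (`levMod_dvd_levForm`, `mem_latticeOf_of_levForm`), and the residues of
the linear forms, as digits of one integer, give the function (`residueCode`). Its values are
doubled, since the odd numbers are needed for the extension to `ℤ^k`.

The program for the lattice problem first computes the coefficients of these linear forms, their
modulus, its powers, and the powers of `2` up to `2 ^ T` (`tables_run`). Then it runs a translation
of `Z` (`Cmd.sim`), in which labels are ordinary quantum registers and an oracle call is replaced by
computing the linear forms, adding their code to the label, and uncomputing the linear forms
(`queryCmd_run`). The powers of `2` serve for reading bits of labels. The simulation `Sim.exec`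
matches every branch of `Z` that ends in time `T` with a branch of the translation that has the same
probability, the same output, and polynomially larger time. The translation only uses gates and
coins where `Z` does, so that it works for the three kinds of algorithms at once.
-/

noncomputable section

namespace HSP

/-! ### The Faddeev–LeVerrier recursion -/

section FaddeevLeVerrier

open Polynomial Matrix

lemma derivative_charpoly_eq_trace_adjugate {n : Type*} [Fintype n] [DecidableEq n]
    (A : Matrix n n ℤ) : derivative A.charpoly = (adjugate (charmatrix A)).trace := by
  classical
  rw [Matrix.charpoly, Matrix.det_apply, derivative_sum, Matrix.trace]
  simp only [Matrix.diag_apply, adjugate_apply, Matrix.det_apply]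
  rw [Finset.sum_comm]
  refine Finset.sum_congr rfl fun σ _ => ?_
  rw [Units.smul_def, derivative_smul, derivative_prod_finset, ← Finset.smul_sum]
  congr 1
  refine Eq.trans ?_ (Equiv.sum_comp σ _)
  refine Finset.sum_congr rfl fun i _ => ?_
  rw [← Finset.mul_prod_erase Finset.univ _ (Finset.mem_univ i), mul_comm]
  have h1 : derivative (charmatrix A (σ i) i) =
      (charmatrix A).updateRow (σ i) (Pi.single (σ i) 1) (σ i) i := by
    rw [updateRow_self]
    by_cases h : σ i = i
    · rw [h, charmatrix_apply_eq]; simp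
    · rw [charmatrix_apply_ne _ _ _ h, Pi.single_eq_of_ne (Ne.symm h)]; simp
  rw [h1]
  congr 1
  refine Finset.prod_congr rfl fun j hj => ?_
  rw [updateRow_ne]
  exact fun h => (Finset.ne_of_mem_erase hj) (σ.injective h)

variable {l : ℕ} (A : Matrix (Fin l) (Fin l) ℤ)

/-- The coefficient of `X ^ m` in the adjugate of `X - A`. -/
def adjCoeff (m : ℕ) : Matrix (Fin l) (Fin l) ℤ :=
  (adjugate (charmatrix A)).map fun p => p.coeff m

lemma charmatrix_mul_apply (B : Matrix (Fin l) (Fin l) ℤ[X]) (i j : Fin l) :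
    (charmatrix A * B) i j = X * B i j - ∑ r, C (A i r) * B r j := by
  rw [charmatrix, Matrix.sub_mul, Matrix.sub_apply, Matrix.scalar_apply,
    Matrix.diagonal_mul, Matrix.mul_apply]
  rfl

lemma charmatrix_mul_adjugate_apply (i j : Fin l) :
    X * adjugate (charmatrix A) i j - ∑ r, C (A i r) * adjugate (charmatrix A) r j =
      if i = j then A.charpoly else 0 := by
  rw [← charmatrix_mul_apply, mul_adjugate, Matrix.smul_apply, Matrix.one_apply, Matrix.charpoly]
  split <;> simp

lemma adjCoeff_eq (m : ℕ) :
    adjCoeff A m = A * adjCoeff A (m + 1) + A.charpoly.coeff (m + 1) • 1 := by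
  ext i j
  have h := congrArg (fun p => p.coeff (m + 1)) (charmatrix_mul_adjugate_apply A i j)
  simp only [coeff_sub, coeff_X_mul, finsetSum_coeff, coeff_C_mul] at h
  simp only [adjCoeff, Matrix.add_apply, Matrix.mul_apply, Matrix.map_apply, Matrix.smul_apply,
    Matrix.one_apply, smul_eq_mul]
  rw [sub_eq_iff_eq_add'] at h
  rw [h]
  split <;> simp

lemma mul_adjCoeff_zero : A * adjCoeff A 0 = (-A.charpoly.coeff 0) • 1 := by
  ext i j
  have h := congrArg (fun p => p.coeff 0) (charmatrix_mul_adjugate_apply A i j)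
  simp only [coeff_sub, finsetSum_coeff, mul_coeff_zero, coeff_C_zero, coeff_X_zero, zero_mul,
    zero_sub] at h
  simp only [adjCoeff, Matrix.mul_apply, Matrix.map_apply, Matrix.smul_apply,
    Matrix.one_apply, smul_eq_mul]
  rw [neg_eq_iff_eq_neg.1 h]
  split <;> simp

lemma trace_adjCoeff (m : ℕ) :
    (adjCoeff A m).trace = A.charpoly.coeff (m + 1) * (m + 1) := by
  have h := congrArg (fun p => p.coeff m) (derivative_charpoly_eq_trace_adjugate A)
  simp only [coeff_derivative, Matrix.trace, finsetSum_coeff] at h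
  rw [h]
  rfl

lemma adjCoeff_eq_zero {m : ℕ} (hm : l ≤ m) : adjCoeff A m = 0 := by
  have hdeg : ∀ m, l < m → A.charpoly.coeff m = 0 := fun m hm =>
    coeff_eq_zero_of_natDegree_lt (by rwa [charpoly_natDegree_eq_dim, Fintype.card_fin])
  -- the coefficients vanish beyond the largest degree of the entries, hence down to `l`
  obtain ⟨K, hK⟩ : ∃ K, ∀ m, K ≤ m → adjCoeff A m = 0 := by
    refine ⟨(∑ i, ∑ j, (adjugate (charmatrix A) i j).natDegree) + 1, fun m hm => ?_⟩
    ext i j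
    refine coeff_eq_zero_of_natDegree_lt (lt_of_lt_of_le ?_ hm)
    refine Nat.lt_succ_of_le ?_
    exact (Finset.single_le_sum (f := fun j => (adjugate (charmatrix A) i j).natDegree)
      (fun _ _ => Nat.zero_le _) (Finset.mem_univ j)).trans
      (Finset.single_le_sum (f := fun i => ∑ j, (adjugate (charmatrix A) i j).natDegree)
      (fun _ _ => Nat.zero_le _) (Finset.mem_univ i))
  have key : ∀ s m, l ≤ m → K ≤ m + s → adjCoeff A m = 0 := by
    intro s
    induction s with
    | zero => exact fun m _ h => hK m h
    | succ s ih =>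
      intro m hl h
      rw [adjCoeff_eq, ih (m + 1) (by omega) (by omega), hdeg (m + 1) (by omega)]
      simp
  exact key K m hm (by omega)

/-- The Faddeev–LeVerrier sequence, which computes the coefficients of the adjugate of `X - A`
from the highest one to the lowest one. -/
def leVerrier : ℕ → Matrix (Fin l) (Fin l) ℤ
  | 0 => 1
  | t + 1 => A * leVerrier t + ((A * leVerrier t).trace / (-(t + 1 : ℤ))) • 1

lemma leVerrier_eq_adjCoeff {t : ℕ} (ht : t < l) : leVerrier A t = adjCoeff A (l - 1 - t) := by
  induction t with
  | zero =>
    rw [leVerrier, adjCoeff_eq, adjCoeff_eq_zero A (by omega)]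
    have h : A.charpoly.coeff (l - 1 - 0 + 1) = 1 := by
      have := A.charpoly_monic.coeff_natDegree
      rwa [charpoly_natDegree_eq_dim, Fintype.card_fin,
        show A.charpoly.coeff l = A.charpoly.coeff (l - 1 - 0 + 1) by congr 1; omega] at this
    rw [h]; simp
  | succ t ih =>
    have ht' : l - 1 - t = l - 1 - (t + 1) + 1 := by omega
    rw [leVerrier, ih (by omega), ht']
    set m := l - 1 - (t + 1) with hm
    rw [adjCoeff_eq A m]
    congr 2
    have h := congrArg Matrix.trace (adjCoeff_eq A m)
    rw [Matrix.trace_add, trace_adjCoeff, Matrix.trace_smul, Matrix.trace_one, Fintype.card_fin,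
      smul_eq_mul] at h
    have hl : (l : ℤ) = m + 1 + (t + 1) := by omega
    refine Int.ediv_eq_of_eq_mul_right (by omega) ?_
    rw [hl] at h
    linear_combination -h

/-- The last matrix of the Faddeev–LeVerrier sequence inverts `A` up to the determinant. -/
lemma mul_leVerrier (hl : 0 < l) (hA : A.det ≠ 0) :
    ∃ d : ℤ, d ≠ 0 ∧ A * leVerrier A (l - 1) = d • 1 := by
  refine ⟨-A.charpoly.coeff 0, ?_, ?_⟩
  · intro h
    rw [neg_eq_zero] at h
    exact hA (by rw [det_eq_sign_charpoly_coeff, h, mul_zero])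
  · rw [leVerrier_eq_adjCoeff A (by omega), show l - 1 - (l - 1) = 0 by omega, mul_adjCoeff_zero]

end FaddeevLeVerrier

/-! ### Linear congruences that describe a lattice -/

section Lattice

open Matrix

variable {k l : ℕ}

lemma mem_latticeOf_iff (M : Matrix (Fin l) (Fin k) ℤ) (x : Fin k → ℤ) :
    x ∈ latticeOf M ↔ ∃ c : Fin l → ℤ, x = c ᵥ* M := by
  change x ∈ AddSubgroup.closure (Set.range fun i => M i) ↔ _
  rw [← Submodule.span_int_eq_addSubgroupClosure, Submodule.mem_toAddSubgroup,
    Submodule.mem_span_range_iff_exists_fun]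
  refine exists_congr fun c => ?_
  rw [eq_comm, Matrix.vecMul_eq_sum]

lemma det_gram_ne_zero {M : Matrix (Fin l) (Fin k) ℤ} (hM : LinearIndependent ℤ M) :
    (M * Mᵀ).det ≠ 0 := by
  intro h
  obtain ⟨v, hv, hv0⟩ := Matrix.exists_vecMul_eq_zero_iff.2 h
  apply hv
  have h1 : v ᵥ* M = 0 := by
    rw [← dotProduct_self_eq_zero (v := v ᵥ* M)]
    calc (v ᵥ* M) ⬝ᵥ (v ᵥ* M) = (v ᵥ* (M * Mᵀ)) ⬝ᵥ v := by
          rw [← Matrix.vecMul_vecMul, dotProduct_comm ((v ᵥ* M) ᵥ* Mᵀ),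
            Matrix.vecMul_transpose, Matrix.dotProduct_mulVec]
      _ = 0 := by rw [hv0, zero_dotProduct]
  rw [Matrix.vecMul_eq_sum] at h1
  funext i
  exact (Fintype.linearIndependent_iff.1 hM) v h1 i

/-- If `N` inverts the Gram matrix of a basis up to the factor `d`, then a vector with `Q N M x`
and `(d - Mᵀ N M) x` divisible by `d Q` is in the lattice, provided that the entries of the latter
vector are smaller than the modulus. -/
lemma mem_latticeOf_of_dvd {M : Matrix (Fin l) (Fin k) ℤ} {N : Matrix (Fin l) (Fin l) ℤ}
    {d Q : ℤ} (hd : d ≠ 0) (hQ : Q ≠ 0) {x : Fin k → ℤ}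
    (hU : ∀ i, d * Q ∣ Q * ((N * M) *ᵥ x) i)
    (hV : ∀ i, d * Q ∣ ((d • 1 - Mᵀ * (N * M)) *ᵥ x) i)
    (hx : ∀ i, |((d • 1 - Mᵀ * (N * M)) *ᵥ x) i| < |d * Q|) : x ∈ latticeOf M := by
  have hU' : ∀ i, ∃ c, ((N * M) *ᵥ x) i = d * c := by
    intro i
    have h := hU i
    rw [mul_comm d Q] at h
    exact (mul_dvd_mul_iff_left hQ).1 h
  choose c hc using hU'
  have hV' : (d • 1 - Mᵀ * (N * M)) *ᵥ x = 0 :=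
    funext fun i => Int.eq_zero_of_abs_lt_dvd ((abs_dvd _ _).2 (hV i)) (hx i)
  rw [mem_latticeOf_iff]
  refine ⟨c, ?_⟩
  have hc' : (N * M) *ᵥ x = d • c := funext hc
  rw [Matrix.sub_mulVec, Matrix.smul_mulVec, Matrix.one_mulVec, ← Matrix.mulVec_mulVec, hc',
    Matrix.mulVec_smul, ← smul_sub, Matrix.mulVec_transpose] at hV'
  exact sub_eq_zero.1 ((smul_eq_zero.1 hV').resolve_left hd)

/-- Lattice vectors satisfy the congruences of `mem_latticeOf_of_dvd`. -/
lemma dvd_of_mem_latticeOf {M : Matrix (Fin l) (Fin k) ℤ} (hM : LinearIndependent ℤ M)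
    {N : Matrix (Fin l) (Fin l) ℤ} {d : ℤ} (hN : M * Mᵀ * N = d • 1) {x : Fin k → ℤ}
    (hx : x ∈ latticeOf M) :
    (∀ i, d ∣ ((N * M) *ᵥ x) i) ∧ (d • 1 - Mᵀ * (N * M)) *ᵥ x = 0 := by
  have hN' : N * (M * Mᵀ) = d • 1 := by
    have hG := det_gram_ne_zero hM
    generalize M * Mᵀ = G at hN hG ⊢
    have h : G * (N * G) = G * (d • 1) := by
      rw [← Matrix.mul_assoc, hN, Matrix.smul_mul, Matrix.one_mul, Matrix.mul_smul, Matrix.mul_one]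
    have h2 := congrArg (fun A => adjugate G * A) h
    simp only [← Matrix.mul_assoc (adjugate G) G, adjugate_mul, Matrix.smul_mul,
      Matrix.one_mul] at h2
    exact smul_right_injective _ hG h2
  obtain ⟨c, rfl⟩ := (mem_latticeOf_iff M x).1 hx
  have h1 : (N * M) *ᵥ (c ᵥ* M) = d • c := by
    rw [← Matrix.mulVec_transpose, Matrix.mulVec_mulVec, Matrix.mul_assoc, hN', Matrix.smul_mulVec,
      Matrix.one_mulVec]
  refine ⟨fun i => ⟨c i, congrFun h1 i⟩, ?_⟩
  rw [Matrix.sub_mulVec, Matrix.smul_mulVec, Matrix.one_mulVec, ← Matrix.mulVec_mulVec, h1,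
    Matrix.mulVec_smul, Matrix.mulVec_transpose, sub_self]

end Lattice

/-! ### Integer codes of residues, and extension of hiding functions -/

/-- The residues of `c 0, …, c (n - 1)` modulo `m`, as the digits of one integer. -/
def residueCode (m : ℤ) (n : ℕ) (c : ℕ → ℤ) : ℤ := ∑ r ∈ Finset.range n, m ^ r * (c r % m)

/-- The digits of an integer in base `m` are unique, also for negative `m`. -/
lemma residueCode_eq_iff {m : ℤ} (hm : m ≠ 0) {n : ℕ} {c c' : ℕ → ℤ} :
    residueCode m n c = residueCode m n c' ↔ ∀ r < n, c r % m = c' r % m := by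
  constructor
  · induction n generalizing c c' with
    | zero => intro _ r hr; omega
    | succ n ih =>
      intro h
      have hs : ∀ c : ℕ → ℤ, residueCode m (n + 1) c =
          m * residueCode m n (fun r => c (r + 1)) + c 0 % m := by
        intro c
        rw [residueCode, Finset.sum_range_succ', residueCode, Finset.mul_sum]
        simp [pow_succ', mul_assoc]
      rw [hs, hs] at h
      have h0 : c 0 % m = c' 0 % m := by
        have := congrArg (· % m) h
        simpa using this
      rw [h0] at h
      have h1 := mul_left_cancel₀ hm (add_right_cancel h)
      intro r hr
      rcases r with _ | r
      · exact h0
      · exact ih h1 r (by omega)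
  · intro h
    exact Finset.sum_congr rfl fun r hr => by rw [h r (Finset.mem_range.1 hr)]

/-- A function that hides `H` on a set and has even values there extends to a function that
hides `H`: the cosets that do not meet the set get odd values. -/
lemma exists_hides_extension {k : ℕ} (H : AddSubgroup (Fin k → ℤ)) (F : (Fin k → ℤ) → ℤ)
    (S : Set (Fin k → ℤ)) (hF : ∀ x ∈ S, ∀ y ∈ S, F x = F y ↔ y - x ∈ H)
    (heven : ∀ x, Even (F x)) :
    ∃ f : (Fin k → ℤ) → ℤ, Hides f H ∧ ∀ x ∈ S, f x = F x := by
  classical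
  have : Countable ((Fin k → ℤ) ⧸ H) :=
    inferInstanceAs (Countable (Quotient (QuotientAddGroup.leftRel H)))
  obtain ⟨e, he⟩ := exists_injective_nat ((Fin k → ℤ) ⧸ H)
  let f : (Fin k → ℤ) → ℤ := fun x =>
    if h : ∃ y ∈ S, y - x ∈ H then F h.choose else 2 * (e (QuotientAddGroup.mk x) : ℤ) + 1
  have hpos : ∀ x y, y ∈ S → y - x ∈ H → f x = F y := by
    intro x y hy hxy
    have h : ∃ y ∈ S, y - x ∈ H := ⟨y, hy, hxy⟩
    have hf : f x = F h.choose := dif_pos h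
    rw [hf, hF _ h.choose_spec.1 _ hy]
    have := H.sub_mem hxy h.choose_spec.2
    simpa using this
  have hneg : ∀ x, (¬ ∃ y ∈ S, y - x ∈ H) →
      f x = 2 * (e (QuotientAddGroup.mk x) : ℤ) + 1 := fun x h => dif_neg h
  have hodd : ∀ (z : Fin k → ℤ) (n : ℕ), F z ≠ 2 * (n : ℤ) + 1 := by
    intro z n h
    obtain ⟨w, hw⟩ := heven z
    omega
  refine ⟨f, ?_, fun x hx => hpos x x hx (by simp)⟩
  intro x y
  have hH : (∃ h ∈ H, y = x + h) ↔ y - x ∈ H :=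
    ⟨fun ⟨h, hh, e⟩ => by rw [e]; simpa using hh, fun h => ⟨y - x, h, by abel⟩⟩
  rw [hH]
  by_cases hx : ∃ z ∈ S, z - x ∈ H
  · obtain ⟨z, hz, hzx⟩ := hx
    rw [hpos x z hz hzx]
    by_cases hy : ∃ w ∈ S, w - y ∈ H
    · obtain ⟨w, hw, hwy⟩ := hy
      rw [hpos y w hw hwy, hF z hz w hw]
      constructor
      · intro h
        have := H.add_mem (H.sub_mem h hwy) hzx
        simpa using this
      · intro h
        have := H.sub_mem (H.add_mem h hwy) hzx
        simpa using this
    · rw [hneg y hy]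
      refine ⟨fun h => absurd h (hodd _ _), fun h => absurd ⟨z, hz, ?_⟩ hy⟩
      have := H.sub_mem hzx h
      simpa using this
  · rw [hneg x hx]
    by_cases hy : ∃ w ∈ S, w - y ∈ H
    · obtain ⟨w, hw, hwy⟩ := hy
      rw [hpos y w hw hwy]
      refine ⟨fun h => absurd h.symm (hodd _ _), fun h => absurd ⟨w, hw, ?_⟩ hx⟩
      have := H.add_mem hwy h
      simpa using this
    · rw [hneg y hy]
      have : (2 * (e (QuotientAddGroup.mk x) : ℤ) + 1 = 2 * (e (QuotientAddGroup.mk y) : ℤ) + 1) ↔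
          (QuotientAddGroup.mk x : (Fin k → ℤ) ⧸ H) = QuotientAddGroup.mk y := by
        rw [← he.eq_iff]; omega
      rw [this, QuotientAddGroup.eq]
      rw [neg_add_eq_sub]

/-! ### Lattices with a unique short vector -/

section Norms

variable {k : ℕ}

lemma abs_le_pNorm {p : ENNReal} (hp : 1 ≤ p) (x : Fin k → ℤ) (i : Fin k) :
    |(x i : ℝ)| ≤ pNorm p x := by
  have : Fact (1 ≤ p) := ⟨hp⟩
  exact PiLp.norm_apply_le (WithLp.toLp p fun i => (x i : ℝ)) i

lemma pNorm_le_norm1 {p : ENNReal} (hp : 1 ≤ p) (x : Fin k → ℤ) : pNorm p x ≤ norm1 x := by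
  have : Fact (1 ≤ p) := ⟨hp⟩
  have h : (WithLp.toLp p (fun i => (x i : ℝ)) : PiLp p (fun _ : Fin k => ℝ)) =
      ∑ i, PiLp.single p i (x i : ℝ) := by
    ext j
    simp
  rw [pNorm, h]
  refine (norm_sum_le _ _).trans (le_of_eq ?_)
  rw [norm1]
  push_cast
  refine Finset.sum_congr rfl fun i _ => ?_
  rw [PiLp.norm_single, Real.norm_eq_abs, Nat.cast_natAbs, Int.cast_abs]

lemma pNorm_smul {p : ENNReal} (hp : 1 ≤ p) (q : ℝ) (x y : Fin k → ℤ)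
    (h : ∀ i, (y i : ℝ) = q * x i) : pNorm p y = |q| * pNorm p x := by
  have : Fact (1 ≤ p) := ⟨hp⟩
  rw [pNorm, pNorm, ← Real.norm_eq_abs, ← norm_smul]
  congr 1
  ext i
  simp [h i]

lemma norm1_le_of_pNorm_le {p : ENNReal} (hp : 1 ≤ p) {x : Fin k → ℤ} {a : ℕ}
    (h : pNorm p x ≤ a) : norm1 x ≤ k * a := by
  rw [norm1]
  calc ∑ i, (x i).natAbs ≤ ∑ _i : Fin k, a := by
        refine Finset.sum_le_sum fun i _ => ?_
        have := (abs_le_pNorm hp x i).trans h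
        rw [← Int.cast_abs, Int.abs_eq_natAbs] at this
        exact_mod_cast this
    _ = k * a := by simp

lemma norm1_sub_le (x y : Fin k → ℤ) : norm1 (y - x) ≤ norm1 x + norm1 y := by
  rw [norm1, norm1, norm1, ← Finset.sum_add_distrib]
  refine Finset.sum_le_sum fun i _ => ?_
  rw [Pi.sub_apply]; omega

/-- A shortest vector generates all lattice vectors that are proportional to it. -/
lemma IsShortest.mem_zmultiples {p : ENNReal} (hp : 1 ≤ p) {L : AddSubgroup (Fin k → ℤ)}
    {v : Fin k → ℤ} (hv : IsShortest p L v) {x : Fin k → ℤ} (hx : x ∈ L)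
    (hxv : Proportional x v) : x ∈ AddSubgroup.zmultiples v := by
  obtain ⟨q, hq⟩ := hxv
  -- the difference to the nearest multiple of `v` is at most half as long as `v`
  have hy : x - round q • v ∈ L := L.sub_mem hx (L.zsmul_mem hv.1 _)
  have hval : ∀ i, (((x - round q • v) i : ℤ) : ℝ) = ((q - round q : ℚ) : ℝ) * (v i : ℝ) := by
    intro i
    have h : (x i : ℝ) = (q : ℝ) * (v i : ℝ) := by
      exact_mod_cast congrArg (Rat.cast (K := ℝ)) (hq i)
    simp only [Pi.sub_apply, Pi.smul_apply, smul_eq_mul]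
    push_cast
    rw [h]; ring
  have hnorm := pNorm_smul hp _ v _ hval
  have hround : |((q - round q : ℚ) : ℝ)| ≤ 1 / 2 := by
    have h : ((|q - round q| : ℚ) : ℝ) ≤ ((1 / 2 : ℚ) : ℝ) := Rat.cast_le.2 (abs_sub_round q)
    rw [Rat.cast_abs] at h
    exact h.trans_eq (by norm_num)
  have hvpos : 0 < pNorm p v := by
    obtain ⟨i, hi⟩ := Function.ne_iff.1 hv.2.1
    refine lt_of_lt_of_le ?_ (abs_le_pNorm hp v i)
    rw [abs_pos]
    exact_mod_cast hi
  by_cases h0 : x - round q • v = 0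
  · exact AddSubgroup.mem_zmultiples_iff.2 ⟨round q, (sub_eq_zero.1 h0).symm⟩
  · have := hv.2.2 _ hy h0
    rw [hnorm] at this
    nlinarith

/-- Every generator of the subgroup of a shortest vector is a shortest vector. -/
lemma IsShortest.of_zmultiples_eq {p : ENNReal} (hp : 1 ≤ p) {L : AddSubgroup (Fin k → ℤ)}
    {v w : Fin k → ℤ} (hv : IsShortest p L v)
    (h : AddSubgroup.zmultiples w = AddSubgroup.zmultiples v) : IsShortest p L w := by
  have hw : w ∈ AddSubgroup.zmultiples v := h ▸ AddSubgroup.mem_zmultiples w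
  have hv' : v ∈ AddSubgroup.zmultiples w := h ▸ AddSubgroup.mem_zmultiples v
  obtain ⟨s, rfl⟩ := AddSubgroup.mem_zmultiples_iff.1 hw
  obtain ⟨t, ht⟩ := AddSubgroup.mem_zmultiples_iff.1 hv'
  have hts : t * s = 1 := by
    obtain ⟨i, hi⟩ := Function.ne_iff.1 hv.2.1
    have := congrFun ht i
    simp only [Pi.smul_apply, smul_eq_mul, ← mul_assoc] at this
    exact mul_right_cancel₀ hi (by rw [this, one_mul])
  have hs : |(s : ℝ)| = 1 := by
    rcases Int.isUnit_iff.1 (IsUnit.of_mul_eq_one t (by rw [mul_comm]; exact hts)) with h | h <;>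
      simp [h]
  refine ⟨L.zsmul_mem hv.1 s, ?_, fun x hx hx0 => ?_⟩
  · intro h0
    rw [h0, smul_zero] at ht
    exact hv.2.1 ht.symm
  · rw [pNorm_smul hp (s : ℝ) v (s • v) (by intro i; simp), hs, one_mul]
    exact hv.2.2 x hx hx0

end Norms

/-! ### Bit lengths and the cost of expressions -/

lemma one_le_bitSize (z : ℤ) : 1 ≤ bitSize z := Nat.le_add_left 1 _

lemma bitSize_le_iff {z : ℤ} {n : ℕ} : bitSize z ≤ n + 1 ↔ |z| < 2 ^ n := by
  rw [bitSize, Nat.succ_le_succ_iff, Nat.size_le, Int.abs_eq_natAbs]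
  exact_mod_cast Iff.rfl

lemma abs_lt_two_pow_bitSize (z : ℤ) : |z| < 2 ^ (bitSize z - 1) :=
  bitSize_le_iff.1 (by have := one_le_bitSize z; omega)

lemma bitSize_mono {x y : ℤ} (h : |x| ≤ |y|) : bitSize x ≤ bitSize y := by
  have h1 := abs_lt_two_pow_bitSize y
  have h2 := one_le_bitSize y
  have h3 := bitSize_le_iff.2 (h.trans_lt h1)
  omega

lemma bitSize_zero : bitSize 0 = 1 := by simp [bitSize]

lemma bitSize_one : bitSize 1 = 2 := by simp [bitSize]

lemma bitSize_neg (x : ℤ) : bitSize (-x) = bitSize x := by simp [bitSize]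

lemma bitSize_le_of_abs_lt {z : ℤ} {n m : ℕ} (h : |z| < 2 ^ n) (hm : n + 1 ≤ m) : bitSize z ≤ m :=
  (bitSize_le_iff.2 h).trans hm

lemma bitSize_natCast_le (n : ℕ) : bitSize n ≤ n + 1 :=
  bitSize_le_iff.2 (by rw [Nat.abs_cast]; exact_mod_cast Nat.lt_two_pow_self)

lemma bitSize_add_le (x y : ℤ) : bitSize (x + y) ≤ bitSize x + bitSize y := by
  by_cases hx : x = 0
  · subst hx; simp
  by_cases hy : y = 0
  · subst hy; simp
  have h1 := abs_lt_two_pow_bitSize x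
  have h2 := abs_lt_two_pow_bitSize y
  have hx2 : 2 ≤ bitSize x := by
    have : 0 < Nat.size x.natAbs := Nat.size_pos.2 (Int.natAbs_pos.2 hx)
    rw [bitSize]; omega
  have hy2 : 2 ≤ bitSize y := by
    have : 0 < Nat.size y.natAbs := Nat.size_pos.2 (Int.natAbs_pos.2 hy)
    rw [bitSize]; omega
  have h3 := abs_add_le x y
  have h4 : (2 : ℤ) ^ (bitSize x - 1) ≤ 2 ^ (bitSize x + bitSize y - 2) :=
    pow_le_pow_right₀ (by norm_num) (by omega)
  have h5 : (2 : ℤ) ^ (bitSize y - 1) ≤ 2 ^ (bitSize x + bitSize y - 2) :=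
    pow_le_pow_right₀ (by norm_num) (by omega)
  have h6 : (2 : ℤ) ^ (bitSize x + bitSize y - 1) = 2 * 2 ^ (bitSize x + bitSize y - 2) := by
    rw [← pow_succ']; congr 1; omega
  refine bitSize_le_of_abs_lt (n := bitSize x + bitSize y - 1) ?_ (by omega)
  omega

lemma bitSize_mul_le (x y : ℤ) : bitSize (x * y) ≤ bitSize x + bitSize y := by
  have h1 := abs_lt_two_pow_bitSize x
  have h2 := abs_lt_two_pow_bitSize y
  refine bitSize_le_of_abs_lt (n := (bitSize x - 1) + (bitSize y - 1)) ?_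
    (by have := one_le_bitSize x; have := one_le_bitSize y; omega)
  rw [abs_mul, pow_add]
  exact mul_lt_mul'' h1 h2 (abs_nonneg _) (abs_nonneg _)

lemma BinOp.bitSize_eval_le (o : BinOp) (x y : ℤ) :
    bitSize (o.eval x y) ≤ bitSize x + bitSize y := by
  have hx := one_le_bitSize x
  have hy := one_le_bitSize y
  cases o with
  | add => exact bitSize_add_le x y
  | sub =>
    have := bitSize_add_le x (-y)
    rwa [bitSize_neg, ← sub_eq_add_neg] at this
  | mul => exact bitSize_mul_le x y
  | div =>
    refine (bitSize_mono ?_).trans (Nat.le_add_right _ _)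
    exact Int.abs_ediv_le_abs x y
  | mod =>
    show bitSize (x % y) ≤ _
    by_cases h : y = 0
    · rw [h, Int.emod_zero]; exact Nat.le_add_right _ _
    · refine (bitSize_mono ?_).trans (Nat.le_add_left _ _)
      rw [abs_of_nonneg (Int.emod_nonneg x h)]
      exact (Int.emod_lt_abs x h).le
  | le =>
    show bitSize (if x ≤ y then 1 else 0) ≤ _
    split
    · rw [bitSize_one]; omega
    · rw [bitSize_zero]; omega

/-- A constant such that an expression costs at most that many times the bit length of the entries
of the memory. -/
def CExp.weight : CExp → ℕ
  | const z => bitSize z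
  | get _ i => i.weight + 1
  | op _ d e => 2 * (d.weight + e.weight)

lemma CExp.bitSize_eval_le_cost (S : Store) (e : CExp) : bitSize (e.eval S) ≤ e.cost S := by
  cases e <;> simp [CExp.eval, CExp.cost]

lemma CExp.one_le_cost (S : Store) (e : CExp) : 1 ≤ e.cost S :=
  (one_le_bitSize _).trans (e.bitSize_eval_le_cost S)

/-- All entries of the classical memory have at most `σ` bits. -/
def MemBits (σ : ℕ) (S : Store) : Prop := ∀ A i, bitSize (S A i) ≤ σ

lemma MemBits.one_le {σ : ℕ} {S : Store} (h : MemBits σ S) : 1 ≤ σ :=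
  (one_le_bitSize _).trans (h 0 0)

lemma CExp.cost_le {σ : ℕ} {S : Store} (h : MemBits σ S) (e : CExp) :
    e.cost S ≤ e.weight * σ := by
  induction e with
  | const z => exact Nat.le_mul_of_pos_right _ h.one_le
  | get A i ih =>
    simp only [CExp.cost, CExp.weight]
    have := h A (i.eval S)
    nlinarith
  | op o d e hd he =>
    simp only [CExp.cost, CExp.weight]
    have h1 := o.bitSize_eval_le (d.eval S) (e.eval S)
    have h2 := d.bitSize_eval_le_cost S
    have h3 := e.bitSize_eval_le_cost S
    nlinarith

lemma put_same {α : Type} (S : ℕ → ℤ → α) (A : ℕ) (i : ℤ) (z : α) : put S A i z A i = z := by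
  simp [put]

lemma put_of_ne {α : Type} (S : ℕ → ℤ → α) {A B : ℕ} (i : ℤ) (z : α) (h : B ≠ A) :
    put S A i z B = S B := by
  simp [put, h]

lemma put_index_of_ne {α : Type} (S : ℕ → ℤ → α) (A : ℕ) {i j : ℤ} (z : α) (h : j ≠ i) :
    put S A i z A j = S A j := by
  simp [put, h]

lemma put_apply {α : Type} (S : ℕ → ℤ → α) (A B : ℕ) (i j : ℤ) (z : α) :
    put S A i z B j = if B = A ∧ j = i then z else S B j := by
  by_cases h : B = A
  · subst h
    by_cases h' : j = i
    · subst h'; simp [put]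
    · simp [put, h']
  · simp [put, h]

lemma MemBits.put {σ : ℕ} {S : Store} (h : MemBits σ S) {A : ℕ} {i z : ℤ} (hz : bitSize z ≤ σ) :
    MemBits σ (HSP.put S A i z) := by
  intro B j
  rw [put_apply]
  split
  · exact hz
  · exact h B j

/-! ### A logic for commands without branching -/

/-- From every state that satisfies `P`, the command ends in exactly one branch, which satisfies
`Q`, after time at most `δ`, when loops are cut off after `N` tests. -/
def Run (N : ℕ) (P : Store → (Basis →₀ ℂ) → Prop) (c : Cmd) (Q : Store → (Basis →₀ ℂ) → Prop)
    (δ : ℕ) : Prop :=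
  ∀ s : State, P s.mem s.amp →
    ∃ s', exec noOracle N c s = {s'} ∧ Q s'.mem s'.amp ∧ s'.time ≤ s.time + δ

section Run

variable {N : ℕ} {P P' Q Q' I : Store → (Basis →₀ ℂ) → Prop} {c d : Cmd} {δ δ' : ℕ}

lemma Run.mono (h : Run N P c Q δ) (hP : ∀ S ψ, P' S ψ → P S ψ) (hQ : ∀ S ψ, Q S ψ → Q' S ψ)
    (hδ : δ ≤ δ') : Run N P' c Q' δ' := by
  intro s hs
  obtain ⟨s', h1, h2, h3⟩ := h s (hP _ _ hs)
  exact ⟨s', h1, hQ _ _ h2, h3.trans (Nat.add_le_add_left hδ _)⟩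

lemma Run.seq (h : Run N P c I δ) (h' : Run N I d Q δ') : Run N P (c.seq d) Q (δ + δ') := by
  intro s hs
  obtain ⟨s', h1, h2, h3⟩ := h s hs
  obtain ⟨s'', h4, h5, h6⟩ := h' s' h2
  refine ⟨s'', ?_, h5, by omega⟩
  rw [exec, h1, Multiset.singleton_bind, h4]

lemma Run.assign {A : ℕ} {i e : CExp} {σ : ℕ}
    (h : ∀ S ψ, P S ψ → MemBits σ S ∧ Q (put S A (i.eval S) (e.eval S)) ψ) :
    Run N P (.assign A i e) Q ((i.weight + e.weight) * σ) := by
  intro s hs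
  obtain ⟨h1, h2⟩ := h _ _ hs
  refine ⟨_, rfl, h2, ?_⟩
  have := i.cost_le h1
  have := e.cost_le h1
  simp only
  rw [Nat.add_mul]
  omega

/-- The loop that runs `B[0]` through `0, …, n - 1`. -/
def forLoop (B : ℕ) (n : CExp) (body : Cmd) : Cmd :=
  .seq (.assign B (.const 0) (.const 0))
    (.whileDo (.op .le (.op .add (.get B (.const 0)) (.const 1)) n)
      (.seq body (.assign B (.const 0) (.op .add (.get B (.const 0)) (.const 1)))))

/-- The rule for loops. The invariant `Inv t` holds before the round in which `B[0]` is `t`; the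
body may not change `B[0]`. -/
lemma Run.forLoop {B : ℕ} {nE : CExp} {body : Cmd} {n σ : ℕ}
    {Inv : ℕ → Store → (Basis →₀ ℂ) → Prop} (hN : n < N)
    (h0 : ∀ S ψ, P S ψ → MemBits σ S ∧ Inv 0 (put S B 0 0) ψ)
    (hI : ∀ t ≤ n, ∀ S ψ, Inv t S ψ → MemBits σ S ∧ S B 0 = t ∧ nE.eval S = n)
    (hb : ∀ t < n, Run N (Inv t) body
      (fun S ψ => MemBits σ S ∧ S B 0 = t ∧ Inv (t + 1) (put S B 0 (t + 1 : ℕ)) ψ) δ) :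
    Run N P (HSP.forLoop B nE body) (Inv n) ((n + 1) * (δ + (100 + 2 * nE.weight) * σ)) := by
  have b0 : bitSize 0 = 1 := bitSize_zero
  have b1 : bitSize 1 = 2 := bitSize_one
  set cond : CExp := .op .le (.op .add (.get B (.const 0)) (.const 1)) nE with hcond
  have hcw : cond.weight = 16 + 2 * nE.weight := by
    simp only [hcond, CExp.weight, b0, b1]; omega
  set step : Cmd := .assign B (.const 0) (.op .add (.get B (.const 0)) (.const 1)) with hstep
  have hstepRun : ∀ t : ℕ, Run N
      (fun S ψ => MemBits σ S ∧ S B 0 = t ∧ Inv (t + 1) (put S B 0 (t + 1 : ℕ)) ψ) step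
      (Inv (t + 1)) (9 * σ) := by
    intro t
    refine (Run.assign (σ := σ) ?_).mono (fun _ _ h => h) (fun _ _ h => h) ?_
    · rintro S ψ ⟨h1, h2, h3⟩
      refine ⟨h1, ?_⟩
      simpa [CExp.eval, BinOp.eval, h2] using h3
    · simp only [CExp.weight, b0, b1]; omega
  have key : ∀ j t, t + j = n → ∀ M, j < M → ∀ s : State, Inv t s.mem s.amp →
      ∃ s', loop cond (exec noOracle N (body.seq step)) M s = {s'} ∧ Inv n s'.mem s'.amp ∧
        s'.time ≤ s.time + j * (δ + 9 * σ) + (j + 1) * (cond.weight * σ) := by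
    intro j
    induction j with
    | zero =>
      intro t ht M hM s hs
      obtain ⟨M, rfl⟩ : ∃ M', M = M' + 1 := ⟨M - 1, by omega⟩
      obtain ⟨hm, hB, hn⟩ := hI t (by omega) _ _ hs
      have hc : cond.eval s.mem = 0 := by
        simp only [hcond, CExp.eval, BinOp.eval, hB, hn]
        rw [if_neg]; omega
      refine ⟨{ s with time := s.time + cond.cost s.mem }, ?_, ?_, ?_⟩
      · rw [loop]; simp [hc]
      · obtain rfl : t = n := by omega
        exact hs
      · have := cond.cost_le hm
        simp only; omega
    | succ j ih =>
      intro t ht M hM s hs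
      obtain ⟨M, rfl⟩ : ∃ M', M = M' + 1 := ⟨M - 1, by omega⟩
      obtain ⟨hm, hB, hn⟩ := hI t (by omega) _ _ hs
      have hc : cond.eval s.mem ≠ 0 := by
        simp only [hcond, CExp.eval, BinOp.eval, hB, hn]
        rw [if_pos (by omega)]; norm_num
      obtain ⟨s1, h1, h2, h3⟩ := ((hb t (by omega)).seq (hstepRun t))
        { s with time := s.time + cond.cost s.mem } hs
      obtain ⟨s2, h4, h5, h6⟩ := ih (t + 1) (by omega) M (by omega) s1 h2
      refine ⟨s2, ?_, h5, ?_⟩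
      · rw [loop]
        simp only [hc, if_false]
        rw [h1, Multiset.singleton_bind, h4]
      · have := cond.cost_le hm
        simp only at h3
        have e1 : (j + 1) * (δ + 9 * σ) = j * (δ + 9 * σ) + (δ + 9 * σ) := by ring
        have e2 : (j + 1 + 1) * (cond.weight * σ) =
          (j + 1) * (cond.weight * σ) + cond.weight * σ := by ring
        omega
  have h1 : Run N P (.assign B (.const 0) (.const 0)) (Inv 0) (2 * σ) := by
    refine (Run.assign (σ := σ) ?_).mono (fun _ _ h => h) (fun _ _ h => h) ?_
    · intro S ψ h
      simpa [CExp.eval] using h0 S ψ h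
    · simp only [CExp.weight, b0]; omega
  have h2 : Run N (Inv 0) (.whileDo cond (body.seq step)) (Inv n)
      (n * (δ + 9 * σ) + (n + 1) * (cond.weight * σ)) := by
    intro s hs
    obtain ⟨s', h1, h2, h3⟩ := key n 0 (by omega) N hN s hs
    exact ⟨s', by rw [exec, h1], h2, by omega⟩
  refine (h1.seq h2).mono (fun _ _ h => h) (fun _ _ h => h) ?_
  rw [hcw]
  nlinarith [Nat.zero_le (n * σ), Nat.zero_le σ, Nat.zero_le (n * nE.weight * σ),
    Nat.zero_le (nE.weight * σ)]

end Run

/-! ### Programs for sums and powers -/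

/-- The memory agrees with `μ`, except for the loop counters in array `3`, and has at most `σ` bits
per entry; the quantum state is `ψ₀`. -/
def Agree (σ : ℕ) (μ : Store) (ψ₀ : Basis →₀ ℂ) (S : Store) (ψ : Basis →₀ ℂ) : Prop :=
  (∀ B ≠ 3, S B = μ B) ∧ MemBits σ S ∧ ψ = ψ₀

/-- `A[off + c] := A[off + c] + ∑ r < n, e` for all `c < L`. The expression `e` reads `c` and `r`
from `3[1]` and `3[2]`. -/
def dotLoop (A : ℕ) (off L n e : CExp) : Cmd :=
  forLoop 3 (.op .mul L n)
    (.seq (.assign 3 (.const 1) (.op .div (.get 3 (.const 0)) n))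
      (.seq (.assign 3 (.const 2) (.op .mod (.get 3 (.const 0)) n))
        (.assign A (.op .add off (.get 3 (.const 1)))
          (.op .add (.get A (.op .add off (.get 3 (.const 1)))) e))))

/-- A bound for the cost of one round of `dotLoop`, per bit of the entries of the memory. -/
def dotWeight (off L n e : CExp) : ℕ :=
  200 + 4 * off.weight + 4 * L.weight + 10 * n.weight + 2 * e.weight + 4 * off.weight

lemma bitSize_le_of_le {m n σ : ℕ} (h : bitSize n ≤ σ) (hm : m ≤ n) : bitSize m ≤ σ :=
  (bitSize_mono (by simpa using hm)).trans h

/-- In a memory in which the cells `A[off + c]` are empty, `dotLoop` stores the sums there. The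
value of `e` may not depend on the array `A`. -/
lemma dotLoop_run {N σ : ℕ} {A : ℕ} {off L n e : CExp} {μ : Store} {ψ₀ : Basis →₀ ℂ}
    {o l' n' : ℕ} {E : ℕ → ℕ → ℤ} (hA : A ≠ 3)
    (hc : ∀ S : Store, (∀ B, B ≠ 3 → B ≠ A → S B = μ B) →
      off.eval S = o ∧ L.eval S = l' ∧ n.eval S = n')
    (he : ∀ S : Store, (∀ B, B ≠ 3 → B ≠ A → S B = μ B) → ∀ c < l', ∀ r < n',
      S 3 1 = c → S 3 2 = r → e.eval S = E c r)
    (h0 : ∀ c < l', μ A (o + c) = 0)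
    (hbits : ∀ c < l', ∀ j ≤ n', bitSize (∑ r ∈ Finset.range j, E c r) ≤ σ)
    (hcnt : bitSize (l' * n' : ℕ) ≤ σ) (hN : l' * n' < N) :
    ∃ μ' : Store, (∀ B ≠ A, μ' B = μ B) ∧
      (∀ c < l', μ' A (o + c) = ∑ r ∈ Finset.range n', E c r) ∧
      (∀ z : ℤ, (∀ c < l', z ≠ o + c) → μ' A z = μ A z) ∧
      Run N (Agree σ μ ψ₀) (dotLoop A off L n e) (Agree σ μ' ψ₀)
        ((l' * n' + 1) * (dotWeight off L n e * σ)) := by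
  let part : ℕ → ℤ → ℤ := fun t z =>
    if o ≤ z ∧ z < o + l' then
      ∑ r ∈ Finset.range (min n' (t - (z - o).toNat * n')), E (z - o).toNat r
    else μ A z
  have part_in : ∀ t c, c < l' →
      part t (o + c) = ∑ r ∈ Finset.range (min n' (t - c * n')), E c r := by
    intro t c hc
    have h1 : ((o : ℤ) + c - o).toNat = c := by omega
    simp only [part, h1]
    rw [if_pos (by omega)]
  have part_out : ∀ t (z : ℤ), (∀ c < l', z ≠ o + c) → part t z = μ A z := by
    intro t z h
    simp only [part]
    rw [if_neg]
    rintro ⟨h1, h2⟩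
    exact h (z - o).toNat (by omega) (by omega)
  have part_zero : part 0 = μ A := by
    funext z
    by_cases h : ∀ c < l', z ≠ o + c
    · exact part_out 0 z h
    · push Not at h
      obtain ⟨c, hc, rfl⟩ := h
      rw [part_in 0 c hc, h0 c hc]
      simp
  let Inv : ℕ → Store → (Basis →₀ ℂ) → Prop := fun t S ψ =>
    (∀ B, B ≠ 3 → B ≠ A → S B = μ B) ∧ S A = part t ∧ S 3 0 = t ∧ MemBits σ S ∧ ψ = ψ₀
  have hcnt' : ∀ m ≤ l' * n', bitSize (m : ℕ) ≤ σ := fun m hm => bitSize_le_of_le hcnt hm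
  let μ' : Store := Function.update μ A (part (l' * n'))
  have hbody : ∀ t < l' * n', Run N (Inv t)
      (.seq (.assign 3 (.const 1) (.op .div (.get 3 (.const 0)) n))
      (.seq (.assign 3 (.const 2) (.op .mod (.get 3 (.const 0)) n))
        (.assign A (.op .add off (.get 3 (.const 1)))
          (.op .add (.get A (.op .add off (.get 3 (.const 1)))) e))))
      (fun S ψ => MemBits σ S ∧ S 3 0 = t ∧ Inv (t + 1) (put S 3 0 (t + 1 : ℕ)) ψ)
      ((60 + 4 * n.weight + 6 * off.weight + 2 * e.weight) * σ) := by
    intro t ht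
    have hn' : 0 < n' := by
      rcases Nat.eq_zero_or_pos n' with h | h
      · rw [h] at ht; omega
      · exact h
    have hdl : t / n' < l' := Nat.div_lt_of_lt_mul (by rwa [mul_comm])
    have hmod : t % n' < n' := Nat.mod_lt _ hn'
    have hdm : t / n' * n' + t % n' = t := by rw [mul_comm]; exact Nat.div_add_mod t n'
    have r1 : Run N (Inv t) (.assign 3 (.const 1) (.op .div (.get 3 (.const 0)) n))
        (fun S ψ => Inv t S ψ ∧ S 3 1 = (t / n' : ℕ)) ((12 + 2 * n.weight) * σ) := by
      refine (Run.assign (σ := σ) ?_).mono (fun _ _ h => h) (fun _ _ h => h) ?_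
      · rintro S ψ ⟨h1, h2, h3, h4, h5⟩
        have hv : (CExp.op .div (.get 3 (.const 0)) n).eval S = (t / n' : ℕ) := by
          simp only [CExp.eval, BinOp.eval, h3, (hc S h1).2.2]
          push_cast; rfl
        refine ⟨h4, ⟨fun B hB hBA => by rw [put_of_ne _ _ _ hB]; exact h1 B hB hBA, ?_, ?_, ?_, h5⟩,
          ?_⟩
        · rw [put_of_ne _ _ _ hA, h2]
        · rw [put_index_of_ne _ _ _ (by simp [CExp.eval]), h3]
        · rw [hv]
          exact h4.put (hcnt' _ ((Nat.div_le_self _ _).trans ht.le))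
        · rw [hv]; exact put_same _ _ _ _
      · simp only [CExp.weight, bitSize_one, bitSize_zero]
        exact Nat.mul_le_mul_right _ (by omega)
    have r2 : Run N (fun S ψ => Inv t S ψ ∧ S 3 1 = (t / n' : ℕ))
        (.assign 3 (.const 2) (.op .mod (.get 3 (.const 0)) n))
        (fun S ψ => Inv t S ψ ∧ S 3 1 = (t / n' : ℕ) ∧ S 3 2 = (t % n' : ℕ))
        ((12 + 2 * n.weight) * σ) := by
      refine (Run.assign (σ := σ) ?_).mono (fun _ _ h => h) (fun _ _ h => h) ?_
      · rintro S ψ ⟨⟨h1, h2, h3, h4, h5⟩, h6⟩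
        have hv : (CExp.op .mod (.get 3 (.const 0)) n).eval S = (t % n' : ℕ) := by
          simp only [CExp.eval, BinOp.eval, h3, (hc S h1).2.2]
          push_cast; rfl
        refine ⟨h4, ⟨fun B hB hBA => by rw [put_of_ne _ _ _ hB]; exact h1 B hB hBA, ?_, ?_, ?_, h5⟩,
          ?_, ?_⟩
        · rw [put_of_ne _ _ _ hA, h2]
        · rw [put_index_of_ne _ _ _ (by simp [CExp.eval]), h3]
        · rw [hv]
          exact h4.put (hcnt' _ ((Nat.mod_le _ _).trans ht.le))
        · rw [put_index_of_ne _ _ _ (by simp [CExp.eval]), h6]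
        · rw [hv]; exact put_same _ _ _ _
      · simp only [CExp.weight, bitSize_zero]
        have : bitSize 2 = 3 := by decide +kernel
        rw [this]
        exact Nat.mul_le_mul_right _ (by omega)
    have r3 : Run N (fun S ψ => Inv t S ψ ∧ S 3 1 = (t / n' : ℕ) ∧ S 3 2 = (t % n' : ℕ))
        (.assign A (.op .add off (.get 3 (.const 1)))
          (.op .add (.get A (.op .add off (.get 3 (.const 1)))) e))
        (fun S ψ => MemBits σ S ∧ S 3 0 = t ∧ Inv (t + 1) (put S 3 0 (t + 1 : ℕ)) ψ)
        ((36 + 6 * off.weight + 2 * e.weight) * σ) := by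
      refine (Run.assign (σ := σ) ?_).mono (fun _ _ h => h) (fun _ _ h => h) ?_
      · rintro S ψ ⟨⟨h1, h2, h3, h4, h5⟩, h6, h7⟩
        have hi : (CExp.op .add off (.get 3 (.const 1))).eval S = o + (t / n' : ℕ) := by
          simp only [CExp.eval, BinOp.eval, h6, (hc S h1).1]
        have hv : (CExp.op .add (.get A (.op .add off (.get 3 (.const 1)))) e).eval S =
            part (t + 1) (o + (t / n' : ℕ)) := by
          have := he S h1 _ hdl _ hmod h6 h7
          simp only [CExp.eval, BinOp.eval, h6, (hc S h1).1, this, h2]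
          rw [part_in _ _ hdl, part_in _ _ hdl]
          rw [show min n' (t - t / n' * n') = t % n' by omega,
            show min n' (t + 1 - t / n' * n') = t % n' + 1 by omega, Finset.sum_range_succ]
        rw [hi, hv]
        have hbit : bitSize (part (t + 1) (o + (t / n' : ℕ))) ≤ σ := by
          rw [part_in _ _ hdl]
          exact hbits _ hdl _ (min_le_left _ _)
        have hpart : put S A (o + (t / n' : ℕ)) (part (t + 1) (o + (t / n' : ℕ))) A =
            part (t + 1) := by
          funext z
          rw [put_apply]
          by_cases hz : z = o + (t / n' : ℕ)
          · rw [if_pos ⟨rfl, hz⟩, hz]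
          · rw [if_neg (fun h => hz h.2), h2]
            by_cases h : ∀ c < l', z ≠ o + c
            · rw [part_out _ _ h, part_out _ _ h]
            · push Not at h
              obtain ⟨c, hc, rfl⟩ := h
              rw [part_in _ _ hc, part_in _ _ hc]
              have hne : c ≠ t / n' := fun h => hz (by rw [h])
              congr 2
              -- a row that is not the current one is either complete or not yet begun
              rcases lt_or_gt_of_ne hne with h | h
              · have : (c + 1) * n' ≤ t / n' * n' := Nat.mul_le_mul_right _ h
                rw [Nat.add_mul] at this
                omega
              · have : (t / n' + 1) * n' ≤ c * n' := Nat.mul_le_mul_right _ h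
                rw [Nat.add_mul] at this
                omega
        refine ⟨h4, h4.put hbit, ?_, ?_, ?_, put_same _ _ _ _, (h4.put hbit).put (hcnt' _ ht), h5⟩
        · rw [put_of_ne _ _ _ (Ne.symm hA), h3]
        · intro B hB hBA
          rw [put_of_ne _ _ _ hB, put_of_ne _ _ _ hBA, h1 B hB hBA]
        · rw [put_of_ne _ _ _ hA, hpart]
      · simp only [CExp.weight, bitSize_one]
        exact Nat.mul_le_mul_right _ (by omega)
    refine (r1.seq (r2.seq r3)).mono (fun _ _ h => h) (fun _ _ h => h) ?_
    rw [← Nat.add_mul, ← Nat.add_mul]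
    exact Nat.mul_le_mul_right _ (by omega)
  have hrun := Run.forLoop (P := Agree σ μ ψ₀) (nE := .op .mul L n) (σ := σ) (Inv := Inv) hN
    ?_ ?_ hbody
  · refine ⟨μ', fun B hB => by simp [μ', hB], ?_, ?_, hrun.mono (fun _ _ h => h) ?_ ?_⟩
    · intro c hcl
      simp only [μ', Function.update_self]
      rw [part_in _ _ hcl]
      have : (c + 1) * n' ≤ l' * n' := Nat.mul_le_mul_right _ hcl
      rw [Nat.add_mul] at this
      rw [show min n' (l' * n' - c * n') = n' by omega]
    · intro z hz
      simp only [μ', Function.update_self]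
      exact part_out _ _ hz
    · rintro S ψ ⟨h1, h2, h3, h4, h5⟩
      refine ⟨fun B hB => ?_, h4, h5⟩
      by_cases hBA : B = A
      · subst hBA; simp [μ', h2]
      · simp [μ', hBA, h1 B hB hBA]
    · rw [← Nat.add_mul]
      refine Nat.mul_le_mul_left _ (Nat.mul_le_mul_right _ ?_)
      simp only [CExp.weight, dotWeight]
      omega
  · rintro S ψ ⟨h1, h2, h3⟩
    refine ⟨h2, ?_, ?_, put_same _ _ _ _, h2.put (by rw [bitSize_zero]; exact h2.one_le), h3⟩
    · intro B hB _
      rw [put_of_ne _ _ _ hB, h1 B hB]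
    · rw [put_of_ne _ _ _ hA, h1 A hA, part_zero]
  · rintro t ht S ψ ⟨h1, h2, h3, h4, h5⟩
    refine ⟨h4, h3, ?_⟩
    simp only [CExp.eval, BinOp.eval, hc S h1]
    push_cast; rfl

/-- `A[i] := b ^ i` for all `i ≤ n`. -/
def powLoop (A : ℕ) (b n : CExp) : Cmd :=
  .seq (.assign A (.const 0) (.const 1))
    (forLoop 3 n (.assign A (.op .add (.get 3 (.const 0)) (.const 1))
      (.op .mul b (.get A (.get 3 (.const 0))))))

/-- A bound for the cost of one round of `powLoop`, per bit of the entries of the memory. -/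
def powWeight (b n : CExp) : ℕ := 200 + 2 * b.weight + 2 * n.weight

lemma powLoop_run {N σ : ℕ} {A : ℕ} {b n : CExp} {μ : Store} {ψ₀ : Basis →₀ ℂ}
    {n' : ℕ} {b' : ℤ} (hA : A ≠ 3)
    (hc : ∀ S : Store, (∀ B, B ≠ 3 → B ≠ A → S B = μ B) → b.eval S = b' ∧ n.eval S = n')
    (hbits : ∀ i ≤ n', bitSize (b' ^ i) ≤ σ)
    (hcnt : bitSize n' ≤ σ) (hN : n' < N) :
    ∃ μ' : Store, (∀ B ≠ A, μ' B = μ B) ∧ (∀ i ≤ n', μ' A i = b' ^ i) ∧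
      Run N (Agree σ μ ψ₀) (powLoop A b n) (Agree σ μ' ψ₀) ((n' + 2) * (powWeight b n * σ)) := by
  let part : ℕ → ℤ → ℤ := fun t z => if 0 ≤ z ∧ z ≤ t then b' ^ z.toNat else μ A z
  let Inv : ℕ → Store → (Basis →₀ ℂ) → Prop := fun t S ψ =>
    (∀ B, B ≠ 3 → B ≠ A → S B = μ B) ∧ S A = part t ∧ S 3 0 = t ∧ MemBits σ S ∧ ψ = ψ₀
  let μ' : Store := Function.update μ A (part n')
  let P1 : Store → (Basis →₀ ℂ) → Prop := fun S ψ =>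
    (∀ B, B ≠ 3 → B ≠ A → S B = μ B) ∧ S A = part 0 ∧ MemBits σ S ∧ ψ = ψ₀
  have r1 : Run N (Agree σ μ ψ₀) (.assign A (.const 0) (.const 1)) P1 (3 * σ) := by
    refine (Run.assign (σ := σ) ?_).mono (fun _ _ h => h) (fun _ _ h => h) ?_
    · rintro S ψ ⟨h1, h2, h3⟩
      refine ⟨h2, fun B hB hBA => ?_, ?_, h2.put ?_, h3⟩
      · rw [put_of_ne _ _ _ hBA, h1 B hB]
      · funext z
        rw [put_apply]
        simp only [CExp.eval, part, true_and, Nat.cast_zero]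
        by_cases hz : z = 0
        · simp [hz]
        · rw [if_neg hz, if_neg (by omega), h1 A hA]
      · simpa [CExp.eval] using hbits 0 (Nat.zero_le _)
    · simp only [CExp.weight, bitSize_one, bitSize_zero]; omega
  have hbody : ∀ t < n', Run N (Inv t) (.assign A (.op .add (.get 3 (.const 0)) (.const 1))
      (.op .mul b (.get A (.get 3 (.const 0)))))
      (fun S ψ => MemBits σ S ∧ S 3 0 = t ∧ Inv (t + 1) (put S 3 0 (t + 1 : ℕ)) ψ)
      ((20 + 2 * b.weight) * σ) := by
    intro t ht
    refine (Run.assign (σ := σ) ?_).mono (fun _ _ h => h) (fun _ _ h => h) ?_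
    · rintro S ψ ⟨h1, h2, h3, h4, h5⟩
      have hi : (CExp.op .add (.get 3 (.const 0)) (.const 1)).eval S = (t + 1 : ℕ) := by
        simp [CExp.eval, BinOp.eval, h3]
      have hv : (CExp.op .mul b (.get A (.get 3 (.const 0)))).eval S = b' ^ (t + 1) := by
        simp only [CExp.eval, BinOp.eval, h3, h2, (hc S h1).1, part]
        rw [if_pos (by omega), pow_succ']
        simp
      rw [hi, hv]
      have hbit := h4.put (A := A) (i := (t + 1 : ℕ)) (hbits (t + 1) ht)
      refine ⟨h4, hbit, ?_, ?_, ?_, put_same _ _ _ _,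
        hbit.put (bitSize_le_of_le hcnt ht), h5⟩
      · rw [put_of_ne _ _ _ (Ne.symm hA), h3]
      · intro B hB hBA
        rw [put_of_ne _ _ _ hB, put_of_ne _ _ _ hBA, h1 B hB hBA]
      · rw [put_of_ne _ _ _ hA]
        funext z
        rw [put_apply]
        simp only [true_and, part, h2]
        by_cases hz : z = (t + 1 : ℕ)
        · rw [if_pos hz, hz, if_pos (by omega)]
          simp
        · rw [if_neg hz]
          have : (0 ≤ z ∧ z ≤ (t : ℤ)) ↔ (0 ≤ z ∧ z ≤ ((t + 1 : ℕ) : ℤ)) := by omega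
          simp only [this]
    · simp only [CExp.weight, bitSize_one, bitSize_zero]
      exact Nat.mul_le_mul_right _ (by omega)
  have hrun := Run.forLoop (P := P1) (nE := n) (σ := σ) (Inv := Inv) hN ?_ ?_ hbody
  · refine ⟨μ', fun B hB => by simp [μ', hB], ?_, (r1.seq hrun).mono (fun _ _ h => h) ?_ ?_⟩
    · intro i hi
      simp only [μ', Function.update_self, part]
      rw [if_pos (by omega)]; simp
    · rintro S ψ ⟨h1, h2, h3, h4, h5⟩
      refine ⟨fun B hB => ?_, h4, h5⟩
      by_cases hBA : B = A
      · subst hBA; simp [μ', h2]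
      · simp [μ', hBA, h1 B hB hBA]
    · rw [← Nat.add_mul, powWeight]
      have e1 : (20 + 2 * b.weight + (100 + 2 * n.weight)) * σ ≤
          (200 + 2 * b.weight + 2 * n.weight) * σ := Nat.mul_le_mul_right _ (by omega)
      have e2 : 3 * σ ≤ (200 + 2 * b.weight + 2 * n.weight) * σ :=
        Nat.mul_le_mul_right _ (by omega)
      calc _ ≤ (200 + 2 * b.weight + 2 * n.weight) * σ +
            (n' + 1) * ((200 + 2 * b.weight + 2 * n.weight) * σ) :=
            Nat.add_le_add e2 (Nat.mul_le_mul_left _ e1)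
        _ = _ := by ring
  · rintro S ψ ⟨h1, h2, h3, h4⟩
    refine ⟨h3, ?_, ?_, put_same _ _ _ _, h3.put (by rw [bitSize_zero]; exact h3.one_le), h4⟩
    · intro B hB hBA
      rw [put_of_ne _ _ _ hB, h1 B hB hBA]
    · rw [put_of_ne _ _ _ hA, h2]
  · rintro t ht S ψ ⟨h1, h2, h3, h4, h5⟩
    exact ⟨h4, h3, (hc S h1).2⟩

/-! ### The numbers that the reduction computes from a basis -/

section Tables

variable (k l : ℕ) (M : ℕ → ℕ → ℤ)

/-- The Gram matrix of the rows of `M`. -/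
def gramN (i j : ℕ) : ℤ := ∑ r ∈ Finset.range k, M i r * M j r

/-- The Faddeev–LeVerrier sequence of the Gram matrix, with natural numbers as indices. -/
def levN : ℕ → ℕ → ℕ → ℤ
  | 0 => fun i j => if i = j then 1 else 0
  | t + 1 => fun i j => ∑ r ∈ Finset.range l, gramN k M i r * levN t r j +
      (if i = j then 1 else 0) *
        ((∑ s ∈ Finset.range l, ∑ r ∈ Finset.range l, gramN k M s r * levN t r s) / (0 - (t + 1)))

/-- The product of the Gram matrix with the sequence `levN`. -/
def levP (t i j : ℕ) : ℤ := ∑ r ∈ Finset.range l, gramN k M i r * levN k l M t r j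

/-- The traces of the matrices `levP`. -/
def levTr (t : ℕ) : ℤ := ∑ s ∈ Finset.range l, levP k l M t s s

/-- The determinant of the Gram matrix, up to sign. -/
def levD : ℤ := levP k l M (l - 1) 0 0

/-- The matrix that computes `levD` times the coordinates of lattice vectors. -/
def levU (i j : ℕ) : ℤ := ∑ r ∈ Finset.range l, levN k l M (l - 1) i r * M r j

/-- The product of the transpose of `M` with `levU`. -/
def levMU (i j : ℕ) : ℤ := ∑ r ∈ Finset.range l, M r i * levU k l M r j

/-- The matrix of `levD` times the orthogonal projection to the complement of the lattice. -/
def levV (i j : ℕ) : ℤ := (if i = j then 1 else 0) * levD k l M - levMU k l M i j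

/-- The sum of the squares of the entries of `levV`. -/
def levVSq : ℤ :=
  ∑ r ∈ Finset.range (k * k), levV k l M (r / k) (r % k) * levV k l M (r / k) (r % k)

/-- A factor that makes the modulus larger than the entries of `levV` times short vectors. -/
def levQ (R : ℕ) : ℤ := (2 * R + 1) * (1 + levVSq k l M)

/-- The modulus of the congruences that describe the lattice. -/
def levMod (R : ℕ) : ℤ := levD k l M * levQ k l M R

/-- The coefficients of the congruences that describe the lattice. -/
def levRow (R : ℕ) (r j : ℕ) : ℤ :=
  if r < l then levQ k l M R * levU k l M r j else levV k l M (r - l) j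

/-- The value of a linear form of `levRow` on a vector. -/
def levForm (R : ℕ) (x : Fin k → ℤ) (r : ℕ) : ℤ := ∑ j : Fin k, levRow k l M R r j * x j

end Tables

section TablesMatrix

open Matrix

variable {k l : ℕ} {M : ℕ → ℕ → ℤ} {B : Matrix (Fin l) (Fin k) ℤ}
  (hB : ∀ (i : Fin l) (j : Fin k), M i j = B i j)

include hB

lemma gramN_eq (i j : Fin l) : gramN k M i j = (B * Bᵀ) i j := by
  rw [gramN, Finset.sum_range, Matrix.mul_apply]
  exact Finset.sum_congr rfl fun r _ => by rw [hB, hB, Matrix.transpose_apply]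

lemma levN_eq (t : ℕ) (i j : Fin l) : levN k l M t i j = leVerrier (B * Bᵀ) t i j := by
  induction t generalizing i j with
  | zero => simp [levN, leVerrier, Matrix.one_apply, Fin.ext_iff]
  | succ t ih =>
    have h : ∀ i j : Fin l, ∑ r ∈ Finset.range l, gramN k M i r * levN k l M t r j =
        (B * Bᵀ * leVerrier (B * Bᵀ) t) i j := by
      intro i j
      rw [Finset.sum_range, Matrix.mul_apply (M := B * Bᵀ)]
      exact Finset.sum_congr rfl fun r _ => by rw [gramN_eq hB, ih]
    rw [levN, leVerrier]
    beta_reduce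
    rw [h, Finset.sum_range, Matrix.add_apply, Matrix.smul_apply, Matrix.one_apply, Matrix.trace]
    congr 1
    rw [Finset.sum_congr rfl fun s _ => h s s, smul_eq_mul, mul_comm, zero_sub]
    simp [Fin.ext_iff]

lemma levP_eq (t : ℕ) (i j : Fin l) :
    levP k l M t i j = (B * Bᵀ * leVerrier (B * Bᵀ) t) i j := by
  rw [levP, Finset.sum_range, Matrix.mul_apply (M := B * Bᵀ)]
  exact Finset.sum_congr rfl fun r _ => by rw [gramN_eq hB, levN_eq hB]

lemma levU_eq (i : Fin l) (j : Fin k) :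
    levU k l M i j = (leVerrier (B * Bᵀ) (l - 1) * B) i j := by
  rw [levU, Finset.sum_range, Matrix.mul_apply]
  exact Finset.sum_congr rfl fun r _ => by rw [levN_eq hB, hB]

lemma levV_eq (i j : Fin k) :
    levV k l M i j =
      (levD k l M • (1 : Matrix (Fin k) (Fin k) ℤ) -
        Bᵀ * (leVerrier (B * Bᵀ) (l - 1) * B)) i j := by
  rw [levV, levMU, Finset.sum_range, Matrix.sub_apply, Matrix.smul_apply, Matrix.one_apply,
    Matrix.mul_apply (M := Bᵀ)]
  congr 1
  · simp [Fin.ext_iff]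
  · exact Finset.sum_congr rfl fun r _ => by rw [levU_eq hB, hB, Matrix.transpose_apply]

lemma mul_leVerrier_eq_levD (hl : 0 < l) (hli : LinearIndependent ℤ B) :
    levD k l M ≠ 0 ∧ B * Bᵀ * leVerrier (B * Bᵀ) (l - 1) = levD k l M • 1 := by
  obtain ⟨d, hd, h⟩ := mul_leVerrier (B * Bᵀ) hl (det_gram_ne_zero hli)
  have : levD k l M = d := by
    have := levP_eq hB (l - 1) ⟨0, hl⟩ ⟨0, hl⟩
    rw [h] at this
    rw [levD]
    simpa using this
  rw [this]
  exact ⟨hd, h⟩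

omit hB in
lemma levVSq_nonneg : 0 ≤ levVSq k l M := Finset.sum_nonneg fun _ _ => mul_self_nonneg _

omit hB in
lemma abs_levV_le (i j : Fin k) : |levV k l M i j| ≤ levVSq k l M := by
  have hlt : (i : ℕ) * k + j < k * k := by
    have := i.2
    have := j.2
    calc (i : ℕ) * k + j < (i : ℕ) * k + k := by omega
      _ = (i + 1) * k := by ring
      _ ≤ k * k := Nat.mul_le_mul_right _ (by omega)
  have h := Finset.single_le_sum (s := Finset.range (k * k))
    (f := fun r => levV k l M (r / k) (r % k) * levV k l M (r / k) (r % k))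
    (fun _ _ => mul_self_nonneg _) (Finset.mem_range.2 hlt)
  have hk : 0 < k := j.pos
  have e1 : ((i : ℕ) * k + j) / k = i := by
    rw [mul_comm, Nat.mul_add_div hk, Nat.div_eq_of_lt j.2, add_zero]
  have e2 : ((i : ℕ) * k + j) % k = j := by
    rw [mul_comm, Nat.mul_add_mod, Nat.mod_eq_of_lt j.2]
  simp only [e1, e2] at h
  refine le_trans ?_ h
  rw [← abs_mul_abs_self]
  rcases eq_or_ne (levV k l M i j) 0 with h0 | h0
  · simp [h0]
  · have := Int.one_le_abs h0
    nlinarith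

omit hB in
lemma levQ_pos (R : ℕ) : 0 < levQ k l M R := by
  have := levVSq_nonneg (k := k) (l := l) (M := M)
  rw [levQ]; positivity

lemma levMod_ne_zero (hl : 0 < l) (hli : LinearIndependent ℤ B) (R : ℕ) :
    levMod k l M R ≠ 0 :=
  mul_ne_zero (mul_leVerrier_eq_levD hB hl hli).1 (levQ_pos R).ne'

lemma levForm_of_lt (R : ℕ) (x : Fin k → ℤ) (i : Fin l) :
    levForm k l M R x i = levQ k l M R * ((leVerrier (B * Bᵀ) (l - 1) * B) *ᵥ x) i := by
  rw [levForm, Matrix.mulVec, dotProduct, Finset.mul_sum]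
  refine Finset.sum_congr rfl fun j _ => ?_
  rw [levRow, if_pos i.2, levU_eq hB, mul_assoc]

lemma levForm_add (R : ℕ) (x : Fin k → ℤ) (i : Fin k) :
    levForm k l M R x (l + i) = ((levD k l M • (1 : Matrix (Fin k) (Fin k) ℤ) -
        Bᵀ * (leVerrier (B * Bᵀ) (l - 1) * B)) *ᵥ x) i := by
  rw [levForm, Matrix.mulVec, dotProduct]
  refine Finset.sum_congr rfl fun j _ => ?_
  rw [levRow, if_neg (by omega), Nat.add_sub_cancel_left, levV_eq hB]

lemma levMod_dvd_levForm (hl : 0 < l) (hli : LinearIndependent ℤ B) (R : ℕ) {x : Fin k → ℤ}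
    (hx : x ∈ latticeOf B) {r : ℕ} (hr : r < l + k) :
    levMod k l M R ∣ levForm k l M R x r := by
  obtain ⟨h1, h2⟩ := dvd_of_mem_latticeOf hli (mul_leVerrier_eq_levD hB hl hli).2 hx
  rcases lt_or_ge r l with h | h
  · rw [levForm_of_lt hB R x ⟨r, h⟩, levMod, mul_comm]
    exact mul_dvd_mul_left _ (h1 _)
  · have := levForm_add hB R x ⟨r - l, by omega⟩
    rw [h2] at this
    simp only [Nat.add_sub_of_le h, Pi.zero_apply] at this
    rw [this]
    exact dvd_zero _

/-- For short vectors, the congruences suffice for membership in the lattice: the last `k` linear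
forms have values less than the modulus, so that they vanish. -/
lemma mem_latticeOf_of_levForm (hl : 0 < l) (hli : LinearIndependent ℤ B) (R : ℕ) {x : Fin k → ℤ}
    (hx : norm1 x ≤ 2 * R) (h : ∀ r < l + k, levMod k l M R ∣ levForm k l M R x r) :
    x ∈ latticeOf B := by
  obtain ⟨hd, -⟩ := mul_leVerrier_eq_levD hB hl hli
  refine mem_latticeOf_of_dvd (N := leVerrier (B * Bᵀ) (l - 1)) hd
    (levQ_pos (k := k) (l := l) (M := M) R).ne' ?_ ?_ ?_
  · exact fun i => (levForm_of_lt hB R x i).symm ▸ h i (by omega)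
  · exact fun i => (levForm_add hB R x i).symm ▸ h (l + i) (by omega)
  · intro i
    rw [← levForm_add hB R x i, levForm]
    have h1 : ∀ j : Fin k, |levRow k l M R (l + i) j * x j| ≤
        levVSq k l M * ((x j).natAbs : ℤ) := by
      intro j
      rw [abs_mul, levRow, if_neg (by omega), Nat.add_sub_cancel_left, Int.abs_eq_natAbs (x j)]
      exact mul_le_mul_of_nonneg_right (abs_levV_le i j) (by positivity)
    have h2 : |∑ j : Fin k, levRow k l M R (l + i) j * x j| ≤ levVSq k l M * (norm1 x : ℤ) := by
      refine (Finset.abs_sum_le_sum_abs _ _).trans ((Finset.sum_le_sum fun j _ => h1 j).trans ?_)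
      rw [← Finset.mul_sum, norm1]
      push_cast; exact le_rfl
    have h3 := levVSq_nonneg (k := k) (l := l) (M := M)
    have h4 : (norm1 x : ℤ) ≤ 2 * R := by exact_mod_cast hx
    have h5 := Int.one_le_abs hd
    have h6 := levQ_pos (k := k) (l := l) (M := M) R
    rw [abs_mul, abs_of_pos h6]
    refine lt_of_lt_of_le (lt_of_le_of_lt h2 ?_) (le_mul_of_one_le_left h6.le h5)
    rw [levQ]
    nlinarith

end TablesMatrix

/-! ### Bounds for these numbers -/

lemma abs_sum_range_le {E : ℕ → ℤ} {n b j : ℕ} (hj : j ≤ 2 ^ b)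
    (h : ∀ r < j, |E r| ≤ 2 ^ n) : |∑ r ∈ Finset.range j, E r| ≤ 2 ^ (b + n) := by
  refine (Finset.abs_sum_le_sum_abs _ _).trans ?_
  refine (Finset.sum_le_sum fun r hr => h r (Finset.mem_range.1 hr)).trans ?_
  rw [Finset.sum_const, Finset.card_range, nsmul_eq_mul, pow_add]
  exact mul_le_mul_of_nonneg_right (by exact_mod_cast hj) (by positivity)

lemma abs_mul_le_two_pow {x y : ℤ} {m n : ℕ} (hx : |x| ≤ 2 ^ m) (hy : |y| ≤ 2 ^ n) :
    |x * y| ≤ 2 ^ (m + n) := by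
  rw [abs_mul, pow_add]
  exact mul_le_mul hx hy (abs_nonneg _) (by positivity)

lemma abs_add_le_two_pow {x y : ℤ} {m n e : ℕ} (hx : |x| ≤ 2 ^ m) (hy : |y| ≤ 2 ^ n)
    (hm : m < e) (hn : n < e) : |x + y| ≤ 2 ^ e := by
  obtain ⟨e, rfl⟩ : ∃ e', e = e' + 1 := ⟨e - 1, by omega⟩
  have h1 : (2 : ℤ) ^ m ≤ 2 ^ e := pow_le_pow_right₀ (by norm_num) (by omega)
  have h2 : (2 : ℤ) ^ n ≤ 2 ^ e := pow_le_pow_right₀ (by norm_num) (by omega)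
  have := abs_add_le x y
  rw [pow_succ]; omega

lemma abs_le_two_pow_mono {x : ℤ} {m n : ℕ} (hx : |x| ≤ 2 ^ m) (h : m ≤ n) : |x| ≤ 2 ^ n :=
  hx.trans (pow_le_pow_right₀ (by norm_num) h)

lemma abs_indicator_mul_le {p : Prop} [Decidable p] {x : ℤ} {n : ℕ} (h : |x| ≤ 2 ^ n) :
    |(if p then 1 else 0) * x| ≤ 2 ^ n := by
  split
  · simpa using h
  · simp

lemma bitSize_le_of_abs_le {z : ℤ} {n m : ℕ} (h : |z| ≤ 2 ^ n) (hm : n + 2 ≤ m) :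
    bitSize z ≤ m :=
  bitSize_le_of_abs_lt (n := n + 1)
    (h.trans_lt (pow_lt_pow_right₀ (by norm_num) (Nat.lt_succ_self n))) hm

section TablesBounds

/-! The partial sums are bounded as well, since the program accumulates the sums in memory. -/

variable {k l X : ℕ} {M : ℕ → ℕ → ℤ} (hk : k ≤ X) (hl : l ≤ X) (hX : 1 ≤ X)
  (hM : ∀ i < l, ∀ j < k, |M i j| ≤ 2 ^ X)

include hk hl hX hM

omit hl hX in
lemma abs_gramN_partial_le {i j n : ℕ} (hi : i < l) (hj : j < l) (hn : n ≤ k) :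
    |∑ r ∈ Finset.range n, M i r * M j r| ≤ 2 ^ (3 * X) := by
  refine abs_le_two_pow_mono (abs_sum_range_le (b := X) (n := X + X) ?_ fun r hr =>
    abs_mul_le_two_pow (hM i hi r (by omega)) (hM j hj r (by omega))) (by omega)
  exact (hn.trans hk).trans Nat.lt_two_pow_self.le

omit hX in
lemma abs_levP_partial_le {t i j n : ℕ} (hi : i < l) (hj : j < l) (hn : n ≤ l)
    (h : ∀ i < l, ∀ j < l, |levN k l M t i j| ≤ 2 ^ (6 * X * t)) :
    |∑ r ∈ Finset.range n, gramN k M i r * levN k l M t r j| ≤ 2 ^ (6 * X * t + 4 * X) := by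
  refine abs_le_two_pow_mono (abs_sum_range_le (b := X) (n := 3 * X + 6 * X * t) ?_ fun r hr =>
    abs_mul_le_two_pow (abs_gramN_partial_le hk hM hi (by omega) le_rfl)
      (h r (by omega) j hj)) (by omega)
  exact (hn.trans hl).trans Nat.lt_two_pow_self.le

omit hX in
lemma abs_levTr_partial_le {t n : ℕ} (hn : n ≤ l)
    (h : ∀ i < l, ∀ j < l, |levN k l M t i j| ≤ 2 ^ (6 * X * t)) :
    |∑ s ∈ Finset.range n, levP k l M t s s| ≤ 2 ^ (6 * X * t + 5 * X) := by
  refine abs_le_two_pow_mono (abs_sum_range_le (b := X) (n := 6 * X * t + 4 * X) ?_ fun r hr =>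
    abs_levP_partial_le hk hl hM (by omega) (by omega) le_rfl h) (by omega)
  exact (hn.trans hl).trans Nat.lt_two_pow_self.le

lemma abs_levN_le (t : ℕ) : ∀ i < l, ∀ j < l, |levN k l M t i j| ≤ 2 ^ (6 * X * t) := by
  induction t with
  | zero =>
    intro i hi j hj
    simp only [levN]
    split <;> simp
  | succ t ih =>
    intro i hi j hj
    rw [levN]
    refine abs_add_le_two_pow (abs_levP_partial_le hk hl hM hi hj le_rfl ih)
      (abs_indicator_mul_le (n := 6 * X * t + 5 * X) ?_) ?_ ?_
    · exact (Int.abs_ediv_le_abs _ _).trans (abs_levTr_partial_le hk hl hM le_rfl ih)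
    · rw [Nat.mul_add]; omega
    · rw [Nat.mul_add]; omega

omit hk hM hX in
lemma levExp_le {t : ℕ} (ht : t ≤ l) : 6 * X * t ≤ 6 * (X * X) := by
  rw [Nat.mul_assoc]; exact Nat.mul_le_mul_left _ (Nat.mul_le_mul_left _ (ht.trans hl))

lemma abs_levN_le' {t i j : ℕ} (ht : t ≤ l) (hi : i < l) (hj : j < l) :
    |levN k l M t i j| ≤ 2 ^ (6 * (X * X)) :=
  abs_le_two_pow_mono (abs_levN_le hk hl hX hM t i hi j hj) (levExp_le hl ht)

lemma abs_levP_le' {t i j n : ℕ} (ht : t ≤ l) (hi : i < l) (hj : j < l) (hn : n ≤ l) :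
    |∑ r ∈ Finset.range n, gramN k M i r * levN k l M t r j| ≤ 2 ^ (6 * (X * X) + 4 * X) :=
  abs_le_two_pow_mono (abs_levP_partial_le hk hl hM hi hj hn (abs_levN_le hk hl hX hM t))
    (by have := levExp_le hl ht; omega)

lemma abs_levTr_le' {t n : ℕ} (ht : t ≤ l) (hn : n ≤ l) :
    |∑ s ∈ Finset.range n, levP k l M t s s| ≤ 2 ^ (6 * (X * X) + 5 * X) :=
  abs_le_two_pow_mono (abs_levTr_partial_le hk hl hM hn (abs_levN_le hk hl hX hM t))
    (by have := levExp_le hl ht; omega)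

lemma abs_levU_le {i j n : ℕ} (hi : i < l) (hj : j < k) (hn : n ≤ l) :
    |∑ r ∈ Finset.range n, levN k l M (l - 1) i r * M r j| ≤ 2 ^ (6 * (X * X) + 2 * X) := by
  refine abs_le_two_pow_mono (abs_sum_range_le (b := X) (n := 6 * (X * X) + X) ?_ fun r hr =>
    abs_mul_le_two_pow (abs_levN_le' hk hl hX hM (by omega) hi (by omega))
      (hM r (by omega) j hj)) (by omega)
  exact (hn.trans hl).trans Nat.lt_two_pow_self.le

lemma abs_levMU_le {i j n : ℕ} (hi : i < k) (hj : j < k) (hn : n ≤ l) :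
    |∑ r ∈ Finset.range n, M r i * levU k l M r j| ≤ 2 ^ (6 * (X * X) + 4 * X) := by
  refine abs_le_two_pow_mono (abs_sum_range_le (b := X) (n := X + (6 * (X * X) + 2 * X)) ?_
    fun r hr => abs_mul_le_two_pow (hM r (by omega) i hi)
      (abs_levU_le hk hl hX hM (by omega) hj le_rfl)) (by omega)
  exact (hn.trans hl).trans Nat.lt_two_pow_self.le

lemma abs_levD_le (hl0 : 0 < l) : |levD k l M| ≤ 2 ^ (6 * (X * X) + 4 * X) :=
  abs_levP_le' hk hl hX hM (by omega) hl0 hl0 le_rfl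

lemma abs_levV_le_two_pow (hl0 : 0 < l) {i j : ℕ} (hi : i < k) (hj : j < k) :
    |levV k l M i j| ≤ 2 ^ (6 * (X * X) + 5 * X) := by
  rw [levV, sub_eq_add_neg]
  refine abs_add_le_two_pow (abs_indicator_mul_le (abs_levD_le hk hl hX hM hl0)) ?_
    (by omega) (n := 6 * (X * X) + 4 * X) (by omega)
  rw [abs_neg]
  exact abs_levMU_le hk hl hX hM hi hj le_rfl

lemma abs_levVSq_le (hl0 : 0 < l) {n : ℕ} (hn : n ≤ k * k) :
    |∑ r ∈ Finset.range n, levV k l M (r / k) (r % k) * levV k l M (r / k) (r % k)| ≤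
      2 ^ (12 * (X * X) + 12 * X) := by
  refine abs_le_two_pow_mono (abs_sum_range_le (b := X + X)
    (n := (6 * (X * X) + 5 * X) + (6 * (X * X) + 5 * X)) ?_ fun r hr => ?_) (by omega)
  · rw [pow_add]
    exact hn.trans (Nat.mul_le_mul (hk.trans Nat.lt_two_pow_self.le)
      (hk.trans Nat.lt_two_pow_self.le))
  · have hk0 : 0 < k := by
      rcases Nat.eq_zero_or_pos k with h | h
      · subst h; omega
      · exact h
    have h1 : r / k < k := Nat.div_lt_of_lt_mul (by omega)
    have h2 : r % k < k := Nat.mod_lt _ hk0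
    exact abs_mul_le_two_pow (abs_levV_le_two_pow hk hl hX hM hl0 h1 h2)
      (abs_levV_le_two_pow hk hl hX hM hl0 h1 h2)

lemma abs_levQ_le (hl0 : 0 < l) (R : ℕ) :
    |levQ k l M R| ≤ 2 ^ (12 * (X * X) + 13 * X + 2 * R + 1) := by
  refine abs_le_two_pow_mono (abs_mul_le_two_pow (m := 2 * R + 1) (n := 12 * (X * X) + 13 * X)
    ?_ (abs_add_le_two_pow (m := 0) (by simp) (abs_levVSq_le hk hl hX hM hl0 le_rfl)
      (by omega) (by omega))) (by omega)
  have : (2 * R + 1 : ℕ) < 2 ^ (2 * R + 1) := Nat.lt_two_pow_self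
  rw [abs_of_nonneg (by positivity)]
  exact_mod_cast this.le

lemma abs_levMod_le (hl0 : 0 < l) (R : ℕ) :
    |levMod k l M R| ≤ 2 ^ (18 * (X * X) + 17 * X + 2 * R + 1) :=
  abs_le_two_pow_mono (abs_mul_le_two_pow (abs_levD_le hk hl hX hM hl0)
    (abs_levQ_le hk hl hX hM hl0 R)) (by omega)

lemma abs_levRow_le (hl0 : 0 < l) (R : ℕ) {r j : ℕ} (hr : r < l + k) (hj : j < k) :
    |levRow k l M R r j| ≤ 2 ^ (18 * (X * X) + 17 * X + 2 * R + 1) := by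
  rw [levRow]
  split
  next h =>
    exact abs_le_two_pow_mono (abs_mul_le_two_pow (abs_levQ_le hk hl hX hM hl0 R)
      (abs_levU_le hk hl hX hM h hj le_rfl)) (by omega)
  next h =>
    exact abs_le_two_pow_mono (abs_levV_le_two_pow hk hl hX hM hl0 (by omega) hj) (by omega)

end TablesBounds

/-! ### The program that computes the tables -/

/-! Arithmetic notation for expressions. -/

instance : Add CExp := ⟨CExp.op .add⟩
instance : Sub CExp := ⟨CExp.op .sub⟩
instance : Mul CExp := ⟨CExp.op .mul⟩
instance : Div CExp := ⟨CExp.op .div⟩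
instance : Mod CExp := ⟨CExp.op .mod⟩

namespace CExp

lemma eval_add (S : Store) (d e : CExp) : (d + e).eval S = d.eval S + e.eval S := rfl
lemma eval_sub (S : Store) (d e : CExp) : (d - e).eval S = d.eval S - e.eval S := rfl
lemma eval_mul (S : Store) (d e : CExp) : (d * e).eval S = d.eval S * e.eval S := rfl
lemma eval_div (S : Store) (d e : CExp) : (d / e).eval S = d.eval S / e.eval S := rfl
lemma eval_mod (S : Store) (d e : CExp) : (d % e).eval S = d.eval S % e.eval S := rfl
lemma eval_const (S : Store) (z : ℤ) : (const z).eval S = z := rfl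
lemma eval_get (S : Store) (A : ℕ) (i : CExp) : (get A i).eval S = S A (i.eval S) := rfl

/-- The test whether two expressions have equal values. -/
def eqTest (d e : CExp) : CExp := .op .le d e * .op .le e d

lemma eval_eqTest (S : Store) (d e : CExp) :
    (eqTest d e).eval S = if d.eval S = e.eval S then 1 else 0 := by
  simp only [eqTest, eval_mul, eval, BinOp.eval]
  split_ifs <;> omega

/-- The power of an expression with a fixed exponent. -/
def pow (e : CExp) : ℕ → CExp
  | 0 => const 1
  | n + 1 => pow e n * e

lemma eval_pow (S : Store) (e : CExp) (n : ℕ) : (pow e n).eval S = e.eval S ^ n := by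
  induction n with
  | zero => rw [pow, eval_const, pow_zero]
  | succ n ih => rw [pow, eval_mul, ih, pow_succ]

end CExp

open CExp

lemma cast_grid_div {i j b : ℕ} (hj : j < b) : ((i * b + j : ℕ) : ℤ) / (b : ℤ) = i := by
  rw [← Int.natCast_div, mul_comm, Nat.mul_add_div (by omega), Nat.div_eq_of_lt hj, add_zero]

lemma cast_grid_mod {i j b : ℕ} (hj : j < b) : ((i * b + j : ℕ) : ℤ) % (b : ℤ) = j := by
  rw [← Int.natCast_mod, mul_comm, Nat.mul_add_mod, Nat.mod_eq_of_lt hj]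

lemma grid_lt {i j a b : ℕ} (hi : i < a) (hj : j < b) : i * b + j < a * b := by
  calc i * b + j < i * b + b := by omega
    _ = (i + 1) * b := by ring
    _ ≤ a * b := Nat.mul_le_mul_right _ hi

/-- The version of `dotLoop_run` for matrices: the entries of an `a × b` matrix are stored from the
index `o` on, row by row. -/
lemma gridLoop_run {N σ m w : ℕ} {A : ℕ} {off L n e : CExp} {μ : Store} {ψ₀ : Basis →₀ ℂ}
    {o a b n' : ℕ} {E : ℕ → ℕ → ℕ → ℤ} (hA : A ≠ 3)
    (hc : ∀ S : Store, (∀ B, B ≠ 3 → B ≠ A → S B = μ B) →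
      off.eval S = o ∧ L.eval S = (a * b : ℕ) ∧ n.eval S = n')
    (he : ∀ S : Store, (∀ B, B ≠ 3 → B ≠ A → S B = μ B) → ∀ i < a, ∀ j < b, ∀ r < n',
      S 3 1 = (i * b + j : ℕ) → S 3 2 = r → e.eval S = E i j r)
    (h0 : ∀ c < a * b, μ A (o + c) = 0)
    (hbits : ∀ i < a, ∀ j < b, ∀ m ≤ n', |∑ r ∈ Finset.range m, E i j r| ≤ 2 ^ w)
    (hw : w + 2 ≤ σ) (hm : a * b * n' ≤ m) (hσ : m + 1 ≤ σ) (hN : σ ≤ N) :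
    ∃ μ' : Store, (∀ B ≠ A, μ' B = μ B) ∧
      (∀ i < a, ∀ j < b, μ' A (o + (i * b + j)) = ∑ r ∈ Finset.range n', E i j r) ∧
      (∀ z : ℤ, (z < o ∨ o + a * b ≤ z) → μ' A z = μ A z) ∧
      Run N (Agree σ μ ψ₀) (dotLoop A off L n e) (Agree σ μ' ψ₀)
        ((m + 1) * (dotWeight off L n e * σ)) := by
  have hb : ∀ c < a * b, 0 < b := by
    intro c hc
    rcases Nat.eq_zero_or_pos b with h | h
    · subst h; omega
    · exact h
  obtain ⟨μ', h1, h2, h3, h4⟩ := dotLoop_run (N := N) (σ := σ) (ψ₀ := ψ₀) (o := o) (l' := a * b)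
    (n' := n') (E := fun c r => E (c / b) (c % b) r) hA hc
    (fun S hS c hc r hr => by
      intro h1 h2
      refine he S hS _ (Nat.div_lt_of_lt_mul (by rwa [mul_comm])) _ (Nat.mod_lt _ (hb c hc)) r hr
        ?_ h2
      rw [h1, mul_comm, Nat.div_add_mod])
    h0
    (fun c hc j hj => bitSize_le_of_abs_le
      (hbits _ (Nat.div_lt_of_lt_mul (by rwa [mul_comm])) _ (Nat.mod_lt _ (hb c hc)) j hj) hw)
    ((bitSize_natCast_le _).trans (by omega)) (by omega)
  refine ⟨μ', h1, ?_, ?_, h4.mono (fun _ _ h => h) (fun _ _ h => h)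
    (Nat.mul_le_mul_right _ (by omega))⟩
  · intro i hi j hj
    have := h2 _ (grid_lt hi hj)
    rw [show (i * b + j) / b = i by
        rw [mul_comm, Nat.mul_add_div (by omega), Nat.div_eq_of_lt hj, add_zero],
      show (i * b + j) % b = j by rw [mul_comm, Nat.mul_add_mod, Nat.mod_eq_of_lt hj]] at this
    rw [← this]
    push_cast
    rfl
  · intro z hz
    refine h3 z fun c hc h => ?_
    have : (c : ℤ) < a * b := by exact_mod_cast hc
    omega

/-- The dimension `k`, as an expression. -/
def kE : CExp := .get 0 (.const 0)
/-- The rank `l`, as an expression. -/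
def lE : CExp := .get 0 (.const 1)
/-- The bound `a`, as an expression. -/
def aE : CExp := .get 0 (.const 2)
/-- The outer loop counter. -/
def tE : CExp := .get 5 (.const 0)
/-- The number of the current cell in a `dotLoop`. -/
def cE : CExp := .get 3 (.const 1)
/-- The summation index in a `dotLoop`. -/
def rE : CExp := .get 3 (.const 2)

/-- Compute the Gram matrix. -/
def gramCmd : Cmd :=
  dotLoop 7 (.const 0) (lE * lE) kE
    (.get 1 (cE / lE * kE + rE) * .get 1 (cE % lE * kE + rE))

/-- Compute the identity matrix, from which the Faddeev–LeVerrier sequence starts. -/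
def identCmd : Cmd :=
  dotLoop 9 (.const 0) (lE * lE) (.const 1) (eqTest (cE / lE) (cE % lE))

/-- Compute the product of the Gram matrix with the current matrix. -/
def levPCmd : Cmd :=
  dotLoop 11 (tE * (lE * lE)) (lE * lE) lE
    (.get 7 (cE / lE * lE + rE) * .get 9 (tE * (lE * lE) + (rE * lE + cE % lE)))

/-- Compute the trace of this product. -/
def levTrCmd : Cmd :=
  dotLoop 13 tE (.const 1) lE (.get 11 (tE * (lE * lE) + (rE * lE + rE)))

/-- Compute the next matrix of the Faddeev–LeVerrier sequence. -/
def levNCmd : Cmd :=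
  dotLoop 9 ((tE + .const 1) * (lE * lE)) (lE * lE) (.const 1)
    (.get 11 (tE * (lE * lE) + cE) +
      eqTest (cE / lE) (cE % lE) * (.get 13 tE / (.const 0 - (tE + .const 1))))

/-- Compute the Faddeev–LeVerrier sequence. -/
def levCmd : Cmd :=
  gramCmd.seq (identCmd.seq (forLoop 5 lE (levPCmd.seq (levTrCmd.seq levNCmd))))

/-- The memory agrees, in the sense of `Agree`, with some memory that satisfies `F`. -/
def AgreeEx (σ : ℕ) (ψ₀ : Basis →₀ ℂ) (F : Store → Prop) (S : Store) (ψ : Basis →₀ ℂ) : Prop :=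
  ∃ μ, F μ ∧ Agree σ μ ψ₀ S ψ

section Lev

variable {N σ k l X : ℕ} {M : ℕ → ℕ → ℤ} {ψ₀ : Basis →₀ ℂ}

/-- The memory before round `t` of the Faddeev–LeVerrier recursion. -/
structure LevInv (k l : ℕ) (M : ℕ → ℕ → ℤ) (μ₀ : Store) (t : ℕ) (μ : Store) : Prop where
  frame : ∀ B, B ≠ 5 → B ≠ 9 → B ≠ 11 → B ≠ 13 → μ B = μ₀ B
  counter : μ 5 0 = t
  valN : ∀ s ≤ t, ∀ i < l, ∀ j < l, μ 9 (s * (l * l) + (i * l + j)) = levN k l M s i j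
  valP : ∀ s < t, ∀ i < l, ∀ j < l, μ 11 (s * (l * l) + (i * l + j)) = levP k l M s i j
  zeroN : ∀ z : ℤ, (t + 1) * (l * l) ≤ z → μ 9 z = 0
  zeroP : ∀ z : ℤ, t * (l * l) ≤ z → μ 11 z = 0
  zeroTr : ∀ z : ℤ, t ≤ z → μ 13 z = 0

lemma block_lt {s t i j l : ℕ} (hs : s < t) (hi : i < l) (hj : j < l) :
    (s : ℤ) * (l * l) + (i * l + j) < t * (l * l) := by
  have h1 := grid_lt hi hj
  have h2 := grid_lt hs h1
  exact_mod_cast h2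

variable (hk : k ≤ X) (hl : l ≤ X) (hX : 1 ≤ X) (hM : ∀ i < l, ∀ j < k, |M i j| ≤ 2 ^ X)
  (hσ1 : 6 * (X * X) + 6 * X + 2 ≤ σ) (hσ2 : X * (X * X) + 1 ≤ σ) (hN : σ ≤ N)

include hk hl hX hM hσ1 hσ2 hN

omit hk hl hX hM hσ1 hσ2 hN in
lemma count_le {a b c : ℕ} (ha : a ≤ X) (hb : b ≤ X) (hc : c ≤ X) : a * b * c ≤ X * (X * X) := by
  rw [Nat.mul_assoc]
  exact Nat.mul_le_mul ha (Nat.mul_le_mul hb hc)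

lemma levBody_run {μ₀ : Store} (hl0 : μ₀ 0 1 = l)
    (hG : ∀ i < l, ∀ j < l, μ₀ 7 (i * l + j) = gramN k M i j) {t : ℕ} (ht : t < l) {μ : Store}
    (h : LevInv k l M μ₀ t μ) :
    ∃ μ' : Store, μ' 5 0 = t ∧ LevInv k l M μ₀ (t + 1) (put μ' 5 0 (t + 1 : ℕ)) ∧
      Run N (Agree σ μ ψ₀) (levPCmd.seq (levTrCmd.seq levNCmd)) (Agree σ μ' ψ₀)
        ((X * (X * X) + 1) * (6000 * σ)) := by
  have h0' : μ 0 = μ₀ 0 := h.frame 0 (by norm_num) (by norm_num) (by norm_num) (by norm_num)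
  have h7' : μ 7 = μ₀ 7 := h.frame 7 (by norm_num) (by norm_num) (by norm_num) (by norm_num)
  obtain ⟨μ1, f1, v1, z1, r1⟩ := gridLoop_run (N := N) (σ := σ) (m := X * (X * X)) (A := 11)
    (w := 6 * (X * X) + 4 * X)
    (off := tE * (lE * lE)) (L := lE * lE) (n := lE)
    (e := .get 7 (cE / lE * lE + rE) * .get 9 (tE * (lE * lE) + (rE * lE + cE % lE)))
    (μ := μ) (ψ₀ := ψ₀) (o := t * (l * l)) (a := l) (b := l) (n' := l)
    (E := fun i j r => gramN k M i r * levN k l M t r j) (by norm_num)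
    (by
      intro S hS
      have s0 := hS 0 (by norm_num) (by norm_num)
      have s5 := hS 5 (by norm_num) (by norm_num)
      simp only [eval_mul, tE, lE, eval_get, eval_const, s0, s5, h0', hl0, h.counter]
      simp)
    (by
      intro S hS i hi j hj r hr e1 e2
      have s0 := hS 0 (by norm_num) (by norm_num)
      have s5 := hS 5 (by norm_num) (by norm_num)
      have s7 := hS 7 (by norm_num) (by norm_num)
      have s9 := hS 9 (by norm_num) (by norm_num)
      simp only [eval_mul, eval_add, eval_div, eval_mod, tE, lE, rE, cE, eval_get, eval_const,
        s0, s5, s7, s9, h0', h7', hl0, h.counter, e1, e2, cast_grid_div hj, cast_grid_mod hj,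
        hG i hi r hr, h.valN t le_rfl r hr j hj])
    (fun c hc => h.zeroP _ (by push_cast; omega))
    (fun i hi j hj m hm => abs_levP_le' hk hl hX hM ht.le hi hj hm)
    (by omega) (count_le hl hl hl) hσ2 hN
  push_cast at v1 z1
  obtain ⟨μ2, f2, v2, z2, r2⟩ := gridLoop_run (N := N) (σ := σ) (m := X * (X * X)) (A := 13)
    (w := 6 * (X * X) + 5 * X)
    (off := tE) (L := .const 1) (n := lE)
    (e := .get 11 (tE * (lE * lE) + (rE * lE + rE)))
    (μ := μ1) (ψ₀ := ψ₀) (o := t) (a := 1) (b := 1) (n' := l)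
    (E := fun i j r => levP k l M t r r) (by norm_num)
    (by
      intro S hS
      have s0 := hS 0 (by norm_num) (by norm_num)
      have s5 := hS 5 (by norm_num) (by norm_num)
      simp only [tE, lE, eval_get, eval_const, s0, s5, f1 0 (by norm_num), f1 5 (by norm_num),
        h0', hl0, h.counter]
      simp)
    (by
      intro S hS i hi j hj r hr e1 e2
      have s0 := hS 0 (by norm_num) (by norm_num)
      have s5 := hS 5 (by norm_num) (by norm_num)
      have s11 := hS 11 (by norm_num) (by norm_num)
      simp only [eval_mul, eval_add, tE, lE, rE, eval_get, eval_const, s0, s5, s11, h0', hl0,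
        h.counter, f1 0 (by norm_num), f1 5 (by norm_num), e2, v1 r hr r hr]
      rfl)
    (fun c hc => by
      rw [f1 13 (by norm_num)]
      exact h.zeroTr _ (by omega))
    (fun i hi j hj m hm => abs_levTr_le' hk hl hX hM ht.le hm)
    (by omega) (count_le hX hX hl) hσ2 hN
  have v2' : μ2 13 t = levTr k l M t := by
    have := v2 0 (by norm_num) 0 (by norm_num)
    rw [levTr]
    simpa using this
  obtain ⟨μ3, f3, v3, z3, r3⟩ := gridLoop_run (N := N) (σ := σ) (m := X * (X * X)) (A := 9)
    (w := 6 * (X * X) + 6 * X)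
    (off := (tE + .const 1) * (lE * lE)) (L := lE * lE) (n := .const 1)
    (e := .get 11 (tE * (lE * lE) + cE) +
      eqTest (cE / lE) (cE % lE) * (.get 13 tE / (.const 0 - (tE + .const 1))))
    (μ := μ2) (ψ₀ := ψ₀) (o := (t + 1) * (l * l)) (a := l) (b := l) (n' := 1)
    (E := fun i j r => levN k l M (t + 1) i j) (by norm_num)
    (by
      intro S hS
      have s0 := hS 0 (by norm_num) (by norm_num)
      have s5 := hS 5 (by norm_num) (by norm_num)
      simp only [eval_mul, eval_add, tE, lE, eval_get, eval_const, s0, s5, f1 0 (by norm_num),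
        f1 5 (by norm_num), f2 0 (by norm_num), f2 5 (by norm_num), h0', hl0, h.counter]
      simp)
    (by
      intro S hS i hi j hj r hr e1 e2
      have s0 := hS 0 (by norm_num) (by norm_num)
      have s5 := hS 5 (by norm_num) (by norm_num)
      have s11 := hS 11 (by norm_num) (by norm_num)
      have s13 := hS 13 (by norm_num) (by norm_num)
      simp only [eval_mul, eval_add, eval_sub, eval_div, eval_mod, eval_eqTest, tE, lE, cE,
        eval_get, eval_const, s0, s5, s11, s13, h0', hl0,
        h.counter, f1 0 (by norm_num), f1 5 (by norm_num), f2 0 (by norm_num), f2 5 (by norm_num),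
        f2 11 (by norm_num), e1, cast_grid_div hj, cast_grid_mod hj, v2']
      have := v1 i hi j hj
      push_cast
      rw [this, levN]
      simp only [Nat.cast_inj]
      rfl)
    (fun c hc => by
      rw [f2 9 (by norm_num), f1 9 (by norm_num)]
      exact h.zeroN _ (by push_cast; omega))
    (fun i hi j hj m hm => by
      have h1 := abs_levN_le' hk hl hX hM (t := t + 1) ht hi hj
      rw [Finset.sum_const, Finset.card_range]
      interval_cases m
      · simp
      · rw [one_smul]; exact abs_le_two_pow_mono h1 (by omega))
    (by omega) (count_le hl hl hX) hσ2 hN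
  push_cast at v3 z3
  refine ⟨μ3, ?_, ⟨?_, put_same _ _ _ _, ?_, ?_, ?_, ?_, ?_⟩,
    (r1.seq (r2.seq r3)).mono (fun _ _ h => h) (fun _ _ h => h) ?_⟩
  · rw [f3 5 (by norm_num), f2 5 (by norm_num), f1 5 (by norm_num), h.counter]
  · intro B h5 h9 h11 h13
    rw [put_of_ne _ _ _ h5, f3 B h9, f2 B h13, f1 B h11, h.frame B h5 h9 h11 h13]
  · intro s hs i hi j hj
    rw [put_of_ne _ _ _ (by norm_num)]
    rcases Nat.lt_or_ge t s with h' | h'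
    · obtain rfl : s = t + 1 := by omega
      push_cast
      rw [v3 i hi j hj]; simp
    · have := block_lt (Nat.lt_succ_of_le h') hi hj
      push_cast at this
      rw [z3 _ (Or.inl this), f2 9 (by norm_num), f1 9 (by norm_num), h.valN s h' i hi j hj]
  · intro s hs i hi j hj
    rw [put_of_ne _ _ _ (by norm_num), f3 11 (by norm_num), f2 11 (by norm_num)]
    rcases Nat.lt_or_ge s t with h' | h'
    · have := block_lt h' hi hj
      rw [z1 _ (Or.inl this), h.valP s h' i hi j hj]
    · obtain rfl : s = t := by omega
      exact v1 i hi j hj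
  · intro z hz
    push_cast at hz
    have e1 : ((t : ℤ) + 1 + 1) * (l * l) = (t + 1) * (l * l) + l * l := by ring
    have e2 : (0 : ℤ) ≤ l * l := by positivity
    rw [put_of_ne _ _ _ (by norm_num), z3 _ (Or.inr (by omega)), f2 9 (by norm_num),
      f1 9 (by norm_num)]
    exact h.zeroN _ (by omega)
  · intro z hz
    push_cast at hz
    have e1 : ((t : ℤ) + 1) * (l * l) = t * (l * l) + l * l := by ring
    have e2 : (0 : ℤ) ≤ l * l := by positivity
    rw [put_of_ne _ _ _ (by norm_num), f3 11 (by norm_num), f2 11 (by norm_num),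
      z1 _ (Or.inr (by omega))]
    exact h.zeroP _ (by omega)
  · intro z hz
    push_cast at hz
    rw [put_of_ne _ _ _ (by norm_num), f3 13 (by norm_num), z2 z (Or.inr (by push_cast; omega)),
      f1 13 (by norm_num)]
    exact h.zeroTr _ (by omega)
  · rw [← Nat.mul_add, ← Nat.mul_add, ← Nat.add_mul, ← Nat.add_mul]
    refine Nat.mul_le_mul_left _ (Nat.mul_le_mul_right _ ?_)
    decide +kernel

lemma lev_run {μ : Store} (hk0 : μ 0 0 = k) (hl0 : μ 0 1 = l)
    (hM1 : ∀ i < l, ∀ j < k, μ 1 (i * k + j) = M i j)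
    (h7 : ∀ z, μ 7 z = 0) (h9 : ∀ z, μ 9 z = 0) (h11 : ∀ z, μ 11 z = 0) (h13 : ∀ z, μ 13 z = 0) :
    Run N (Agree σ μ ψ₀) levCmd
      (AgreeEx σ ψ₀ fun μ' => (∀ B, B ≠ 5 → B ≠ 7 → B ≠ 9 → B ≠ 11 → B ≠ 13 → μ' B = μ B) ∧
        (∀ i < l, ∀ j < l, μ' 9 (((l - 1 : ℕ) : ℤ) * (l * l) + (i * l + j)) =
          levN k l M (l - 1) i j) ∧
        (0 < l → μ' 11 (((l - 1 : ℕ) : ℤ) * (l * l)) = levD k l M))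
      ((X + 2) * ((X * (X * X) + 1) * (12000 * σ))) := by
  have hXX : X ≤ X * X := Nat.le_mul_of_pos_left _ hX
  obtain ⟨μ1, f1, v1, z1, r1⟩ := gridLoop_run (N := N) (σ := σ) (m := X * (X * X)) (A := 7)
    (w := 3 * X)
    (off := .const 0) (L := lE * lE) (n := kE)
    (e := .get 1 (cE / lE * kE + rE) * .get 1 (cE % lE * kE + rE))
    (μ := μ) (ψ₀ := ψ₀) (o := 0) (a := l) (b := l) (n' := k)
    (E := fun i j r => M i r * M j r) (by norm_num)
    (by
      intro S hS
      have s0 := hS 0 (by norm_num) (by norm_num)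
      simp only [eval_mul, lE, kE, eval_get, eval_const, s0, hl0, hk0]
      simp)
    (by
      intro S hS i hi j hj r hr e1 e2
      have s0 := hS 0 (by norm_num) (by norm_num)
      have s1 := hS 1 (by norm_num) (by norm_num)
      simp only [eval_mul, eval_add, eval_div, eval_mod, lE, kE, rE, cE, eval_get, eval_const,
        s0, s1, hl0, hk0, e1, e2, cast_grid_div hj, cast_grid_mod hj, hM1 i hi r hr,
        hM1 j hj r hr])
    (fun c hc => h7 _)
    (fun i hi j hj m hm => abs_gramN_partial_le hk hM hi hj hm)
    (by omega) (count_le hl hl hk) hσ2 hN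
  simp only [Nat.cast_zero, zero_add] at v1
  obtain ⟨μ2, f2, v2, z2, r2⟩ := gridLoop_run (N := N) (σ := σ) (m := X * (X * X)) (A := 9)
    (w := 0)
    (off := .const 0) (L := lE * lE) (n := .const 1)
    (e := eqTest (cE / lE) (cE % lE))
    (μ := μ1) (ψ₀ := ψ₀) (o := 0) (a := l) (b := l) (n' := 1)
    (E := fun i j r => levN k l M 0 i j) (by norm_num)
    (by
      intro S hS
      have s0 := hS 0 (by norm_num) (by norm_num)
      simp only [eval_mul, lE, eval_get, eval_const, s0, f1 0 (by norm_num), hl0]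
      simp)
    (by
      intro S hS i hi j hj r hr e1 e2
      have s0 := hS 0 (by norm_num) (by norm_num)
      simp only [eval_eqTest, eval_div, eval_mod, lE, cE, eval_get, eval_const,
        s0, hl0, e1, cast_grid_div hj, cast_grid_mod hj, f1 0 (by norm_num), levN, Nat.cast_inj])
    (fun c hc => by rw [f1 9 (by norm_num)]; exact h9 _)
    (fun i hi j hj m hm => by
      rw [Finset.sum_const, Finset.card_range]
      interval_cases m
      · simp
      · simp only [levN]; split <;> simp)
    (by omega) (count_le hl hl hX) hσ2 hN
  simp only [Nat.cast_zero, zero_add] at v2 z2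
  let Inv : ℕ → Store → (Basis →₀ ℂ) → Prop := fun t => AgreeEx σ ψ₀ (LevInv k l M μ2 t)
  have h20 : μ2 0 = μ 0 := by rw [f2 0 (by norm_num), f1 0 (by norm_num)]
  have bit0 : bitSize 0 ≤ σ := by rw [bitSize_zero]; omega
  have hbody : ∀ t < l, Run N (Inv t) (levPCmd.seq (levTrCmd.seq levNCmd))
      (fun S ψ => MemBits σ S ∧ S 5 0 = t ∧ Inv (t + 1) (put S 5 0 (t + 1 : ℕ)) ψ)
      ((X * (X * X) + 1) * (6000 * σ)) := by
    rintro t ht s ⟨μt, hμt, hs⟩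
    obtain ⟨μ', h5, hμ', hrun⟩ := levBody_run (ψ₀ := ψ₀) hk hl hX hM hσ1 hσ2 hN (μ₀ := μ2)
      (by rw [h20, hl0])
      (fun i hi j hj => by rw [f2 7 (by norm_num)]; exact v1 i hi j hj) ht hμt
    obtain ⟨s', e1, ⟨e2, e3, e4⟩, e5⟩ := hrun s hs
    refine ⟨s', e1, ⟨e3, by rw [e2 5 (by norm_num), h5], _, hμ', ?_, ?_, e4⟩, e5⟩
    · intro B hB
      funext z
      rw [put_apply, put_apply, e2 B hB]
    · refine e3.put ((bitSize_natCast_le _).trans ?_)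
      have := Nat.le_mul_of_pos_left (X * X) hX
      omega
  have r3 := Run.forLoop (P := Agree σ μ2 ψ₀) (B := 5) (nE := lE) (n := l) (σ := σ) (Inv := Inv)
    (by have := Nat.le_mul_of_pos_left (X * X) hX; omega) ?_ ?_ hbody
  · refine (r1.seq (r2.seq r3)).mono (fun _ _ h => h) ?_ ?_
    · rintro S ψ ⟨μ', h', hA⟩
      refine ⟨μ', ⟨?_, ?_, ?_⟩, hA⟩
      · intro B h5 h7 h9 h11 h13
        rw [h'.frame B h5 h9 h11 h13, f2 B h9, f1 B h7]
      · intro i hi j hj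
        exact h'.valN (l - 1) (by omega) i hi j hj
      · intro hl0
        have := h'.valP (l - 1) (by omega) 0 hl0 0 hl0
        simpa [levD] using this
    · have e1 : dotWeight (.const 0) (lE * lE) kE
          (.get 1 (cE / lE * kE + rE) * .get 1 (cE % lE * kE + rE)) ≤ 1000 := by decide +kernel
      have e2 : dotWeight (.const 0) (lE * lE) (.const 1) (eqTest (cE / lE) (cE % lE)) ≤ 1000 := by
        decide +kernel
      set Z := X * (X * X) + 1 with hZ
      have i1 : Z * (dotWeight (.const 0) (lE * lE) kE
          (.get 1 (cE / lE * kE + rE) * .get 1 (cE % lE * kE + rE)) * σ) ≤ Z * (1000 * σ) :=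
        Nat.mul_le_mul_left _ (Nat.mul_le_mul_right _ e1)
      have i2 : Z * (dotWeight (.const 0) (lE * lE) (.const 1)
          (eqTest (cE / lE) (cE % lE)) * σ) ≤ Z * (1000 * σ) :=
        Nat.mul_le_mul_left _ (Nat.mul_le_mul_right _ e2)
      have i3 : (100 + 2 * lE.weight) * σ ≤ Z * (6000 * σ) := by
        calc (100 + 2 * lE.weight) * σ ≤ 6000 * σ := by
              refine Nat.mul_le_mul_right _ ?_
              have : lE.weight = 2 + 1 := by decide +kernel
              omega
          _ ≤ _ := Nat.le_mul_of_pos_left _ (by omega)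
      have i4 : (l + 1) * (Z * (6000 * σ) + (100 + 2 * lE.weight) * σ) ≤
          (X + 1) * (Z * (12000 * σ)) := by
        refine Nat.mul_le_mul (by omega) ?_
        have : Z * (12000 * σ) = Z * (6000 * σ) + Z * (6000 * σ) := by ring
        omega
      have i5 : (X + 2) * (Z * (12000 * σ)) = (X + 1) * (Z * (12000 * σ)) + Z * (1000 * σ)
          + Z * (1000 * σ) + Z * (10000 * σ) := by ring
      omega
  · rintro S ψ ⟨hA, hb, hψ⟩
    refine ⟨hb, put μ2 5 0 0, ⟨?_, put_same _ _ _ _, ?_, ?_, ?_, ?_, ?_⟩, ?_, hb.put bit0, hψ⟩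
    · intro B h5 _ _ _
      rw [put_of_ne _ _ _ h5]
    · intro s hs i hi j hj
      obtain rfl : s = 0 := by omega
      rw [put_of_ne _ _ _ (by norm_num)]
      simpa using v2 i hi j hj
    · intro s hs; omega
    · intro z hz
      rw [put_of_ne _ _ _ (by norm_num), z2 z (Or.inr (by simpa using hz)), f1 9 (by norm_num), h9]
    · intro z _
      rw [put_of_ne _ _ _ (by norm_num), f2 11 (by norm_num), f1 11 (by norm_num), h11]
    · intro z _
      rw [put_of_ne _ _ _ (by norm_num), f2 13 (by norm_num), f1 13 (by norm_num), h13]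
    · intro B hB
      funext z
      rw [put_apply, put_apply, hA B hB]
  · rintro t ht S ψ ⟨μt, hμt, hA, hb, -⟩
    refine ⟨hb, by rw [hA 5 (by norm_num), hμt.counter], ?_⟩
    rw [lE, eval_get, eval_const, hA 0 (by norm_num),
      hμt.frame 0 (by norm_num) (by norm_num) (by norm_num) (by norm_num), h20, hl0]

end Lev

open CExp

/-- The index of the last block of the Faddeev–LeVerrier sequence. -/
def lastE : CExp := (lE - .const 1) * (lE * lE)

/-- Compute `levU`. -/
def levUCmd : Cmd :=
  dotLoop 15 (.const 0) (lE * kE) lE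
    (.get 9 (lastE + (cE / kE * lE + rE)) * .get 1 (rE * kE + cE % kE))

/-- Compute `levMU`. -/
def levMUCmd : Cmd :=
  dotLoop 17 (.const 0) (kE * kE) lE
    (.get 1 (rE * kE + cE / kE) * .get 15 (rE * kE + cE % kE))

/-- Compute `levV`. -/
def levVCmd : Cmd :=
  dotLoop 19 (.const 0) (kE * kE) (.const 1)
    (eqTest (cE / kE) (cE % kE) * .get 11 lastE - .get 17 cE)

/-- Compute `levVSq`. -/
def levVSqCmd : Cmd := dotLoop 23 (.const 0) (.const 1) (kE * kE) (.get 19 rE * .get 19 rE)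

/-- Compute `levQ`. -/
def levQCmd (RE : CExp) : Cmd :=
  dotLoop 31 (.const 0) (.const 1) (.const 1)
    ((.const 2 * RE + .const 1) * (.const 1 + .get 23 (.const 0)))

/-- Compute `levMod`. -/
def levModCmd : Cmd :=
  dotLoop 25 (.const 0) (.const 1) (.const 1) (.get 11 lastE * .get 31 (.const 0))

/-- Compute the first `l` rows of `levRow`. -/
def levRowCmd : Cmd :=
  dotLoop 21 (.const 0) (lE * kE) (.const 1) (.get 31 (.const 0) * .get 15 cE)

/-- Compute the last `k` rows of `levRow`. -/
def levRowCmd' : Cmd := dotLoop 21 (lE * kE) (kE * kE) (.const 1) (.get 19 cE)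

/-- Copy the dimension to the place where the simulated program expects it. -/
def dimCmd : Cmd := dotLoop 4 (.const 0) (.const 1) (.const 1) kE

/-- Compute all tables. The expressions are bounds for the simulated time and for the vectors that
the simulated program queries. -/
def tablesCmd (TE RE : CExp) : Cmd :=
  levCmd.seq (levUCmd.seq (levMUCmd.seq (levVCmd.seq (levVSqCmd.seq ((levQCmd RE).seq
    (levModCmd.seq (levRowCmd.seq (levRowCmd'.seq (dimCmd.seq
      ((powLoop 27 (.const 2) TE).seq (powLoop 29 (.get 25 (.const 0)) (lE + kE))))))))))))

/-- A bound for the cost of the commands in `tablesCmd`. -/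
def tablesWeight (TE RE : CExp) : ℕ :=
  100000 + 2 * powWeight (.const 2) TE +
    dotWeight (.const 0) (.const 1) (.const 1)
      ((.const 2 * RE + .const 1) * (.const 1 + .get 23 (.const 0)))

/-- The part of the memory that the simulation reads. -/
structure Tables (k l : ℕ) (M : ℕ → ℕ → ℤ) (R T : ℕ) (μ : Store) : Prop where
  dim : μ 0 0 = k
  rank : μ 0 1 = l
  row : ∀ r < l + k, ∀ j < k, μ 21 (r * k + j) = levRow k l M R r j
  modulus : μ 25 0 = levMod k l M R
  two : ∀ i ≤ T, μ 27 i = 2 ^ i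
  base : ∀ r ≤ l + k, μ 29 r = levMod k l M R ^ r

lemma abs_pow_le_two_pow {x : ℤ} {n r s : ℕ} (h : |x| ≤ 2 ^ n) (hr : r ≤ s) :
    |x ^ r| ≤ 2 ^ (s * n) := by
  rw [abs_pow]
  calc |x| ^ r ≤ (2 ^ n) ^ r := pow_le_pow_left₀ (abs_nonneg _) h r
    _ = 2 ^ (n * r) := (pow_mul _ _ _).symm
    _ ≤ 2 ^ (s * n) :=
      pow_le_pow_right₀ (by norm_num) (by rw [mul_comm]; exact Nat.mul_le_mul_right _ hr)

section Tables

variable {N σ k l X R T : ℕ} {M : ℕ → ℕ → ℤ} {ψ₀ : Basis →₀ ℂ}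

lemma Run.exists {F : Store → Prop} {c : Cmd} {Q : Store → (Basis →₀ ℂ) → Prop} {δ : ℕ}
    (h : ∀ μ, F μ → Run N (Agree σ μ ψ₀) c Q δ) : Run N (AgreeEx σ ψ₀ F) c Q δ := by
  rintro s ⟨μ, hμ, hs⟩
  exact h μ hμ s hs

/-- The tables are computed in polynomial time. The even arrays, which are those of the simulated
program, then contain its input, and are empty otherwise. -/
lemma tables_run (hk : k ≤ X) (hl : l ≤ X) (hX : 1 ≤ X) (hl0 : 0 < l)
    (hM : ∀ i < l, ∀ j < k, |M i j| ≤ 2 ^ X)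
    (hσ1 : 18 * (X * X) + 17 * X + 2 * R + 3 ≤ σ) (hσ2 : X * (X * X) + 2 ≤ σ)
    (hσ3 : 2 * X * (18 * (X * X) + 17 * X + 2 * R + 1) + 2 ≤ σ) (hσ4 : T + 2 ≤ σ) (hN : σ ≤ N)
    {μ : Store} {TE RE : CExp} (hTE : ∀ S : Store, S 0 = μ 0 → TE.eval S = T)
    (hRE : ∀ S : Store, S 0 = μ 0 → RE.eval S = R)
    (k0 : μ 0 0 = k) (l0 : μ 0 1 = l)
    (hM1 : ∀ i < l, ∀ j < k, μ 1 (i * k + j) = M i j)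
    (hz : ∀ B, B ≠ 0 → B ≠ 1 → ∀ z, μ B z = 0) :
    Run N (Agree σ μ ψ₀) (tablesCmd TE RE)
      (AgreeEx σ ψ₀ fun μ' => Tables k l M R T μ' ∧ μ' 4 0 = k ∧ (∀ z ≠ 0, μ' 4 z = 0) ∧
        ∀ B, B % 2 = 0 → B ≠ 0 → B ≠ 4 → ∀ z, μ' B z = 0)
      ((X + 2) * (σ * (12000 * σ)) + σ * (tablesWeight TE RE * σ)) := by
  have hlev := lev_run (ψ₀ := ψ₀) (σ := σ) (N := N) hk hl hX hM (by omega) (by omega) hN k0 l0 hM1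
    (hz 7 (by norm_num) (by norm_num)) (hz 9 (by norm_num) (by norm_num))
    (hz 11 (by norm_num) (by norm_num)) (hz 13 (by norm_num) (by norm_num))
  have hlev' := hlev.mono (fun _ _ h => h) (fun _ _ h => h)
    (Nat.mul_le_mul_left (X + 2) (Nat.mul_le_mul_right (12000 * σ)
      (show X * (X * X) + 1 ≤ σ by omega)))
  refine hlev'.seq (Run.exists ?_)
  rintro μ0 ⟨f0, v9, v11⟩
  replace v11 := v11 hl0
  have k0' : μ0 0 0 = k := by
    rw [f0 0 (by norm_num) (by norm_num) (by norm_num) (by norm_num) (by norm_num), k0]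
  have l0' : μ0 0 1 = l := by
    rw [f0 0 (by norm_num) (by norm_num) (by norm_num) (by norm_num) (by norm_num), l0]
  have m1' : ∀ i < l, ∀ j < k, μ0 1 (i * k + j) = M i j := by
    rw [f0 1 (by norm_num) (by norm_num) (by norm_num) (by norm_num) (by norm_num)]
    exact hM1
  have hz' : ∀ B, B ≠ 0 → B ≠ 1 → B ≠ 5 → B ≠ 7 → B ≠ 9 → B ≠ 11 → B ≠ 13 → ∀ z, μ0 B z = 0 :=
    fun B h0 h1 h5 h7 h9 h11 h13 => by rw [f0 B h5 h7 h9 h11 h13]; exact hz B h0 h1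
  have hs1 : (l : ℤ) - 1 = ((l - 1 : ℕ) : ℤ) := by omega
  have cnt : ∀ {a b c : ℕ}, a ≤ X → b ≤ X → c ≤ X → a * b * c ≤ σ - 1 := fun ha hb hc =>
    (count_le ha hb hc).trans (by omega)
  have hσ0 : σ - 1 + 1 ≤ σ := by omega
  -- the matrix `U`
  obtain ⟨μ1, f1, v1, z1, r1⟩ := gridLoop_run (N := N) (σ := σ) (m := σ - 1) (A := 15)
    (w := 6 * (X * X) + 2 * X)
    (off := .const 0) (L := lE * kE) (n := lE)
    (e := .get 9 (lastE + (cE / kE * lE + rE)) * .get 1 (rE * kE + cE % kE))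
    (μ := μ0) (ψ₀ := ψ₀) (o := 0) (a := l) (b := k) (n' := l)
    (E := fun i j r => levN k l M (l - 1) i r * M r j) (by norm_num)
    (by
      intro S hS
      have s0 := hS 0 (by norm_num) (by norm_num)
      simp only [eval_mul, lE, kE, eval_get, eval_const, s0, l0', k0']
      simp)
    (by
      intro S hS i hi j hj r hr e1 e2
      have s0 := hS 0 (by norm_num) (by norm_num)
      have s1 := hS 1 (by norm_num) (by norm_num)
      have s9 := hS 9 (by norm_num) (by norm_num)
      simp only [lastE, eval_mul, eval_add, eval_sub, eval_div, eval_mod, lE, kE, rE, cE, eval_get,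
        eval_const, s0, s1, s9, l0', k0', e1, e2, cast_grid_div hj, cast_grid_mod hj, hs1,
        v9 i hi r hr, m1' r hr j hj])
    (fun c hc => hz' 15 (by norm_num) (by norm_num) (by norm_num) (by norm_num) (by norm_num)
      (by norm_num) (by norm_num) _)
    (fun i hi j hj m hm => abs_levU_le hk hl hX hM hi hj hm)
    (by omega) (cnt hl hk hl) hσ0 hN
  simp only [Nat.cast_zero, zero_add] at v1
  -- the product of the transpose of `M` with `U`
  obtain ⟨μ2, f2, v2, z2, r2⟩ := gridLoop_run (N := N) (σ := σ) (m := σ - 1) (A := 17)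
    (w := 6 * (X * X) + 4 * X)
    (off := .const 0) (L := kE * kE) (n := lE)
    (e := .get 1 (rE * kE + cE / kE) * .get 15 (rE * kE + cE % kE))
    (μ := μ1) (ψ₀ := ψ₀) (o := 0) (a := k) (b := k) (n' := l)
    (E := fun i j r => M r i * levU k l M r j) (by norm_num)
    (by
      intro S hS
      have s0 := hS 0 (by norm_num) (by norm_num)
      simp only [eval_mul, lE, kE, eval_get, eval_const, s0, f1 0 (by norm_num), l0', k0']
      simp)
    (by
      intro S hS i hi j hj r hr e1 e2
      have s0 := hS 0 (by norm_num) (by norm_num)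
      have s1 := hS 1 (by norm_num) (by norm_num)
      have s15 := hS 15 (by norm_num) (by norm_num)
      simp only [eval_mul, eval_add, eval_div, eval_mod, kE, rE, cE, eval_get,
        eval_const, s0, s1, s15, f1 0 (by norm_num), f1 1 (by norm_num), k0', e1, e2,
        cast_grid_div hj, cast_grid_mod hj, m1' r hr i hi, v1 r hr j hj]
      rfl)
    (fun c hc => by
      rw [f1 17 (by norm_num)]
      exact hz' 17 (by norm_num) (by norm_num) (by norm_num) (by norm_num) (by norm_num)
        (by norm_num) (by norm_num) _)
    (fun i hi j hj m hm => abs_levMU_le hk hl hX hM hi hj hm)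
    (by omega) (cnt hk hk hl) hσ0 hN
  simp only [Nat.cast_zero, zero_add] at v2
  -- the matrix `V`
  obtain ⟨μ3, f3, v3, z3, r3⟩ := gridLoop_run (N := N) (σ := σ) (m := σ - 1) (A := 19)
    (w := 6 * (X * X) + 5 * X)
    (off := .const 0) (L := kE * kE) (n := .const 1)
    (e := eqTest (cE / kE) (cE % kE) * .get 11 lastE - .get 17 cE)
    (μ := μ2) (ψ₀ := ψ₀) (o := 0) (a := k) (b := k) (n' := 1)
    (E := fun i j r => levV k l M i j) (by norm_num)
    (by
      intro S hS
      have s0 := hS 0 (by norm_num) (by norm_num)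
      simp only [eval_mul, kE, eval_get, eval_const, s0, f1 0 (by norm_num), f2 0 (by norm_num),
        k0']
      simp)
    (by
      intro S hS i hi j hj r hr e1 e2
      have s0 := hS 0 (by norm_num) (by norm_num)
      have s11 := hS 11 (by norm_num) (by norm_num)
      have s17 := hS 17 (by norm_num) (by norm_num)
      have hv := v2 i hi j hj
      simp only [lastE, eval_mul, eval_sub, eval_div, eval_mod, eval_eqTest, kE, lE, cE, eval_get,
        eval_const, s0, s11, s17, f1 0 (by norm_num), f2 0 (by norm_num), f1 11 (by norm_num),
        f2 11 (by norm_num), k0', l0', e1, cast_grid_div hj, cast_grid_mod hj, hs1, v11]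
      push_cast
      rw [hv, levV, levMU]
      simp only [Nat.cast_inj])
    (fun c hc => by
      rw [f2 19 (by norm_num), f1 19 (by norm_num)]
      exact hz' 19 (by norm_num) (by norm_num) (by norm_num) (by norm_num) (by norm_num)
        (by norm_num) (by norm_num) _)
    (fun i hi j hj m hm => by
      rw [Finset.sum_const, Finset.card_range]
      interval_cases m
      · simp
      · rw [one_smul]; exact abs_levV_le_two_pow hk hl hX hM hl0 hi hj)
    (by omega) (cnt hk hk hX) hσ0 hN
  simp only [Nat.cast_zero, zero_add, Finset.sum_const, Finset.card_range, one_smul] at v3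
  have hkk : k * k ≤ X * X := Nat.mul_le_mul hk hk
  have hXX : X * X ≤ X * (X * X) := Nat.mul_le_mul_left _ (Nat.le_mul_of_pos_left _ hX)
  -- the sum of squares
  obtain ⟨μ4, f4, v4, z4, r4⟩ := gridLoop_run (N := N) (σ := σ) (m := σ - 1) (A := 23)
    (w := 12 * (X * X) + 12 * X)
    (off := .const 0) (L := .const 1) (n := kE * kE)
    (e := .get 19 rE * .get 19 rE)
    (μ := μ3) (ψ₀ := ψ₀) (o := 0) (a := 1) (b := 1) (n' := k * k)
    (E := fun i j r => levV k l M (r / k) (r % k) * levV k l M (r / k) (r % k)) (by norm_num)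
    (by
      intro S hS
      have s0 := hS 0 (by norm_num) (by norm_num)
      simp only [eval_mul, kE, eval_get, eval_const, s0, f1 0 (by norm_num), f2 0 (by norm_num),
        f3 0 (by norm_num), k0']
      simp)
    (by
      intro S hS i hi j hj r hr e1 e2
      have s19 := hS 19 (by norm_num) (by norm_num)
      have hk0 : 0 < k := by
        rcases Nat.eq_zero_or_pos k with h | h
        · subst h; omega
        · exact h
      have hv := v3 (r / k) (Nat.div_lt_of_lt_mul hr) (r % k) (Nat.mod_lt _ hk0)
      have hr' : ((r / k : ℕ) : ℤ) * k + (r % k : ℕ) = r := by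
        have := Nat.div_add_mod r k
        rw [mul_comm] at this
        exact_mod_cast this
      rw [hr'] at hv
      simp only [eval_mul, rE, eval_get, eval_const, s19, e2, hv])
    (fun c hc => by
      rw [f3 23 (by norm_num), f2 23 (by norm_num), f1 23 (by norm_num)]
      exact hz' 23 (by norm_num) (by norm_num) (by norm_num) (by norm_num) (by norm_num)
        (by norm_num) (by norm_num) _)
    (fun i hi j hj m hm => abs_levVSq_le hk hl hX hM hl0 hm)
    (by omega) (by omega) hσ0 hN
  have v4' : μ4 23 0 = levVSq k l M := by
    have := v4 0 (by norm_num) 0 (by norm_num)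
    rw [levVSq]
    simpa using this
  -- the factor `Q`
  obtain ⟨μ5, f5, v5, z5, r5⟩ := gridLoop_run (N := N) (σ := σ) (m := σ - 1) (A := 31)
    (w := 12 * (X * X) + 13 * X + 2 * R + 1)
    (off := .const 0) (L := .const 1) (n := .const 1)
    (e := (.const 2 * RE + .const 1) * (.const 1 + .get 23 (.const 0)))
    (μ := μ4) (ψ₀ := ψ₀) (o := 0) (a := 1) (b := 1) (n' := 1)
    (E := fun i j r => levQ k l M R) (by norm_num)
    (by
      intro S hS
      simp only [eval_const]
      simp)
    (by
      intro S hS i hi j hj r hr e1 e2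
      have s0 := hS 0 (by norm_num) (by norm_num)
      have s23 := hS 23 (by norm_num) (by norm_num)
      have hR := hRE S (by rw [s0, f4 0 (by norm_num), f3 0 (by norm_num), f2 0 (by norm_num),
        f1 0 (by norm_num),
        f0 0 (by norm_num) (by norm_num) (by norm_num) (by norm_num) (by norm_num)])
      simp only [eval_mul, eval_add, eval_get, eval_const, s23, v4', hR, levQ])
    (fun c hc => by
      rw [f4 31 (by norm_num), f3 31 (by norm_num), f2 31 (by norm_num), f1 31 (by norm_num)]
      exact hz' 31 (by norm_num) (by norm_num) (by norm_num) (by norm_num) (by norm_num)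
        (by norm_num) (by norm_num) _)
    (fun i hi j hj m hm => by
      rw [Finset.sum_const, Finset.card_range]
      interval_cases m
      · simp
      · rw [one_smul]; exact abs_levQ_le hk hl hX hM hl0 R)
    (by omega) (by omega) hσ0 hN
  have v5' : μ5 31 0 = levQ k l M R := by
    have := v5 0 (by norm_num) 0 (by norm_num)
    simpa using this
  have f05 : μ5 0 = μ0 0 := by
    rw [f5 0 (by norm_num), f4 0 (by norm_num), f3 0 (by norm_num), f2 0 (by norm_num),
      f1 0 (by norm_num)]
  have k5 : μ5 0 0 = k := by rw [f05, k0']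
  have l5 : μ5 0 1 = l := by rw [f05, l0']
  have v11' : μ5 11 (((l - 1 : ℕ) : ℤ) * (l * l)) = levD k l M := by
    rw [f5 11 (by norm_num), f4 11 (by norm_num), f3 11 (by norm_num), f2 11 (by norm_num),
      f1 11 (by norm_num), v11]
  have v15' : ∀ i < l, ∀ j < k, μ5 15 (i * k + j) = levU k l M i j := by
    intro i hi j hj
    rw [f5 15 (by norm_num), f4 15 (by norm_num), f3 15 (by norm_num), f2 15 (by norm_num),
      v1 i hi j hj, levU]
  have v19' : ∀ i < k, ∀ j < k, μ5 19 (i * k + j) = levV k l M i j := by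
    intro i hi j hj
    rw [f5 19 (by norm_num), f4 19 (by norm_num), v3 i hi j hj]
  have hz5 : ∀ B, B ≠ 0 → B ≠ 1 → B ≠ 5 → B ≠ 7 → B ≠ 9 → B ≠ 11 → B ≠ 13 → B ≠ 15 → B ≠ 17 →
      B ≠ 19 → B ≠ 23 → B ≠ 31 → ∀ z, μ5 B z = 0 := by
    intro B h0 h1 h5 h7 h9 h11 h13 h15 h17 h19 h23 h31
    rw [f5 B h31, f4 B h23, f3 B h19, f2 B h17, f1 B h15]
    exact hz' B h0 h1 h5 h7 h9 h11 h13
  -- the modulus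
  obtain ⟨μ6, f6, v6, z6, r6⟩ := gridLoop_run (N := N) (σ := σ) (m := σ - 1) (A := 25)
    (w := 18 * (X * X) + 17 * X + 2 * R + 1)
    (off := .const 0) (L := .const 1) (n := .const 1)
    (e := .get 11 lastE * .get 31 (.const 0))
    (μ := μ5) (ψ₀ := ψ₀) (o := 0) (a := 1) (b := 1) (n' := 1)
    (E := fun i j r => levMod k l M R) (by norm_num)
    (by
      intro S hS
      simp only [eval_const]
      simp)
    (by
      intro S hS i hi j hj r hr e1 e2
      have s0 := hS 0 (by norm_num) (by norm_num)
      have s11 := hS 11 (by norm_num) (by norm_num)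
      have s31 := hS 31 (by norm_num) (by norm_num)
      simp only [lastE, lE, eval_mul, eval_sub, eval_get, eval_const, s0, s11, s31, l5, hs1, v11',
        v5', levMod])
    (fun c hc => by apply hz5 25 <;> norm_num)
    (fun i hi j hj m hm => by
      rw [Finset.sum_const, Finset.card_range]
      interval_cases m
      · simp
      · rw [one_smul]; exact abs_levMod_le hk hl hX hM hl0 R)
    (by omega) (by omega) hσ0 hN
  have v6' : μ6 25 0 = levMod k l M R := by
    have := v6 0 (by norm_num) 0 (by norm_num)
    simpa using this
  -- the rows of the congruences
  obtain ⟨μ7, f7, v7, z7, r7⟩ := gridLoop_run (N := N) (σ := σ) (m := σ - 1) (A := 21)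
    (w := 18 * (X * X) + 17 * X + 2 * R + 1)
    (off := .const 0) (L := lE * kE) (n := .const 1)
    (e := .get 31 (.const 0) * .get 15 cE)
    (μ := μ6) (ψ₀ := ψ₀) (o := 0) (a := l) (b := k) (n' := 1)
    (E := fun i j r => levRow k l M R i j) (by norm_num)
    (by
      intro S hS
      have s0 := hS 0 (by norm_num) (by norm_num)
      simp only [eval_mul, lE, kE, eval_get, eval_const, s0, f6 0 (by norm_num), l5, k5]
      simp)
    (by
      intro S hS i hi j hj r hr e1 e2
      have s15 := hS 15 (by norm_num) (by norm_num)
      have s31 := hS 31 (by norm_num) (by norm_num)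
      simp only [eval_mul, cE, eval_get, eval_const, s15, s31, f6 15 (by norm_num),
        f6 31 (by norm_num), v5', e1]
      push_cast
      rw [v15' i hi j hj, levRow, if_pos hi])
    (fun c hc => by rw [f6 21 (by norm_num)]; apply hz5 21 <;> norm_num)
    (fun i hi j hj m hm => by
      rw [Finset.sum_const, Finset.card_range]
      interval_cases m
      · simp
      · rw [one_smul]; exact abs_levRow_le hk hl hX hM hl0 R (by omega) hj)
    (by omega) (cnt hl hk hX) hσ0 hN
  simp only [Nat.cast_zero, zero_add, Finset.sum_const, Finset.card_range, one_smul] at v7 z7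
  obtain ⟨μ8, f8, v8, z8, r8⟩ := gridLoop_run (N := N) (σ := σ) (m := σ - 1) (A := 21)
    (w := 18 * (X * X) + 17 * X + 2 * R + 1)
    (off := lE * kE) (L := kE * kE) (n := .const 1)
    (e := .get 19 cE)
    (μ := μ7) (ψ₀ := ψ₀) (o := l * k) (a := k) (b := k) (n' := 1)
    (E := fun i j r => levRow k l M R (l + i) j) (by norm_num)
    (by
      intro S hS
      have s0 := hS 0 (by norm_num) (by norm_num)
      simp only [eval_mul, lE, kE, eval_get, eval_const, s0, f7 0 (by norm_num),
        f6 0 (by norm_num), l5, k5]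
      simp)
    (by
      intro S hS i hi j hj r hr e1 e2
      have s19 := hS 19 (by norm_num) (by norm_num)
      simp only [cE, eval_get, eval_const, s19, f6 19 (by norm_num), f7 19 (by norm_num), e1]
      push_cast
      rw [v19' i hi j hj, levRow, if_neg (by omega), Nat.add_sub_cancel_left])
    (fun c hc => by
      rw [z7 _ (Or.inr (by push_cast; omega)), f6 21 (by norm_num)]; apply hz5 21 <;> norm_num)
    (fun i hi j hj m hm => by
      rw [Finset.sum_const, Finset.card_range]
      interval_cases m
      · simp
      · rw [one_smul]; exact abs_levRow_le hk hl hX hM hl0 R (by omega) hj)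
    (by omega) (cnt hk hk hX) hσ0 hN
  simp only [Nat.cast_mul, Finset.sum_const, Finset.card_range, one_smul] at v8 z8
  -- the dimension
  obtain ⟨μ9, f9, v9', z9, r9⟩ := gridLoop_run (N := N) (σ := σ) (m := σ - 1) (A := 4)
    (w := X)
    (off := .const 0) (L := .const 1) (n := .const 1) (e := kE)
    (μ := μ8) (ψ₀ := ψ₀) (o := 0) (a := 1) (b := 1) (n' := 1)
    (E := fun i j r => k) (by norm_num)
    (by
      intro S hS
      simp only [eval_const]
      simp)
    (by
      intro S hS i hi j hj r hr e1 e2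
      have s0 := hS 0 (by norm_num) (by norm_num)
      simp only [kE, eval_get, eval_const, s0, f8 0 (by norm_num), f7 0 (by norm_num),
        f6 0 (by norm_num), k5])
    (fun c hc => by
      rw [f8 4 (by norm_num), f7 4 (by norm_num), f6 4 (by norm_num)]
      apply hz5 4 <;> norm_num)
    (fun i hi j hj m hm => by
      rw [Finset.sum_const, Finset.card_range]
      interval_cases m
      · simp
      · rw [one_smul, Nat.abs_cast]
        exact_mod_cast hk.trans Nat.lt_two_pow_self.le)
    (by omega) (by omega) hσ0 hN
  have f09 : μ9 0 = μ5 0 := by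
    rw [f9 0 (by norm_num), f8 0 (by norm_num), f7 0 (by norm_num), f6 0 (by norm_num)]
  have k9 : μ9 0 0 = k := by rw [f09, k5]
  have l9 : μ9 0 1 = l := by rw [f09, l5]
  -- the powers
  obtain ⟨μ10, f10, v10, r10⟩ := powLoop_run (N := N) (σ := σ) (A := 27) (b := .const 2) (n := TE)
    (μ := μ9) (ψ₀ := ψ₀) (n' := T) (b' := 2) (by norm_num)
    (by
      intro S hS
      have s0 := hS 0 (by norm_num) (by norm_num)
      exact ⟨rfl, hTE S (by rw [s0, f09, f05,
        f0 0 (by norm_num) (by norm_num) (by norm_num) (by norm_num) (by norm_num)])⟩)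
    (fun i hi => bitSize_le_of_abs_le (n := T)
      (by rw [abs_pow]; exact pow_le_pow_right₀ (by norm_num) hi) hσ4)
    ((bitSize_natCast_le _).trans (by omega)) (by omega)
  have hX2 : 2 * X ≤ 2 * X * (18 * (X * X) + 17 * X + 2 * R + 1) :=
    Nat.le_mul_of_pos_right _ (by omega)
  obtain ⟨μ11, f11, v11, r11⟩ := powLoop_run (N := N) (σ := σ) (A := 29)
    (b := .get 25 (.const 0)) (n := lE + kE)
    (μ := μ10) (ψ₀ := ψ₀) (n' := l + k) (b' := levMod k l M R) (by norm_num)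
    (by
      intro S hS
      have s0 := hS 0 (by norm_num) (by norm_num)
      have s25 := hS 25 (by norm_num) (by norm_num)
      simp only [eval_add, lE, kE, eval_get, eval_const, s0, s25, f10 0 (by norm_num),
        f10 25 (by norm_num), f9 25 (by norm_num), f8 25 (by norm_num), f7 25 (by norm_num),
        k9, l9, v6']
      simp)
    (fun i hi => bitSize_le_of_abs_le
      (abs_pow_le_two_pow (abs_levMod_le hk hl hX hM hl0 R)
        (hi.trans (show l + k ≤ 2 * X by omega)))
      hσ3)
    ((bitSize_natCast_le _).trans (by omega)) (by omega)
  refine (r1.seq (r2.seq (r3.seq (r4.seq (r5.seq (r6.seq (r7.seq (r8.seq (r9.seq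
    (r10.seq r11)))))))))).mono (fun _ _ h => h) ?_ ?_
  · intro S ψ hS
    refine ⟨μ11, ⟨⟨?_, ?_, ?_, ?_, ?_, ?_⟩, ?_, ?_, ?_⟩, hS⟩
    · rw [f11 0 (by norm_num), f10 0 (by norm_num), k9]
    · rw [f11 0 (by norm_num), f10 0 (by norm_num), l9]
    · intro r hr j hj
      rw [f11 21 (by norm_num), f10 21 (by norm_num), f9 21 (by norm_num)]
      rcases lt_or_ge r l with h | h
      · have : (r : ℤ) * k + j < l * k := by exact_mod_cast grid_lt h hj
        rw [z8 _ (Or.inl this), v7 r h j hj]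
      · have := v8 (r - l) (by omega) j hj
        rw [Nat.add_sub_of_le h] at this
        rw [← this]
        congr 1
        push_cast [h]
        ring
    · rw [f11 25 (by norm_num), f10 25 (by norm_num), f9 25 (by norm_num), f8 25 (by norm_num),
        f7 25 (by norm_num), v6']
    · intro i hi
      rw [f11 27 (by norm_num), v10 i hi]
    · exact v11
    · rw [f11 4 (by norm_num), f10 4 (by norm_num)]
      have := v9' 0 (by norm_num) 0 (by norm_num)
      simpa using this
    · intro z hz
      rw [f11 4 (by norm_num), f10 4 (by norm_num), z9 z (by push_cast; omega),
        f8 4 (by norm_num), f7 4 (by norm_num), f6 4 (by norm_num)]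
      apply hz5 4 <;> norm_num
    · intro B hB h0 h4 z
      rw [f11 B (by omega), f10 B (by omega), f9 B h4, f8 B (by omega), f7 B (by omega),
        f6 B (by omega)]
      exact hz5 B h0 (by omega) (by omega) (by omega) (by omega) (by omega) (by omega) (by omega)
        (by omega) (by omega) (by omega) (by omega) z
  · have e0 : σ - 1 + 1 = σ := by omega
    rw [e0]
    have e1 : (T + 2) * (powWeight (.const 2) TE * σ) ≤ σ * (powWeight (.const 2) TE * σ) :=
      Nat.mul_le_mul_right _ hσ4
    have e2 : (l + k + 2) * (powWeight (.get 25 (.const 0)) (lE + kE) * σ) ≤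
        σ * (powWeight (.get 25 (.const 0)) (lE + kE) * σ) :=
      Nat.mul_le_mul_right _ (by omega)
    refine (Nat.add_le_add_left (Nat.add_le_add_left (Nat.add_le_add_left (Nat.add_le_add_left
      (Nat.add_le_add_left (Nat.add_le_add_left (Nat.add_le_add_left (Nat.add_le_add_left
      (Nat.add_le_add_left (Nat.add_le_add e1 e2) _) _) _) _) _) _) _) _) _).trans ?_
    simp only [← Nat.mul_add, ← Nat.add_mul]
    refine Nat.mul_le_mul_left _ (Nat.mul_le_mul_right _ ?_)
    rw [tablesWeight]
    have d1 : dotWeight (.const 0) (lE * kE) lE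
      (.get 9 (lastE + (cE / kE * lE + rE)) * .get 1 (rE * kE + cE % kE)) ≤ 10000 := by
      decide +kernel
    have d2 : dotWeight (.const 0) (kE * kE) lE
      (.get 1 (rE * kE + cE / kE) * .get 15 (rE * kE + cE % kE)) ≤ 10000 := by decide +kernel
    have d3 : dotWeight (.const 0) (kE * kE) (.const 1)
      (eqTest (cE / kE) (cE % kE) * .get 11 lastE - .get 17 cE) ≤ 10000 := by decide +kernel
    have d4 : dotWeight (.const 0) (.const 1) (kE * kE) (.get 19 rE * .get 19 rE) ≤ 10000 := by
      decide +kernel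
    have d6 : dotWeight (.const 0) (.const 1) (.const 1) (.get 11 lastE * .get 31 (.const 0)) ≤
      10000 := by decide +kernel
    have d7 : dotWeight (.const 0) (lE * kE) (.const 1) (.get 31 (.const 0) * .get 15 cE) ≤
      10000 := by decide +kernel
    have d8 : dotWeight (lE * kE) (kE * kE) (.const 1) (.get 19 cE) ≤ 10000 := by decide +kernel
    have d9 : dotWeight (.const 0) (.const 1) (.const 1) kE ≤ 10000 := by decide +kernel
    have d11 : powWeight (.get 25 (.const 0)) (lE + kE) ≤ 10000 := by decide +kernel
    omega

end Tables

/-! ### Translation of programs with oracle calls -/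

/-- The classical array in which the translated program keeps a classical array of the original
program. The output array `2` stays in place, and the values are even and non-zero, so that the
arrays `0`, `1` of the input and all odd ones are free. -/
def renC (A : ℕ) : ℕ := if A = 2 then 2 else 2 * A + 4

lemma renC_injective : Function.Injective renC := by
  intro A B h
  simp only [renC] at h
  split_ifs at h <;> omega

lemma renC_even (A : ℕ) : renC A % 2 = 0 := by
  simp only [renC]
  split_ifs <;> omega

lemma renC_ne_zero (A : ℕ) : renC A ≠ 0 := by
  simp only [renC]
  split_ifs <;> omega

lemma renC_ne_of_odd {A B : ℕ} (hB : B % 2 = 1) : B ≠ renC A := by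
  have := renC_even A
  omega

/-- Translation of classical expressions. -/
def CExp.ren : CExp → CExp
  | const z => const z
  | get A i => get (renC A) i.ren
  | op o d e => op o d.ren e.ren

lemma CExp.ren_eval {S S' : Store} (h : ∀ A, S' (renC A) = S A) (e : CExp) :
    e.ren.eval S' = e.eval S := by
  induction e with
  | const z => rfl
  | get A i ih => simp only [ren, eval, ih, h]
  | op o d e hd he => simp only [ren, eval, hd, he]

lemma CExp.ren_cost {S S' : Store} (h : ∀ A, S' (renC A) = S A) (e : CExp) :
    e.ren.cost S' = e.cost S := by
  induction e with
  | const z => rfl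
  | get A i ih => simp only [ren, cost, ih, h, CExp.ren_eval h]
  | op o d e hd he => simp only [ren, cost, hd, he, CExp.ren_eval h]

/-- The power of `2` with the value of `w` as exponent, from the table in array `27`. -/
def twoPowE (w : CExp) : CExp := .get 27 (w * .op .le (.const 0) w)

/-- Translation of quantum expressions. The integer registers `A` and the label registers `L`
become the integer registers `3 * A` and `3 * L + 1`. -/
def QExp.sim : QExp → QExp
  | classical e => classical e.ren
  | get A i => get (3 * A) i.ren
  | labelMod L i w => op .mod (get (3 * L + 1) i.ren) (classical (twoPowE w.ren))
  | labelLt L i w =>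
    op .mul (op .le (classical (.const 1 - twoPowE w.ren)) (get (3 * L + 1) i.ren))
      (op .le (get (3 * L + 1) i.ren) (classical (twoPowE w.ren - .const 1)))
  | op o d e => op o d.sim e.sim

/-- The counter of a loop with counter array `3`. -/
def loopE : CExp := .get 3 (.const 0)

/-- `A[u] += e` for all values of the loop counter less than `n`. -/
def qLoop (A : ℕ) (n u : CExp) (e : QExp) : Cmd := forLoop 3 n (.qadd A u e)

/-- Add the linear forms `levRow`, times `s`, of the registers of the array `A` to the
quantum array `2`. -/
def formsCmd (s : ℤ) (A : ℕ) : Cmd :=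
  qLoop 2 ((lE + kE) * kE) (loopE / kE)
    (.op .mul (.classical (.const s * .get 21 loopE)) (.get (3 * A) (loopE % kE)))

/-- Add the code of the residues of the quantum array `2`, times `2 s`, to a label register. -/
def codeCmd (s : ℤ) (L : ℕ) (j : CExp) : Cmd :=
  qLoop (3 * L + 1) (lE + kE) j
    (.op .mul (.classical (.const (2 * s) * .get 29 loopE))
      (.op .mod (.get 2 loopE) (.classical (.get 25 (.const 0)))))

/-- Translation of commands. An oracle call computes the linear forms, adds their code to the label
register, and uncomputes the linear forms. -/
def Cmd.sim : Cmd → Cmd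
  | skip => skip
  | assign A i e => assign (renC A) i.ren e.ren
  | coin A i => coin (renC A) i.ren
  | qadd A i e => qadd (3 * A) i.ren e.sim
  | hadamard A i => hadamard (3 * A) i.ren
  | phase A i => phase (3 * A) i.ren
  | measure D j A i => measure (renC D) j.ren (3 * A) i.ren
  | query s A L j => (formsCmd 1 A).seq ((codeCmd s L j.ren).seq (formsCmd (-1) A))
  | labelAdd s L i M j =>
    qadd (3 * L + 1) i.ren (.op .mul (.classical (.const s)) (.get (3 * M + 1) j.ren))
  | seq c d => seq c.sim d.sim
  | ite e c d => ite e.ren c.sim d.sim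
  | whileDo e c => whileDo e.ren c.sim

lemma QExp.Avoids.sim {A : ℕ} {e : QExp} (h : e.Avoids A) : e.sim.Avoids (3 * A) := by
  induction e with
  | classical e => trivial
  | get B i => simp only [QExp.sim, Avoids] at h ⊢; omega
  | labelMod L i w =>
    have h : 3 * L + 1 ≠ 3 * A := by omega
    exact ⟨h, trivial⟩
  | labelLt L i w =>
    have h : 3 * L + 1 ≠ 3 * A := by omega
    exact ⟨⟨trivial, h⟩, h, trivial⟩
  | op o d e hd he => exact ⟨hd h.1, he h.2⟩

lemma wellFormed_formsCmd (s : ℤ) (A : ℕ) : (formsCmd s A).WellFormed := by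
  have h : 3 * A ≠ 2 := by omega
  exact ⟨trivial, ⟨trivial, h⟩, trivial⟩

lemma wellFormed_codeCmd (s : ℤ) (L : ℕ) (j : CExp) : (codeCmd s L j).WellFormed := by
  have h : 2 ≠ 3 * L + 1 := by omega
  exact ⟨trivial, ⟨trivial, h, trivial⟩, trivial⟩

lemma Cmd.WellFormed.sim {c : Cmd} (h : c.WellFormed) : c.sim.WellFormed := by
  induction c with
  | qadd A i e => exact QExp.Avoids.sim h
  | query s A L j =>
    exact ⟨wellFormed_formsCmd _ _, wellFormed_codeCmd _ _ _, wellFormed_formsCmd _ _⟩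
  | labelAdd s L i M j =>
    have h' : L ≠ M := h
    exact ⟨trivial, by show 3 * M + 1 ≠ 3 * L + 1; omega⟩
  | seq c d hc hd => exact ⟨hc h.1, hd h.2⟩
  | ite e c d hc hd => exact ⟨hc h.1, hd h.2⟩
  | whileDo e c hc => exact hc h
  | _ => trivial

lemma Cmd.InMode.sim {m : Mode} {c : Cmd} (h : c.InMode m) : c.sim.InMode m := by
  induction c with
  | query s A L j => simp [Cmd.sim, formsCmd, codeCmd, qLoop, forLoop, InMode]
  | seq c d hc hd => exact ⟨hc h.1, hd h.2⟩
  | ite e c d hc hd => exact ⟨hc h.1, hd h.2⟩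
  | whileDo e c hc => exact hc h
  | coin A i => exact h
  | hadamard A i => exact h
  | phase A i => exact h
  | _ => trivial

lemma Cmd.queryFree_sim (c : Cmd) : c.sim.QueryFree := by
  induction c with
  | query s A L j => simp [Cmd.sim, formsCmd, codeCmd, qLoop, forLoop, QueryFree]
  | seq c d hc hd => exact ⟨hc, hd⟩
  | ite e c d hc hd => exact ⟨hc, hd⟩
  | whileDo e c hc => exact hc
  | _ => trivial

/-- Commands that use classical assignments only. -/
def Cmd.Classical : Cmd → Prop
  | assign _ _ _ => True
  | seq c d => c.Classical ∧ d.Classical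
  | whileDo _ c => c.Classical
  | _ => False

lemma Cmd.Classical.wellFormed {c : Cmd} (h : c.Classical) : c.WellFormed := by
  induction c with
  | assign A i e => trivial
  | seq c d hc hd => exact ⟨hc h.1, hd h.2⟩
  | whileDo e c hc => exact hc h
  | _ => exact h.elim

lemma Cmd.Classical.inMode {c : Cmd} (h : c.Classical) (m : Mode) : c.InMode m := by
  induction c with
  | assign A i e => trivial
  | seq c d hc hd => exact ⟨hc h.1, hd h.2⟩
  | whileDo e c hc => exact hc h
  | _ => exact h.elim

lemma Cmd.Classical.queryFree {c : Cmd} (h : c.Classical) : c.QueryFree := by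
  induction c with
  | assign A i e => trivial
  | seq c d hc hd => exact ⟨hc h.1, hd h.2⟩
  | whileDo e c hc => exact hc h
  | _ => exact h.elim

lemma classical_tablesCmd (TE RE : CExp) : (tablesCmd TE RE).Classical := by
  simp [tablesCmd, levCmd, gramCmd, identCmd, levPCmd, levTrCmd, levNCmd, levUCmd, levMUCmd,
    levVCmd, levVSqCmd, levQCmd, levModCmd, levRowCmd, levRowCmd', dimCmd, powLoop, dotLoop,
    forLoop, Cmd.Classical]

/-! ### Basis states of the translated program -/

/-- The basis state of the translated program that corresponds to a basis state of the original
program. -/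
def embed (B : Basis) : Basis where
  reg A := if A % 3 = 0 then B.reg (A / 3) else if A % 3 = 1 then B.lab (A / 3) else 0
  lab := 0

lemma embed_reg (B : Basis) (A : ℕ) : (embed B).reg (3 * A) = B.reg A := by
  simp [embed]

lemma embed_lab (B : Basis) (L : ℕ) : (embed B).reg (3 * L + 1) = B.lab L := by
  have h1 : (3 * L + 1) % 3 = 1 := by omega
  have h2 : (3 * L + 1) / 3 = L := by omega
  simp [embed, h1, h2]

lemma embed_two (B : Basis) : (embed B).reg 2 = 0 := by
  simp [embed]

lemma embed_injective : Function.Injective embed := by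
  intro B B' h
  ext1
  · funext A
    rw [← embed_reg, h, embed_reg]
  · funext L
    rw [← embed_lab, h, embed_lab]

lemma embed_addReg (A : ℕ) (i z : ℤ) (B : Basis) :
    embed (B.addReg A i z) = (embed B).addReg (3 * A) i z := by
  ext C n
  · by_cases h : C = 3 * A
    · subst h
      rw [embed_reg]
      simp only [Basis.addReg, embed_reg]
      rw [put_apply, put_apply]
      simp [embed_reg]
    · have h1 : ((embed B).addReg (3 * A) i z).reg C = (embed B).reg C := by
        simp only [Basis.addReg]; rw [put_of_ne _ _ _ h]
      rw [h1]
      simp only [embed]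
      split_ifs with h3 h4
      · have : C / 3 ≠ A := by omega
        simp only [Basis.addReg]; rw [put_of_ne _ _ _ this]
      · rfl
      · rfl
  · rfl

lemma embed_addLab (L : ℕ) (i z : ℤ) (B : Basis) :
    embed (B.addLab L i z) = (embed B).addReg (3 * L + 1) i z := by
  ext C n
  · by_cases h : C = 3 * L + 1
    · subst h
      rw [embed_lab]
      simp only [Basis.addReg, Basis.addLab, embed_lab]
      rw [put_apply, put_apply]
      simp [embed_lab]
    · have h1 : ((embed B).addReg (3 * L + 1) i z).reg C = (embed B).reg C := by
        simp only [Basis.addReg]; rw [put_of_ne _ _ _ h]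
      rw [h1]
      simp only [embed]
      split_ifs with h3 h4
      · rfl
      · have : C / 3 ≠ L := by omega
        simp only [Basis.addLab]; rw [put_of_ne _ _ _ this]
      · rfl
  · rfl

lemma embed_zero : embed ⟨fun _ _ => 0, fun _ _ => 0⟩ = ⟨fun _ _ => 0, fun _ _ => 0⟩ := by
  ext A n
  · simp only [embed]
    split_ifs <;> rfl
  · rfl

lemma filter_mapDomain_embed (ψ : Basis →₀ ℂ) (p q : Basis → Prop) [DecidablePred p]
    [DecidablePred q] (h : ∀ B, q (embed B) ↔ p B) :
    (ψ.mapDomain embed).filter q = (ψ.filter p).mapDomain embed := by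
  induction ψ using Finsupp.induction_linear with
  | zero =>
    have h0 : ∀ (r : Basis → Prop) [DecidablePred r], (0 : Basis →₀ ℂ).filter r = 0 := by
      intro r _
      ext
      simp [Finsupp.filter_apply]
    rw [Finsupp.mapDomain_zero, h0, h0, Finsupp.mapDomain_zero]
  | add f g hf hg => rw [Finsupp.mapDomain_add, Finsupp.filter_add, hf, hg, Finsupp.filter_add,
      Finsupp.mapDomain_add]
  | single B z =>
    rw [Finsupp.mapDomain_single]
    by_cases hB : p B
    · rw [Finsupp.filter_single_of_pos _ hB, Finsupp.filter_single_of_pos _ ((h B).2 hB),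
        Finsupp.mapDomain_single]
    · rw [Finsupp.filter_single_of_neg _ hB, Finsupp.filter_single_of_neg _ (mt (h B).1 hB),
        Finsupp.mapDomain_zero]

lemma support_mapDomain_embed (ψ : Basis →₀ ℂ) [DecidableEq Basis] :
    (ψ.mapDomain embed).support = ψ.support.image embed :=
  Finsupp.mapDomain_support_of_injective embed_injective ψ

lemma supCost_mapDomain_embed (ψ : Basis →₀ ℂ) (t : Basis → ℕ) :
    supCost (ψ.mapDomain embed) t = supCost ψ fun B => t (embed B) := by
  classical
  rw [supCost, support_mapDomain_embed, Finset.sup_image]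
  rfl

lemma hadamardGate_mapDomain_embed (A : ℕ) (i : ℤ) (ψ : Basis →₀ ℂ) :
    hadamardGate (3 * A) i (ψ.mapDomain embed) = (hadamardGate A i ψ).mapDomain embed := by
  rw [hadamardGate, hadamardGate, Finsupp.sum_mapDomain_index_inj embed_injective,
    Finsupp.mapDomain_sum]
  refine Finsupp.sum_congr fun B _ => ?_
  rw [embed_reg]
  split_ifs
  · rw [Finsupp.mapDomain_add, Finsupp.mapDomain_single, Finsupp.mapDomain_single, embed_addReg]
  · rw [sub_eq_add_neg, ← Finsupp.single_neg, sub_eq_add_neg, ← Finsupp.single_neg,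
      Finsupp.mapDomain_add, Finsupp.mapDomain_single, Finsupp.mapDomain_single, embed_addReg]
  · rw [Finsupp.mapDomain_single]

lemma phaseGate_mapDomain_embed (A : ℕ) (i : ℤ) (ψ : Basis →₀ ℂ) :
    phaseGate (3 * A) i (ψ.mapDomain embed) = (phaseGate A i ψ).mapDomain embed := by
  rw [phaseGate, phaseGate, Finsupp.sum_mapDomain_index_inj embed_injective,
    Finsupp.mapDomain_sum]
  refine Finsupp.sum_congr fun B _ => ?_
  rw [embed_reg, Finsupp.mapDomain_single]

/-- The Hadamard gate leaves the label registers as they are. -/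
lemma exists_mem_support_of_hadamardGate {A : ℕ} {i : ℤ} {ψ : Basis →₀ ℂ} {p : Basis → Prop}
    (hp : ∀ B z, p B → p (B.addReg A i z)) (h : ∀ B ∈ ψ.support, p B) :
    ∀ B ∈ (hadamardGate A i ψ).support, p B := by
  have key : hadamardGate A i ψ ∈ Finsupp.supported ℂ ℂ {B | p B} := by
    rw [hadamardGate, Finsupp.sum]
    refine Submodule.sum_mem _ fun B hB => ?_
    have hs : ∀ B' z, p B' → Finsupp.single B' z ∈ Finsupp.supported ℂ ℂ {B | p B} :=
      fun B' z h => Finsupp.single_mem_supported ℂ z h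
    split_ifs
    · exact Submodule.add_mem _ (hs _ _ (h B hB)) (hs _ _ (hp _ _ (h B hB)))
    · exact Submodule.sub_mem _ (hs _ _ (hp _ _ (h B hB))) (hs _ _ (h B hB))
    · exact hs _ _ (h B hB)
  exact fun B hB => (Finsupp.mem_supported ℂ _).1 key hB

lemma mem_support_of_phaseGate {A : ℕ} {i : ℤ} {ψ : Basis →₀ ℂ} {p : Basis → Prop}
    (h : ∀ B ∈ ψ.support, p B) : ∀ B ∈ (phaseGate A i ψ).support, p B := by
  have key : phaseGate A i ψ ∈ Finsupp.supported ℂ ℂ {B | p B} := by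
    rw [phaseGate, Finsupp.sum]
    exact Submodule.sum_mem _ fun B hB => Finsupp.single_mem_supported ℂ _ (h B hB)
  exact fun B hB => (Finsupp.mem_supported ℂ _).1 key hB

lemma mem_support_of_mapDomain {ψ : Basis →₀ ℂ} {g : Basis → Basis} {p : Basis → Prop}
    (h : ∀ B ∈ ψ.support, p (g B)) : ∀ B ∈ (ψ.mapDomain g).support, p B := by
  classical
  intro B hB
  obtain ⟨B', hB', rfl⟩ := Finset.mem_image.1 (Finsupp.mapDomain_support hB)
  exact h B' hB'

/-! ### Loops on the quantum memory -/

/-- The basis state `B`, with `c z` added to the registers `A[z]`. -/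
def Basis.addRegs (A : ℕ) (c : ℤ → ℤ) (B : Basis) : Basis :=
  { B with reg := Function.update B.reg A fun z => B.reg A z + c z }

lemma qLoop_run {N σ w : ℕ} {A : ℕ} {nE u : CExp} {e : QExp} {n : ℕ} {μ : Store}
    {ψ₀ : Basis →₀ ℂ} {g : Basis → Basis} {U : ℕ → ℤ} {E : ℕ → Basis → ℤ}
    (hn : ∀ S : Store, (∀ B ≠ 3, S B = μ B) → nE.eval S = n)
    (hu : ∀ S : Store, (∀ B ≠ 3, S B = μ B) → ∀ t < n, S 3 0 = t → u.eval S = U t)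
    (he : ∀ S : Store, (∀ B ≠ 3, S B = μ B) → MemBits σ S → ∀ t < n, S 3 0 = t →
      ∀ B ∈ ψ₀.support, ∀ c : ℤ → ℤ,
        e.eval S ((g B).addRegs A c) = E t B ∧ e.cost S ((g B).addRegs A c) ≤ w)
    (hcnt : n + 1 ≤ σ) (hN : σ ≤ N) :
    Run N (Agree σ μ (ψ₀.mapDomain g)) (qLoop A nE u e)
      (Agree σ μ (ψ₀.mapDomain fun B =>
        (g B).addRegs A fun z => ∑ t ∈ Finset.range n, if U t = z then E t B else 0))
      (σ * (w + (100 + u.weight + 2 * nE.weight) * σ)) := by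
  let G : ℕ → Basis → Basis := fun t B =>
    (g B).addRegs A fun z => ∑ t ∈ Finset.range t, if U t = z then E t B else 0
  let Inv : ℕ → Store → (Basis →₀ ℂ) → Prop := fun t S ψ =>
    Agree σ μ (ψ₀.mapDomain (G t)) S ψ ∧ S 3 0 = t
  have hcnt' : ∀ t ≤ n, bitSize t ≤ σ := fun t ht => (bitSize_natCast_le t).trans (by omega)
  have hbody : ∀ t < n, Run N (Inv t) (.qadd A u e)
      (fun S ψ => MemBits σ S ∧ S 3 0 = t ∧ Inv (t + 1) (put S 3 0 (t + 1 : ℕ)) ψ)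
      (u.weight * σ + w) := by
    rintro t ht s ⟨⟨h1, h2, h3⟩, h4⟩
    refine ⟨_, rfl, ⟨h2, h4, ⟨?_, h2.put (hcnt' _ ht), ?_⟩, put_same _ _ _ _⟩, ?_⟩
    · intro B hB
      rw [put_of_ne _ _ _ hB, h1 B hB]
    · simp only
      rw [h3, ← Finsupp.mapDomain_comp]
      refine Finsupp.mapDomain_congr fun B hB => ?_
      simp only [Function.comp, G]
      rw [(he s.mem h1 h2 t ht h4 B hB _).1, hu s.mem h1 t ht h4]
      ext C z
      · simp only [Basis.addReg, Basis.addRegs]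
        rw [put_apply]
        by_cases hC : C = A
        · subst hC
          simp only [Function.update_self, true_and, Finset.sum_range_succ]
          split_ifs with h5 h6 h6
          · rw [h5]; ring
          · exact absurd h5.symm h6
          · exact absurd h6.symm h5
          · ring
        · simp [hC]
      · rfl
    · have hc := u.cost_le h2
      have hs : supCost s.amp (fun B => e.cost s.mem B) ≤ w := by
        rw [h3]
        refine Finset.sup_le (mem_support_of_mapDomain fun B hB => ?_)
        exact (he s.mem h1 h2 t ht h4 B hB _).2
      simp only
      omega
  have hrun := Run.forLoop (P := Agree σ μ (ψ₀.mapDomain g)) (nE := nE) (σ := σ) (Inv := Inv)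
    (B := 3) (show n < N by omega) ?_ ?_ hbody
  · refine hrun.mono (fun _ _ h => h) (fun S ψ h => h.1) ?_
    refine Nat.mul_le_mul hcnt (le_of_eq ?_)
    ring
  · rintro S ψ ⟨h1, h2, h3⟩
    refine ⟨h2, ⟨?_, h2.put (by rw [bitSize_zero]; exact h2.one_le), ?_⟩, put_same _ _ _ _⟩
    · intro B hB
      rw [put_of_ne _ _ _ hB, h1 B hB]
    · rw [h3]
      congr 1
      funext B
      simp [G, Basis.addRegs]
  · rintro t ht S ψ ⟨⟨h1, h2, h3⟩, h4⟩
    exact ⟨h2, h4, hn S h1⟩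

/-- A constant such that a quantum expression costs at most that many times the bit length of the
registers that it reads. -/
def QExp.weight : QExp → ℕ
  | classical e => e.weight
  | get _ i => i.weight + 1
  | labelMod _ _ _ => 0
  | labelLt _ _ _ => 0
  | op _ d e => 2 * (d.weight + e.weight)

/-- The expression reads no labels, and only registers with values of at most `σ` bits. -/
def QExp.ReadsLe (S : Store) (B : Basis) (σ : ℕ) : QExp → Prop
  | classical _ => True
  | get A i => bitSize (B.reg A (i.eval S)) ≤ σ
  | labelMod _ _ _ => False
  | labelLt _ _ _ => False
  | op _ d e => d.ReadsLe S B σ ∧ e.ReadsLe S B σ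

lemma QExp.bitSize_eval_le_cost {S : Store} {B : Basis} {σ : ℕ} {e : QExp}
    (h : e.ReadsLe S B σ) : bitSize (e.eval S B) ≤ e.cost S B := by
  cases e with
  | classical e => exact e.bitSize_eval_le_cost S
  | get A i => exact Nat.le_add_left _ _
  | labelMod L i w => exact h.elim
  | labelLt L i w => exact h.elim
  | op o d e => exact Nat.le_add_left _ _

lemma QExp.cost_le {S : Store} {B : Basis} {σ : ℕ} {e : QExp} (hS : MemBits σ S)
    (h : e.ReadsLe S B σ) : e.cost S B ≤ e.weight * σ := by
  induction e with
  | classical e => exact e.cost_le hS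
  | get A i =>
    have h1 := i.cost_le hS
    have h2 : bitSize (B.reg A (i.eval S)) ≤ σ := h
    simp only [cost, weight]
    rw [Nat.add_mul]
    omega
  | labelMod L i w => exact h.elim
  | labelLt L i w => exact h.elim
  | op o d e hd he =>
    have h1 := hd h.1
    have h2 := he h.2
    have h3 := o.bitSize_eval_le (d.eval S B) (e.eval S B)
    have h4 := QExp.bitSize_eval_le_cost h.1
    have h5 := QExp.bitSize_eval_le_cost h.2
    simp only [cost, weight]
    nlinarith

/-! ### The simulation relation -/

/-- The numbers on which the simulation of a program with oracle depends. -/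
structure SimData where
  /-- the oracle of the simulated program -/
  O : Oracle
  /-- the rank of the lattice -/
  l : ℕ
  /-- the basis of the lattice -/
  M : ℕ → ℕ → ℤ
  /-- a bound for the 1-norm of the vectors that are queried -/
  R : ℕ
  /-- a bound for the time of the simulated program -/
  T : ℕ
  /-- a bound for the bit lengths in the tables -/
  σ : ℕ
  /-- a bound for the bit lengths of the values of the oracle -/
  φ : ℕ
  /-- the time after which the simulation starts -/
  τ : ℕ
  /-- the factor by which the simulation is slower than the simulated program -/
  Q : ℕ

/-- The conditions under which the simulation works: within the ball of radius `R`, the values of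
the oracle are given by the tables, and queries outside of it cost more than `T`. -/
structure SimData.Valid (D : SimData) : Prop where
  fee : ∀ x, D.O.fee x ≤ D.T → norm1 x ≤ D.R
  val : ∀ x, norm1 x ≤ D.R → D.O.val x =
    2 * residueCode (levMod D.O.dim D.l D.M D.R) (D.l + D.O.dim) (levForm D.O.dim D.l D.M D.R x)
  abs_val : ∀ x, norm1 x ≤ D.R → |D.O.val x| ≤ 2 ^ D.φ
  form : ∀ x, norm1 x ≤ D.R → ∀ r < D.l + D.O.dim,
    bitSize (levForm D.O.dim D.l D.M D.R x r) ≤ D.σ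
  radius : D.R + 1 ≤ D.σ
  count : (D.l + D.O.dim) * D.O.dim + 1 ≤ D.σ
  count' : D.l + D.O.dim + 1 ≤ D.σ
  one_le : 1 ≤ D.Q

/-- A bound for the cost of simulating one step, up to a constant. -/
def SimData.step (D : SimData) : ℕ := (D.σ + D.T) * (D.σ + D.T) + D.φ + D.T + 3

/-- A bound for the labels at time `t`. Labels can at most double in one unit of time, or grow by an
oracle value, which is at most `2 ^ φ`; the summand `2 ^ φ` makes this an induction invariant. -/
def LabLe (φ t : ℕ) (B : Basis) : Prop := ∀ L i, |B.lab L i| + 2 ^ φ ≤ 2 ^ (φ + t)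

lemma LabLe.mono {φ t t' : ℕ} {B : Basis} (h : LabLe φ t B) (ht : t ≤ t') : LabLe φ t' B :=
  fun L i => (h L i).trans (pow_le_pow_right₀ (by norm_num) (by omega))

lemma LabLe.bitSize_le {φ t : ℕ} {B : Basis} (h : LabLe φ t B) (L : ℕ) (i : ℤ) :
    bitSize (B.lab L i) ≤ φ + t + 1 := by
  refine bitSize_le_iff.2 (lt_of_lt_of_le ?_ (h L i))
  have : (0 : ℤ) < 2 ^ φ := by positivity
  omega

lemma LabLe.addReg {φ t : ℕ} {B : Basis} (h : LabLe φ t B) (A : ℕ) (i z : ℤ) :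
    LabLe φ t (B.addReg A i z) := h

lemma LabLe.addLab {φ t t' : ℕ} {B : Basis} (h : LabLe φ t B) (L : ℕ) (i z : ℤ)
    (hz : |z| ≤ 2 ^ (φ + t)) (ht : t < t') : LabLe φ t' (B.addLab L i z) := by
  have h2 : (2 : ℤ) ^ (φ + (t + 1)) ≤ 2 ^ (φ + t') :=
    pow_le_pow_right₀ (by norm_num) (by omega)
  have h3 : (2 : ℤ) ^ (φ + (t + 1)) = 2 * 2 ^ (φ + t) := by rw [← add_assoc, pow_succ']
  intro K j
  have h1 := h K j
  simp only [Basis.addLab]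
  rw [put_apply]
  split_ifs with hK
  · obtain ⟨rfl, rfl⟩ := hK
    have := abs_add_le (B.lab K j) z
    omega
  · have : (0 : ℤ) < 2 ^ (φ + t) := by positivity
    omega

/-- The state of the translated program represents the state of the original program. -/
structure Sim (D : SimData) (s s' : State) : Prop where
  mem : ∀ A, s'.mem (renC A) = s.mem A
  tab : Tables D.O.dim D.l D.M D.R D.T s'.mem
  bits : MemBits (D.σ + s.time) s'.mem
  amp : s'.amp = s.amp.mapDomain embed
  lab : ∀ B ∈ s.amp.support, LabLe D.φ s.time B
  time : s'.time ≤ D.τ + D.Q * s.time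

lemma Tables.congr {k l : ℕ} {M : ℕ → ℕ → ℤ} {R T : ℕ} {μ μ' : Store} (h : Tables k l M R T μ)
    (h' : ∀ B, B ≠ 3 → B = 0 ∨ B % 2 = 1 → μ' B = μ B) : Tables k l M R T μ' where
  dim := by rw [h' 0 (by norm_num) (by norm_num), h.dim]
  rank := by rw [h' 0 (by norm_num) (by norm_num), h.rank]
  row := by rw [h' 21 (by norm_num) (by norm_num)]; exact h.row
  modulus := by rw [h' 25 (by norm_num) (by norm_num), h.modulus]
  two := by rw [h' 27 (by norm_num) (by norm_num)]; exact h.two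
  base := by rw [h' 29 (by norm_num) (by norm_num)]; exact h.base

lemma Tables.put {k l : ℕ} {M : ℕ → ℕ → ℤ} {R T : ℕ} {μ : Store} (h : Tables k l M R T μ)
    (A : ℕ) (i z : ℤ) : Tables k l M R T (put μ (renC A) i z) := by
  refine h.congr fun B _ hB => put_of_ne _ _ _ fun hBA => ?_
  have h1 := renC_even A
  have h2 := renC_ne_zero A
  omega

lemma put_renC {μ S : Store} (h : ∀ A, μ (renC A) = S A) (A : ℕ) (i z : ℤ) (B : ℕ) :
    put μ (renC A) i z (renC B) = put S A i z B := by
  funext j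
  by_cases hB : B = A
  · simp [put_apply, h, hB]
  · simp [put_apply, h, hB, renC_injective.eq_iff]

/-! ### Simulation of quantum expressions -/

/-- A constant that bounds how much more a translated expression costs. -/
def QExp.simWeight : QExp → ℕ
  | classical _ => 1
  | get _ _ => 1
  | labelMod _ _ _ => 40
  | labelLt _ _ _ => 40
  | op _ d e => d.simWeight + e.simWeight

lemma bitSize_le_eval_le_two (x y : ℤ) : bitSize (BinOp.le.eval x y) ≤ 2 := by
  change bitSize (if x ≤ y then 1 else 0) ≤ 2
  split_ifs
  · rw [bitSize_one]
  · rw [bitSize_zero]; norm_num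

lemma le_eval_mul_le_eval (P x : ℤ) :
    BinOp.mul.eval (BinOp.le.eval (BinOp.sub.eval 1 P) x) (BinOp.le.eval x (BinOp.sub.eval P 1)) =
      if |x| < P then 1 else 0 := by
  change (if 1 - P ≤ x then (1 : ℤ) else 0) * (if x ≤ P - 1 then 1 else 0) = _
  have hiff : |x| < P ↔ 1 - P ≤ x ∧ x ≤ P - 1 := by rw [abs_lt]; omega
  by_cases h1 : 1 - P ≤ x <;> by_cases h2 : x ≤ P - 1 <;> simp [hiff, h1, h2]

lemma twoPowE_eval {k l : ℕ} {M : ℕ → ℕ → ℤ} {R T : ℕ} {S S' : Store}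
    (hS : ∀ A, S' (renC A) = S A) (ht : Tables k l M R T S') {w : CExp}
    (hw : (w.eval S).toNat ≤ T) :
    (twoPowE w.ren).eval S' = 2 ^ (w.eval S).toNat ∧
      (twoPowE w.ren).cost S' ≤ 3 * w.cost S + (w.eval S).toNat + 5 := by
  have hval : (w.ren * CExp.op .le (.const 0) w.ren).eval S' = ((w.eval S).toNat : ℤ) := by
    change w.ren.eval S' * (if 0 ≤ w.ren.eval S' then (1 : ℤ) else 0) = _
    rw [ren_eval hS]
    split_ifs <;> omega
  have h2 : (twoPowE w.ren).eval S' = 2 ^ (w.eval S).toNat := by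
    rw [twoPowE, eval_get, hval, ht.two _ hw]
  refine ⟨h2, ?_⟩
  have hb : bitSize ((w.eval S).toNat : ℤ) ≤ w.cost S :=
    (bitSize_mono (by rw [Nat.abs_cast, Int.abs_eq_natAbs]; omega)).trans
      (w.bitSize_eval_le_cost S)
  have hp : bitSize ((2 : ℤ) ^ (w.eval S).toNat) ≤ (w.eval S).toNat + 2 :=
    bitSize_le_of_abs_le (n := (w.eval S).toNat) (by rw [abs_pow]; norm_num) le_rfl
  have hc : (twoPowE w.ren).cost S' =
      (w.ren.cost S' + (bitSize 0 + w.ren.cost S' +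
        bitSize ((CExp.op .le (.const 0) w.ren).eval S')) +
        bitSize ((w.ren * CExp.op .le (.const 0) w.ren).eval S')) +
      bitSize ((twoPowE w.ren).eval S') := rfl
  have hle : bitSize ((CExp.op .le (.const 0) w.ren).eval S') ≤ 2 :=
    bitSize_le_eval_le_two _ _
  rw [hc, h2, hval, ren_cost hS, bitSize_zero]
  omega

lemma QExp.sim_eval_cost {k l : ℕ} {M : ℕ → ℕ → ℤ} {R T Λ : ℕ} {S S' : Store} {B : Basis}
    (hS : ∀ A, S' (renC A) = S A) (ht : Tables k l M R T S')
    (hΛ : ∀ L i, bitSize (B.lab L i) ≤ Λ) {e : QExp} (he : e.cost S B ≤ T) :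
    e.sim.eval S' (embed B) = e.eval S B ∧
      e.sim.cost S' (embed B) ≤ e.simWeight * (e.cost S B + Λ) := by
  induction e with
  | classical e =>
    simp only [QExp.sim, QExp.eval, QExp.cost, ren_eval hS, ren_cost hS, simWeight]
    exact ⟨trivial, by omega⟩
  | get A i =>
    simp only [QExp.sim, QExp.eval, QExp.cost, ren_eval hS, ren_cost hS, simWeight, embed_reg]
    exact ⟨trivial, by omega⟩
  | labelMod L i w =>
    simp only [QExp.cost] at he
    obtain ⟨h1, h2⟩ := twoPowE_eval hS ht (w := w) (by omega)
    have hp : bitSize ((2 : ℤ) ^ (w.eval S).toNat) ≤ (w.eval S).toNat + 2 :=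
      bitSize_le_of_abs_le (n := (w.eval S).toNat) (by rw [abs_pow]; norm_num) le_rfl
    have h3 := BinOp.mod.bitSize_eval_le (B.lab L (i.eval S)) (2 ^ (w.eval S).toNat)
    have h4 := hΛ L (i.eval S)
    simp only [QExp.sim, QExp.eval, QExp.cost, ren_eval hS, ren_cost hS, simWeight, embed_lab, h1]
    refine ⟨rfl, ?_⟩
    omega
  | labelLt L i w =>
    simp only [QExp.cost] at he
    obtain ⟨h1, h2⟩ := twoPowE_eval hS ht (w := w) (by omega)
    have hp : bitSize ((2 : ℤ) ^ (w.eval S).toNat) ≤ (w.eval S).toNat + 2 :=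
      bitSize_le_of_abs_le (n := (w.eval S).toNat) (by rw [abs_pow]; norm_num) le_rfl
    have h4 := hΛ L (i.eval S)
    have h5 := BinOp.sub.bitSize_eval_le 1 (2 ^ (w.eval S).toNat)
    have h6 := BinOp.sub.bitSize_eval_le (2 ^ (w.eval S).toNat) 1
    have h7 := bitSize_le_eval_le_two (BinOp.sub.eval 1 (2 ^ (w.eval S).toNat)) (B.lab L (i.eval S))
    have h8 := bitSize_le_eval_le_two (B.lab L (i.eval S)) (BinOp.sub.eval (2 ^ (w.eval S).toNat) 1)
    have h9 := BinOp.mul.bitSize_eval_le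
      (BinOp.le.eval (BinOp.sub.eval 1 (2 ^ (w.eval S).toNat)) (B.lab L (i.eval S)))
      (BinOp.le.eval (B.lab L (i.eval S)) (BinOp.sub.eval (2 ^ (w.eval S).toNat) 1))
    have e1 : (CExp.const 1 - twoPowE w.ren).eval S' = BinOp.sub.eval 1 (2 ^ (w.eval S).toNat) := by
      rw [eval_sub, eval_const, h1]; rfl
    have e2 : (twoPowE w.ren - CExp.const 1).eval S' = BinOp.sub.eval (2 ^ (w.eval S).toNat) 1 := by
      rw [eval_sub, eval_const, h1]; rfl
    have c1 : (CExp.const 1 - twoPowE w.ren).cost S' = 2 + (twoPowE w.ren).cost S' +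
        bitSize (BinOp.sub.eval 1 (2 ^ (w.eval S).toNat)) := by
      rw [← e1, ← bitSize_one]; rfl
    have c2 : (twoPowE w.ren - CExp.const 1).cost S' = (twoPowE w.ren).cost S' + 2 +
        bitSize (BinOp.sub.eval (2 ^ (w.eval S).toNat) 1) := by
      rw [← e2, ← bitSize_one]; rfl
    rw [bitSize_one] at h5 h6
    have hpos := i.one_le_cost S
    simp only [QExp.sim, QExp.eval, QExp.cost, ren_eval hS, ren_cost hS, simWeight, embed_lab, e1,
      e2, c1, c2]
    exact ⟨le_eval_mul_le_eval _ _, by omega⟩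
  | op o d e hd he' =>
    simp only [QExp.cost] at he
    obtain ⟨d1, d2⟩ := hd (by omega)
    obtain ⟨e1, e2⟩ := he' (by omega)
    simp only [QExp.sim, QExp.eval, QExp.cost, simWeight, d1, e1]
    refine ⟨trivial, ?_⟩
    have hpos : ∀ e : QExp, 1 ≤ e.simWeight := by
      intro e
      induction e with
      | op o d e hd _ => exact hd.trans (Nat.le_add_right _ _)
      | _ => simp [simWeight]
    have p1 := hpos d
    rw [Nat.add_mul]
    set b := bitSize (o.eval (d.eval S B) (e.eval S B))
    have i1 : d.simWeight * (d.cost S B + Λ) + b ≤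
        d.simWeight * (d.cost S B + e.cost S B + b + Λ) := by
      have : b ≤ d.simWeight * b := Nat.le_mul_of_pos_left _ p1
      have h2 : d.simWeight * (d.cost S B + e.cost S B + b + Λ) =
        d.simWeight * (d.cost S B + Λ) + d.simWeight * b + d.simWeight * e.cost S B := by ring
      omega
    have i2 : e.simWeight * (e.cost S B + Λ) ≤
        e.simWeight * (d.cost S B + e.cost S B + b + Λ) := Nat.mul_le_mul_left _ (by omega)
    omega

/-! ### Simulation of oracle calls -/

lemma sum_range_grid {a k : ℕ} (f : ℕ → ℤ) {r : ℕ} (hr : r < a) :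
    (∑ t ∈ Finset.range (a * k), if ((t / k : ℕ) : ℤ) = r then f t else 0) =
      ∑ j ∈ Finset.range k, f (r * k + j) := by
  have hdiv : ∀ a j, j < k → (a * k + j) / k = a := by
    intro a j hj
    rw [mul_comm, Nat.mul_add_div (by omega), Nat.div_eq_of_lt hj, add_zero]
  induction a with
  | zero => omega
  | succ a ih =>
    rw [Nat.add_mul, one_mul, Finset.sum_range_add]
    rcases Nat.lt_or_ge r a with h | h
    · rw [ih h]
      refine add_eq_left.2 (Finset.sum_eq_zero fun j hj => ?_)
      rw [hdiv a j (Finset.mem_range.1 hj), if_neg (by omega)]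
    · obtain rfl : r = a := by omega
      rw [Finset.sum_eq_zero (s := Finset.range (r * k)), zero_add]
      · refine Finset.sum_congr rfl fun j hj => ?_
        rw [hdiv r j (Finset.mem_range.1 hj), if_pos rfl]
      · intro t ht
        rw [if_neg]
        have : t / k < r := Nat.div_lt_of_lt_mul (by rw [mul_comm]; exact Finset.mem_range.1 ht)
        omega

/-- The contents of the scratch array after the computation of the linear forms. -/
def flatForms (D : SimData) (A : ℕ) (B : Basis) (z : ℤ) : ℤ :=
  ∑ t ∈ Finset.range ((D.l + D.O.dim) * D.O.dim),
    if ((t / D.O.dim : ℕ) : ℤ) = z then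
      levRow D.O.dim D.l D.M D.R (t / D.O.dim) (t % D.O.dim) * B.reg A (t % D.O.dim : ℕ) else 0

lemma flatForms_eq (D : SimData) (A : ℕ) (B : Basis) {r : ℕ} (hr : r < D.l + D.O.dim) :
    flatForms D A B r = levForm D.O.dim D.l D.M D.R (B.vec A D.O.dim) r := by
  rw [flatForms, sum_range_grid _ hr, levForm, Finset.sum_range]
  refine Finset.sum_congr rfl fun j _ => ?_
  rw [mul_comm r, Nat.mul_add_div j.pos, Nat.div_eq_of_lt j.2, Nat.mul_add_mod,
    Nat.mod_eq_of_lt j.2, add_zero]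
  rfl

lemma bitSize_reg_le {k R : ℕ} {B : Basis} {A : ℕ} (h : norm1 (B.vec A k) ≤ R) {j : ℕ}
    (hj : j < k) : bitSize (B.reg A j) ≤ R + 1 := by
  have h1 : (B.reg A j).natAbs ≤ R := by
    have := Finset.single_le_sum (f := fun i : Fin k => (B.vec A k i).natAbs)
      (fun _ _ => Nat.zero_le _) (Finset.mem_univ (⟨j, hj⟩ : Fin k))
    exact le_trans this h
  refine bitSize_le_iff.2 (lt_of_le_of_lt ?_ (b := (R : ℤ)) ?_)
  · rw [Int.abs_eq_natAbs]; exact_mod_cast h1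
  · exact_mod_cast Nat.lt_two_pow_self

section Query

variable {D : SimData} {N σ : ℕ} {μ : Store} {ψ₀ : Basis →₀ ℂ} {g : Basis → Basis}

lemma formsCmd_run (hD : D.Valid) (hμ : Tables D.O.dim D.l D.M D.R D.T μ)
    (hσ : D.σ ≤ σ) (hN : σ ≤ N) {s : ℤ} (hs : bitSize s ≤ 2) {A : ℕ}
    (hg : ∀ B ∈ ψ₀.support, (g B).reg (3 * A) = B.reg A)
    (hR : ∀ B ∈ ψ₀.support, norm1 (B.vec A D.O.dim) ≤ D.R) :
    Run N (Agree σ μ (ψ₀.mapDomain g)) (formsCmd s A)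
      (Agree σ μ (ψ₀.mapDomain fun B => (g B).addRegs 2 fun z => s * flatForms D A B z))
      (1000 * (σ * σ)) := by
  set k := D.O.dim with hk
  have hcount : (D.l + k) * k + 1 ≤ D.σ := hD.count
  have hradius := hD.radius
  have hkpos : ∀ t < (D.l + k) * k, 0 < k := by
    intro t ht
    rcases Nat.eq_zero_or_pos k with h | h
    · rw [h] at ht; omega
    · exact h
  have h := qLoop_run (N := N) (σ := σ) (A := 2) (nE := (lE + kE) * kE) (u := loopE / kE)
    (e := .op .mul (.classical (.const s * .get 21 loopE)) (.get (3 * A) (loopE % kE)))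
    (n := (D.l + k) * k) (μ := μ) (ψ₀ := ψ₀) (g := g) (w := 200 * σ)
    (U := fun t => ((t / k : ℕ) : ℤ))
    (E := fun t B => s * (levRow k D.l D.M D.R (t / k) (t % k) * B.reg A (t % k : ℕ)))
    (by
      intro S hS
      simp only [eval_mul, eval_add, lE, kE, eval_get, eval_const, hS 0 (by norm_num), hμ.dim,
        hμ.rank]
      push_cast; rfl)
    (by
      intro S hS t ht h3
      simp only [eval_div, loopE, kE, eval_get, eval_const, hS 0 (by norm_num), hμ.dim, h3]
      push_cast; rfl)
    (by
      intro S hS hb t ht h3 B hB c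
      have hk0 := hkpos t ht
      have hmod : t % k < k := Nat.mod_lt _ hk0
      have hrow := hμ.row (t / k) (Nat.div_lt_of_lt_mul (by rwa [mul_comm])) (t % k) hmod
      have ht' : ((t / k : ℕ) : ℤ) * k + (t % k : ℕ) = t := by
        have := Nat.div_add_mod t k
        rw [mul_comm] at this
        exact_mod_cast this
      rw [ht'] at hrow
      have hidx : (loopE % kE).eval S = (t % k : ℕ) := by
        simp only [eval_mod, loopE, kE, eval_get, eval_const, hS 0 (by norm_num), hμ.dim, h3]
        push_cast; rfl
      have hreg : ((g B).addRegs 2 c).reg (3 * A) = B.reg A := by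
        rw [← hg B hB]
        simp only [Basis.addRegs]
        rw [Function.update_of_ne (by omega)]
      constructor
      · have hcl : (CExp.const s * CExp.get 21 loopE).eval S =
            s * levRow k D.l D.M D.R (t / k) (t % k) := by
          simp only [eval_mul, eval_get, eval_const, loopE, h3, hS 21 (by norm_num), hrow]
        simp only [QExp.eval, BinOp.eval, hidx, hreg, hcl]
        ring
      · refine (QExp.cost_le hb ?_).trans (Nat.mul_le_mul_right _ ?_)
        · refine ⟨trivial, ?_⟩
          simp only [QExp.ReadsLe, hidx, hreg]
          exact (bitSize_reg_le (hR B hB) hmod).trans (hradius.trans hσ)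
        · have : (QExp.op .mul (.classical (.const s * .get 21 loopE))
            (.get (3 * A) (loopE % kE))).weight =
              2 * ((2 * (bitSize s + (bitSize 0 + 1 + 1))) +
                (2 * (bitSize 0 + 1 + (bitSize 0 + 1)) + 1)) := rfl
          rw [this, bitSize_zero]
          omega)
    (by omega) hN
  refine h.mono (fun _ _ h => h) (fun S ψ h => ?_) ?_
  · refine ⟨h.1, h.2.1, h.2.2.trans ?_⟩
    congr 1
    funext B
    congr 1
    funext z
    rw [flatForms, Finset.mul_sum]
    exact Finset.sum_congr rfl fun t _ => by rw [mul_ite, mul_zero]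
  · have e1 : (loopE / kE).weight ≤ 50 := by decide +kernel
    have e2 : ((lE + kE) * kE).weight ≤ 50 := by decide +kernel
    calc _ ≤ σ * (200 * σ + (100 + 50 + 2 * 50) * σ) := by gcongr
      _ = 450 * (σ * σ) := by ring
      _ ≤ _ := Nat.mul_le_mul_right _ (by norm_num)

lemma codeCmd_run (hD : D.Valid) (hμ : Tables D.O.dim D.l D.M D.R D.T μ)
    (hσ : D.σ ≤ σ) (hN : σ ≤ N) {s : ℤ} (hs : bitSize (2 * s) ≤ 3) {A L : ℕ} {j : CExp} {jv : ℤ}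
    (hj : ∀ S : Store, (∀ B ≠ 3, S B = μ B) → j.eval S = jv)
    (hg : ∀ B ∈ ψ₀.support, (g B).reg 2 = flatForms D A B)
    (hR : ∀ B ∈ ψ₀.support, norm1 (B.vec A D.O.dim) ≤ D.R) :
    Run N (Agree σ μ (ψ₀.mapDomain g)) (codeCmd s L j)
      (Agree σ μ (ψ₀.mapDomain fun B => (g B).addRegs (3 * L + 1) fun z =>
        if jv = z then s * D.O.val (B.vec A D.O.dim) else 0))
      ((1000 + j.weight) * (σ * σ)) := by
  set k := D.O.dim with hk
  have hcount : D.l + k + 1 ≤ D.σ := hD.count'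
  have h := qLoop_run (N := N) (σ := σ) (A := 3 * L + 1) (nE := lE + kE) (u := j)
    (e := .op .mul (.classical (.const (2 * s) * .get 29 loopE))
      (.op .mod (.get 2 loopE) (.classical (.get 25 (.const 0)))))
    (n := D.l + k) (μ := μ) (ψ₀ := ψ₀) (g := g) (w := 200 * σ)
    (U := fun _ => jv)
    (E := fun t B => s * (2 * (levMod k D.l D.M D.R ^ t *
      (levForm k D.l D.M D.R (B.vec A k) t % levMod k D.l D.M D.R))))
    (by
      intro S hS
      simp only [eval_add, lE, kE, eval_get, eval_const, hS 0 (by norm_num), hμ.dim, hμ.rank]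
      push_cast; rfl)
    (fun S hS _ _ _ => hj S hS)
    (by
      intro S hS hb t ht h3 B hB c
      have hreg : ((g B).addRegs (3 * L + 1) c).reg 2 = flatForms D A B := by
        rw [← hg B hB]
        simp only [Basis.addRegs]
        rw [Function.update_of_ne (by omega)]
      constructor
      · simp only [QExp.eval, BinOp.eval, eval_mul, eval_get, eval_const, hreg, loopE, h3,
          hS 29 (by norm_num), hS 25 (by norm_num), hμ.base t ht.le, hμ.modulus,
          flatForms_eq D A B ht]
        ring
      · refine (QExp.cost_le hb ?_).trans (Nat.mul_le_mul_right _ ?_)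
        · refine ⟨trivial, ?_, trivial⟩
          simp only [QExp.ReadsLe, hreg, loopE, eval_get, eval_const, h3, flatForms_eq D A B ht]
          exact (hD.form _ (hR B hB) t ht).trans hσ
        · have : (QExp.op .mul (.classical (.const (2 * s) * .get 29 loopE))
            (.op .mod (.get 2 loopE) (.classical (.get 25 (.const 0))))).weight =
              2 * ((2 * (bitSize (2 * s) + (bitSize 0 + 1 + 1))) +
                (2 * (bitSize 0 + 1 + 1 + (bitSize 0 + 1)))) := rfl
          rw [this, bitSize_zero]
          omega)
    (by omega) hN
  refine h.mono (fun _ _ h => h) (fun S ψ h => ?_) ?_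
  · refine ⟨h.1, h.2.1, h.2.2.trans (Finsupp.mapDomain_congr fun B hB => ?_)⟩
    congr 1
    funext z
    rw [hD.val _ (hR B hB), residueCode]
    split_ifs
    · rw [Finset.mul_sum, Finset.mul_sum]
    · simp
  · have e2 : (lE + kE).weight ≤ 50 := by decide +kernel
    calc _ ≤ σ * (200 * σ + (100 + j.weight + 2 * 50) * σ) := by gcongr
      _ = (400 + j.weight) * (σ * σ) := by ring
      _ ≤ _ := Nat.mul_le_mul_right _ (by omega)

lemma bitSize_unit (s : ℤˣ) : bitSize (s : ℤ) ≤ 2 ∧ bitSize (2 * (s : ℤ)) ≤ 3 := by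
  rcases Int.units_eq_one_or s with h | h <;> subst h <;> decide +kernel

/-- The translation of an oracle call has the effect of the oracle call. -/
lemma queryCmd_run (hD : D.Valid) (hμ : Tables D.O.dim D.l D.M D.R D.T μ)
    (hσ : D.σ ≤ σ) (hN : σ ≤ N) (s : ℤˣ) {A L : ℕ} {j : CExp} {jv : ℤ}
    (hj : ∀ S : Store, (∀ B ≠ 3, S B = μ B) → j.ren.eval S = jv)
    (hR : ∀ B ∈ ψ₀.support, norm1 (B.vec A D.O.dim) ≤ D.R) :
    Run N (Agree σ μ (ψ₀.mapDomain embed)) (Cmd.query s A L j).sim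
      (Agree σ μ ((ψ₀.mapDomain fun B =>
        B.addLab L jv (s * D.O.val (B.vec A D.O.dim))).mapDomain embed))
      ((3000 + j.ren.weight) * (σ * σ)) := by
  obtain ⟨b1, b2⟩ := bitSize_unit s
  have r1 := formsCmd_run (N := N) (σ := σ) (μ := μ) (ψ₀ := ψ₀) (g := embed) hD hμ hσ hN (s := 1)
    (by rw [bitSize_one]) (A := A) (fun B _ => embed_reg B A) hR
  have r2 := codeCmd_run (N := N) (σ := σ) (μ := μ) (ψ₀ := ψ₀)
    (g := fun B => (embed B).addRegs 2 fun z => 1 * flatForms D A B z) hD hμ hσ hN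
    b2 (A := A) (L := L) hj
    (fun B _ => by simp [Basis.addRegs, embed_two]) hR
  have r3 := formsCmd_run (N := N) (σ := σ) (μ := μ) (ψ₀ := ψ₀)
    (g := fun B => ((embed B).addRegs 2 fun z => 1 * flatForms D A B z).addRegs (3 * L + 1)
      fun z => if jv = z then s * D.O.val (B.vec A D.O.dim) else 0) hD hμ hσ hN (s := -1)
    (by rw [bitSize_neg, bitSize_one]) (A := A)
    (fun B _ => by
      have h1 : 3 * A ≠ 3 * L + 1 := by omega
      have h2 : 3 * A ≠ 2 := by omega
      simp [Basis.addRegs, h1, h2, embed_reg]) hR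
  refine (r1.seq (r2.seq r3)).mono (fun _ _ h => h) (fun S ψ h => ⟨h.1, h.2.1, h.2.2.trans ?_⟩) ?_
  · rw [← Finsupp.mapDomain_comp]
    congr 1
    funext B
    rw [Function.comp, embed_addLab]
    have h2 : 2 ≠ 3 * L + 1 := by omega
    ext C z
    · simp only [Basis.addRegs, Basis.addReg]
      rw [put_apply]
      by_cases hC : C = 3 * L + 1
      · subst hC
        simp only [h2.symm, ne_eq, not_false_eq_true, Function.update_of_ne, Function.update_self,
          true_and]
        by_cases hz : z = jv
        · subst hz; simp
        · rw [if_neg hz, if_neg (Ne.symm hz), add_zero]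
      · rw [if_neg (fun h => hC h.1)]
        by_cases hC2 : C = 2
        · subst hC2
          simp [h2]
        · simp [hC, hC2]
    · rfl
  · nlinarith [Nat.zero_le (σ * σ)]

end Query

/-! ### Branches of the translated program -/

lemma le_time_of_mem_loop {e : CExp} {body : State → Multiset State}
    (hb : ∀ s, ∀ t ∈ body s, s.time ≤ t.time) (n : ℕ) :
    ∀ s, ∀ t ∈ loop e body n s, s.time ≤ t.time := by
  induction n with
  | zero => intro s t ht; simp [loop] at ht
  | succ n ih =>
    intro s t ht
    rw [loop] at ht
    split_ifs at ht with h
    · rw [Multiset.mem_singleton.1 ht]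
      exact Nat.le_add_right _ _
    · obtain ⟨r, hr, hrt⟩ := Multiset.mem_bind.1 ht
      exact (Nat.le_add_right _ _).trans ((hb _ _ hr).trans (ih _ _ hrt))

lemma le_time_of_mem_exec {O : Oracle} {n : ℕ} {c : Cmd} :
    ∀ {s t : State}, t ∈ exec O n c s → s.time ≤ t.time := by
  induction c with
  | seq c d hc hd =>
    intro s t ht
    rw [exec] at ht
    obtain ⟨r, hr, hrt⟩ := Multiset.mem_bind.1 ht
    exact (hc hr).trans (hd hrt)
  | ite e c d hc hd =>
    intro s t ht
    rw [exec] at ht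
    split_ifs at ht with h
    · exact (Nat.le_add_right _ _).trans (hd ht)
    · exact (Nat.le_add_right _ _).trans (hc ht)
  | whileDo e c hc =>
    intro s t ht
    rw [exec] at ht
    exact le_time_of_mem_loop (fun s t ht => hc ht) n s t ht
  | coin A i =>
    intro s t ht
    rw [exec] at ht
    obtain ⟨z, -, rfl⟩ := Multiset.mem_map.1 ht
    simp only; omega
  | measure A j B i =>
    intro s t ht
    rw [exec] at ht
    obtain ⟨z, -, rfl⟩ := Multiset.mem_map.1 ht
    simp only; omega
  | _ =>
    intro s t ht
    rw [exec] at ht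
    obtain rfl := Multiset.mem_singleton.1 ht
    first
      | exact le_rfl
      | simp only [add_assoc, Nat.le_add_right]

/-- If the elements of `f a` satisfy `p` only if `a` satisfies `q`, then the elements that do not
satisfy `q` may be dropped first. -/
lemma filter_bind_eq {α β : Type*} {p : β → Prop} {q : α → Prop} [DecidablePred p]
    [DecidablePred q] {f : α → Multiset β} (m : Multiset α)
    (h : ∀ a, ∀ b ∈ f a, p b → q a) :
    (m.bind f).filter p = (m.filter q).bind fun a => (f a).filter p := by
  induction m using Multiset.induction_on with
  | empty => simp
  | cons a m ih =>
    rw [Multiset.cons_bind, Multiset.filter_add, ih]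
    by_cases hq : q a
    · rw [Multiset.filter_cons_of_pos _ hq, Multiset.cons_bind]
    · rw [Multiset.filter_cons_of_neg _ hq,
        Multiset.filter_eq_nil.2 fun b hb hp => hq (h a b hb hp), zero_add]

lemma exists_rel_bind {α β : Type*} {S : α → β → Prop} {f : α → Multiset α} {g : β → Multiset β}
    {X : Multiset α} {Y : Multiset β} (h : ∃ u ≤ Y, Multiset.Rel S X u)
    (hfg : ∀ a b, S a b → ∃ u ≤ g b, Multiset.Rel S (f a) u) :
    ∃ u ≤ Y.bind g, Multiset.Rel S (X.bind f) u := by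
  obtain ⟨u, hu, hX⟩ := h
  obtain ⟨v, rfl⟩ := Multiset.le_iff_exists_add.1 hu
  suffices ∃ w ≤ u.bind g, Multiset.Rel S (X.bind f) w by
    obtain ⟨w, hw, hr⟩ := this
    exact ⟨w, hw.trans (by rw [Multiset.add_bind]; exact Multiset.le_add_right _ _), hr⟩
  clear hu
  induction hX with
  | zero => exact ⟨0, le_rfl, by simp⟩
  | cons hab _ ih =>
    obtain ⟨w, hw, hr⟩ := ih
    obtain ⟨w', hw', hr'⟩ := hfg _ _ hab
    refine ⟨w' + w, ?_, ?_⟩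
    · rw [Multiset.cons_bind]; exact add_le_add hw' hw
    · rw [Multiset.cons_bind]; exact hr'.add hr

lemma exists_rel_map {ι α β : Type*} {S : α → β → Prop} {p : α → Prop} [DecidablePred p]
    (m : Multiset ι) {f : ι → α} {g : ι → β} (h : ∀ z ∈ m, p (f z) → S (f z) (g z)) :
    ∃ u ≤ m.map g, Multiset.Rel S ((m.map f).filter p) u := by
  induction m using Multiset.induction_on with
  | empty => exact ⟨0, by simp, by simp⟩
  | cons z m ih =>
    obtain ⟨u, hu, hr⟩ := ih fun z hz => h z (Multiset.mem_cons_of_mem hz)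
    rw [Multiset.map_cons, Multiset.map_cons]
    by_cases hp : p (f z)
    · rw [Multiset.filter_cons_of_pos _ hp]
      exact ⟨g z ::ₘ u, Multiset.cons_le_cons _ hu,
        Multiset.Rel.cons (h z (Multiset.mem_cons_self _ _) hp) hr⟩
    · rw [Multiset.filter_cons_of_neg _ hp]
      exact ⟨u, hu.trans (Multiset.le_cons_self _ _), hr⟩

lemma exists_rel_singleton {α β : Type*} {S : α → β → Prop} {p : α → Prop} [DecidablePred p]
    {a : α} {Y : Multiset β} (h : p a → ∃ b, Y = {b} ∧ S a b) :
    ∃ u ≤ Y, Multiset.Rel S (({a} : Multiset α).filter p) u := by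
  by_cases hp : p a
  · obtain ⟨b, rfl, hb⟩ := h hp
    refine ⟨{b}, le_rfl, ?_⟩
    rw [Multiset.filter_singleton, if_pos hp]
    exact Multiset.Rel.cons hb Multiset.Rel.zero
  · refine ⟨0, Multiset.zero_le _, ?_⟩
    rw [Multiset.filter_singleton, if_neg hp]
    exact Multiset.Rel.zero

/-! ### The simulation of programs -/

/-- A constant that bounds the factor by which the translation of a command is slower. -/
def Cmd.simWeight : Cmd → ℕ
  | qadd _ _ e => e.simWeight + 1
  | labelAdd _ _ _ _ _ => 10
  | query _ _ _ j => 3000 + j.ren.weight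
  | seq c d => c.simWeight + d.simWeight
  | ite _ c d => c.simWeight + d.simWeight
  | whileDo _ c => c.simWeight
  | _ => 1

section Sim

variable {D : SimData} {s s' : State}

/-- The translated program is slower at most by the factor `D.Q` also after one more step. -/
lemma Sim.le_cost {q a b t : ℕ} (hs : s'.time ≤ D.τ + D.Q * s.time) (ht : t = s.time + a)
    (hq : q = s'.time + b) (hab : b ≤ D.Q * a) : q ≤ D.τ + D.Q * t := by
  rw [ht, hq, Nat.mul_add]; omega

lemma Sim.wait (h : Sim D s s') (hD : D.Valid) (δ : ℕ) :
    Sim D { s with time := s.time + δ } { s' with time := s'.time + δ } where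
  mem := h.mem
  tab := h.tab
  bits A i := (h.bits A i).trans (by simp only; omega)
  amp := h.amp
  lab B hB := (h.lab B hB).mono (Nat.le_add_right _ _)
  time := Sim.le_cost h.time rfl rfl (Nat.le_mul_of_pos_left _ hD.one_le)

lemma Sim.bitSize_lab (h : Sim D s s') (hT : s.time ≤ D.T) {B : Basis} (hB : B ∈ s.amp.support)
    (L : ℕ) (i : ℤ) : bitSize (B.lab L i) ≤ D.φ + D.T + 1 :=
  ((h.lab B hB).bitSize_le L i).trans (by omega)

lemma le_supCost {ψ : Basis →₀ ℂ} (t : Basis → ℕ) {B : Basis} (hB : B ∈ ψ.support) :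
    t B ≤ supCost ψ t := Finset.le_sup (f := t) hB

lemma supCost_le {ψ : Basis →₀ ℂ} {t : Basis → ℕ} {n : ℕ} (h : ∀ B ∈ ψ.support, t B ≤ n) :
    supCost ψ t ≤ n := Finset.sup_le h

lemma MemBits.put_time {σ δ : ℕ} {S : Store} (h : MemBits σ S) {A : ℕ} {i z : ℤ}
    (hz : bitSize z ≤ σ + δ) : MemBits (σ + δ) (HSP.put S A i z) :=
  MemBits.put (fun B j => (h B j).trans (Nat.le_add_right _ _)) hz

lemma Sim.qadd (h : Sim D s s') {A : ℕ} {i : CExp} {e : QExp}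
    (hQ : (e.simWeight + 1) * D.step ≤ D.Q)
    (hT : s.time + i.cost s.mem + supCost s.amp (fun B => e.cost s.mem B) ≤ D.T) :
    Sim D
      { s with
        amp := s.amp.mapDomain fun B => B.addReg A (i.eval s.mem) (e.eval s.mem B)
        time := s.time + i.cost s.mem + supCost s.amp fun B => e.cost s.mem B }
      { s' with
        amp := s'.amp.mapDomain fun B => B.addReg (3 * A) (i.ren.eval s'.mem) (e.sim.eval s'.mem B)
        time := s'.time + i.ren.cost s'.mem + supCost s'.amp fun B => e.sim.cost s'.mem B } := by
  have key : ∀ B ∈ s.amp.support, e.sim.eval s'.mem (embed B) = e.eval s.mem B ∧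
      e.sim.cost s'.mem (embed B) ≤ e.simWeight * (e.cost s.mem B + (D.φ + D.T + 1)) :=
    fun B hB => QExp.sim_eval_cost h.mem h.tab (fun L i => h.bitSize_lab (by omega) hB L i)
      ((le_supCost (fun B => e.cost s.mem B) hB).trans (by omega))
  refine ⟨h.mem, h.tab, fun A i => (h.bits A i).trans (by simp only; omega), ?_, ?_, ?_⟩
  · simp only
    rw [h.amp, ← Finsupp.mapDomain_comp, ← Finsupp.mapDomain_comp]
    refine Finsupp.mapDomain_congr fun B hB => ?_
    simp only [Function.comp]
    rw [embed_addReg, (key B hB).1, ren_eval h.mem]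
  · exact mem_support_of_mapDomain fun B hB =>
      ((h.lab B hB).mono (by simp only; omega)).addReg _ _ _
  · refine Sim.le_cost h.time (add_assoc _ _ _) (add_assoc _ _ _) ?_
    rw [ren_cost h.mem, h.amp, supCost_mapDomain_embed]
    set c := supCost s.amp fun B => e.cost s.mem B
    have hc : supCost s.amp (fun B => e.sim.cost s'.mem (embed B)) ≤
        e.simWeight * (c + (D.φ + D.T + 1)) := by
      refine supCost_le fun B hB => (key B hB).2.trans (Nat.mul_le_mul_left _ ?_)
      have : e.cost s.mem B ≤ c := le_supCost (fun B => e.cost s.mem B) hB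
      omega
    have hi := i.one_le_cost s.mem
    have hstep : D.φ + D.T + 1 ≤ D.step := by unfold SimData.step; omega
    have h1 : e.simWeight * (c + (D.φ + D.T + 1)) ≤
        e.simWeight * (D.step * (i.cost s.mem + c)) := by
      refine Nat.mul_le_mul_left _ ?_
      have : D.step ≤ D.step * i.cost s.mem := Nat.le_mul_of_pos_right _ hi
      have : c ≤ D.step * c := Nat.le_mul_of_pos_left _ (by omega)
      rw [Nat.mul_add]; omega
    have h2 : i.cost s.mem ≤ D.step * (i.cost s.mem + c) :=
      (Nat.le_add_right _ c).trans (Nat.le_mul_of_pos_left _ (by omega))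
    calc _ ≤ (e.simWeight + 1) * D.step * (i.cost s.mem + c) := by
            rw [mul_assoc, Nat.add_mul, one_mul]; omega
      _ ≤ _ := Nat.mul_le_mul_right _ hQ

lemma Sim.labelAdd (h : Sim D s s') {r : ℤˣ} {L M : ℕ} {i j : CExp} (hQ : 10 * D.step ≤ D.Q)
    (hT : s.time + i.cost s.mem + j.cost s.mem ≤ D.T) :
    ∃ t', exec noOracle N (Cmd.labelAdd r L i M j).sim s' = {t'} ∧ Sim D
      { s with
        amp := s.amp.mapDomain fun B => B.addLab L (i.eval s.mem) (r * B.lab M (j.eval s.mem))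
        time := s.time + i.cost s.mem + j.cost s.mem } t' := by
  refine ⟨_, rfl, h.mem, h.tab, fun A i => (h.bits A i).trans (by simp only; omega), ?_, ?_, ?_⟩
  · simp only
    rw [h.amp, ← Finsupp.mapDomain_comp, ← Finsupp.mapDomain_comp]
    congr 1
    funext B
    simp only [Function.comp, QExp.eval, CExp.eval, BinOp.eval, embed_lab, embed_addLab,
      ren_eval h.mem]
  · have hi := i.one_le_cost s.mem
    refine mem_support_of_mapDomain fun B hB => (h.lab B hB).addLab _ _ _ ?_ (by simp only; omega)
    have h1 := h.lab B hB M (j.eval s.mem)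
    have h2 : (0 : ℤ) < 2 ^ D.φ := by positivity
    have h3 : |(r : ℤ) * B.lab M (j.eval s.mem)| = |B.lab M (j.eval s.mem)| := by
      rw [abs_mul, Int.abs_eq_natAbs (r : ℤ), Int.units_natAbs, Nat.cast_one, one_mul]
    omega
  · refine Sim.le_cost h.time (add_assoc _ _ _) (add_assoc _ _ _) ?_
    rw [ren_cost h.mem, h.amp, supCost_mapDomain_embed]
    have hi := i.one_le_cost s.mem
    have hstep : D.φ + D.T + 3 ≤ D.step := by unfold SimData.step; omega
    have hc : supCost s.amp (fun B => (QExp.op .mul (.classical (.const r))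
        (.get (3 * M + 1) j.ren)).cost s'.mem (embed B)) ≤
        j.cost s.mem + 2 * (D.φ + D.T + 1) + 4 := by
      refine supCost_le fun B hB => ?_
      simp only [QExp.cost, QExp.eval, CExp.cost, CExp.eval, embed_lab, ren_eval h.mem,
        ren_cost h.mem]
      have h1 := h.bitSize_lab (by omega) hB M (j.eval s.mem)
      have h2 := BinOp.mul.bitSize_eval_le r (B.lab M (j.eval s.mem))
      have h3 := (bitSize_unit r).1
      omega
    calc _ ≤ 10 * D.step * (i.cost s.mem + j.cost s.mem) := by nlinarith
      _ ≤ _ := Nat.mul_le_mul_right _ hQ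

lemma Sim.query (h : Sim D s s') (hD : D.Valid) {r : ℤˣ} {A L N : ℕ} {j : CExp}
    (hQ : (3000 + j.ren.weight) * D.step ≤ D.Q) (hN : D.σ + D.T ≤ N)
    (hT : s.time + j.cost s.mem + supCost s.amp (fun B => D.O.fee (B.vec A D.O.dim)) ≤ D.T) :
    ∃ t', exec noOracle N (Cmd.query r A L j).sim s' = {t'} ∧ Sim D
      { s with
        amp := s.amp.mapDomain fun B =>
          B.addLab L (j.eval s.mem) (r * D.O.val (B.vec A D.O.dim))
        time := s.time + j.cost s.mem + supCost s.amp fun B => D.O.fee (B.vec A D.O.dim) } t' := by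
  -- a query outside of the ball of radius `D.R` would cost too much
  have hR : ∀ B ∈ s.amp.support, norm1 (B.vec A D.O.dim) ≤ D.R := fun B hB =>
    hD.fee _ ((le_supCost (fun B => D.O.fee (B.vec A D.O.dim)) hB).trans (by omega))
  have hj : ∀ S : Store, (∀ B ≠ 3, S B = s'.mem B) → j.ren.eval S = j.eval s.mem := fun S hS =>
    ren_eval (fun A => by rw [hS _ (renC_ne_of_odd (by norm_num)).symm, h.mem]) j
  obtain ⟨t', h1, ⟨h2, h3, h4⟩, h5⟩ := queryCmd_run (N := N) (σ := D.σ + s.time) (L := L) hD h.tab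
    (Nat.le_add_right _ _) (by omega) r hj hR s' ⟨fun _ _ => rfl, h.bits, h.amp⟩
  have hjc := j.one_le_cost s.mem
  refine ⟨t', h1, fun A => ?_, h.tab.congr fun B hB _ => h2 B hB,
    fun A i => (h3 A i).trans (by simp only; omega), h4, ?_, ?_⟩
  · rw [h2 _ (renC_ne_of_odd (by norm_num)).symm, h.mem]
  · refine mem_support_of_mapDomain fun B hB => (h.lab B hB).addLab _ _ _ ?_ (by simp only; omega)
    rw [abs_mul, Int.abs_eq_natAbs (r : ℤ), Int.units_natAbs, Nat.cast_one, one_mul]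
    exact (hD.abs_val _ (hR B hB)).trans (pow_le_pow_right₀ (by norm_num) (by omega))
  · have hσ : (D.σ + s.time) * (D.σ + s.time) ≤ D.step := by
      have : (D.σ + s.time) * (D.σ + s.time) ≤ (D.σ + D.T) * (D.σ + D.T) :=
        Nat.mul_le_mul (by omega) (by omega)
      unfold SimData.step; omega
    refine h5.trans (Sim.le_cost h.time (add_assoc _ _ _) rfl ?_)
    calc _ ≤ D.Q := (Nat.mul_le_mul_left _ hσ).trans hQ
      _ ≤ _ := Nat.le_mul_of_pos_right _ (by omega)

variable {n N : ℕ}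

lemma Sim.loop (hD : D.Valid) {e : CExp} {c d : State → Multiset State}
    (hc : ∀ s, ∀ t ∈ c s, s.time ≤ t.time)
    (hcd : ∀ s s', Sim D s s' →
      ∃ u ≤ d s', Multiset.Rel (Sim D) ((c s).filter (·.time ≤ D.T)) u) (m : ℕ) :
    ∀ M, m ≤ M → ∀ s s', Sim D s s' → ∃ u ≤ HSP.loop e.ren d M s',
      Multiset.Rel (Sim D) ((HSP.loop e c m s).filter (·.time ≤ D.T)) u := by
  induction m with
  | zero => exact fun _ _ _ _ _ => ⟨0, Multiset.zero_le _, by simp [HSP.loop]⟩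
  | succ m ih =>
    intro M hM s s' h
    obtain ⟨M, rfl⟩ : ∃ M', M = M' + 1 := ⟨M - 1, by omega⟩
    have hw := h.wait hD (e.cost s.mem)
    simp only [HSP.loop, ren_eval h.mem, ren_cost h.mem]
    split_ifs with he
    · exact exists_rel_singleton fun _ => ⟨_, rfl, hw⟩
    · rw [filter_bind_eq (q := (·.time ≤ D.T)) _
        fun a b hb hp => (le_time_of_mem_loop hc m a b hb).trans hp]
      exact exists_rel_bind (hcd _ _ hw) fun a b hab => ih M (by omega) a b hab

/-- The translated program has branches that represent all branches of the original program that
end in time. -/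
lemma Sim.exec (hD : D.Valid) (hn : n ≤ N) (hN : D.σ + D.T ≤ N) (c : Cmd)
    (hQ : c.simWeight * D.step ≤ D.Q) : ∀ s s', Sim D s s' →
      ∃ u ≤ HSP.exec noOracle N c.sim s',
        Multiset.Rel (Sim D) ((HSP.exec D.O n c s).filter (·.time ≤ D.T)) u := by
  induction c with
  | skip => exact fun s s' h => exists_rel_singleton fun _ => ⟨_, rfl, h⟩
  | assign A i e =>
    refine fun s s' h => exists_rel_singleton fun hT => ⟨_, rfl, ?_, ?_, ?_, h.amp, ?_, ?_⟩
    · intro B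
      simp only [ren_eval h.mem]
      exact put_renC h.mem A _ _ B
    · exact h.tab.put _ _ _
    · simp only [ren_eval h.mem]
      rw [add_assoc s.time, ← add_assoc D.σ]
      refine h.bits.put_time ((e.bitSize_eval_le_cost s.mem).trans ?_)
      omega
    · exact fun B hB => (h.lab B hB).mono (by simp only; omega)
    · refine Sim.le_cost h.time (add_assoc _ _ _) (add_assoc _ _ _) ?_
      rw [ren_cost h.mem, ren_cost h.mem]
      exact Nat.le_mul_of_pos_left _ hD.one_le
  | coin A i =>
    intro s s' h
    refine exists_rel_map (S := Sim D) (p := (·.time ≤ D.T)) {0, 1}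
      fun z hz hT => ⟨?_, ?_, ?_, ?_, ?_, ?_⟩
    · intro B
      simp only [ren_eval h.mem]
      exact put_renC h.mem A _ _ B
    · exact h.tab.put _ _ _
    · rw [add_assoc s.time, ← add_assoc D.σ]
      have hi := i.one_le_cost s.mem
      have : bitSize z ≤ 2 := by
        rcases Multiset.mem_cons.1 hz with rfl | hz
        · decide +kernel
        · rw [Multiset.mem_singleton.1 hz]; decide +kernel
      exact h.bits.put_time (by omega)
    · simp only
      rw [h.amp, Finsupp.mapDomain_smul]
    · exact fun B hB => (h.lab B (Finsupp.support_smul hB)).mono (by simp only; omega)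
    · refine Sim.le_cost h.time (add_assoc _ _ _) (add_assoc _ _ _) ?_
      rw [ren_cost h.mem]
      exact Nat.le_mul_of_pos_left _ hD.one_le
  | qadd A i e => exact fun s s' h => exists_rel_singleton fun hT => ⟨_, rfl, h.qadd hQ hT⟩
  | hadamard A i =>
    refine fun s s' h => exists_rel_singleton fun hT => ⟨_, rfl, h.mem, h.tab, ?_, ?_, ?_, ?_⟩
    · exact fun A i => (h.bits A i).trans (by simp only; omega)
    · simp only [ren_eval h.mem]
      rw [h.amp, hadamardGate_mapDomain_embed]
    · exact exists_mem_support_of_hadamardGate (fun B z h => h.addReg _ _ _)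
        fun B hB => (h.lab B hB).mono (by simp only; omega)
    · refine Sim.le_cost h.time (add_assoc _ _ _) (add_assoc _ _ _) ?_
      rw [ren_cost h.mem]
      exact Nat.le_mul_of_pos_left _ hD.one_le
  | phase A i =>
    refine fun s s' h => exists_rel_singleton fun hT => ⟨_, rfl, h.mem, h.tab, ?_, ?_, ?_, ?_⟩
    · exact fun A i => (h.bits A i).trans (by simp only; omega)
    · simp only [ren_eval h.mem]
      rw [h.amp, phaseGate_mapDomain_embed]
    · exact mem_support_of_phaseGate fun B hB => (h.lab B hB).mono (by simp only; omega)
    · refine Sim.le_cost h.time (add_assoc _ _ _) (add_assoc _ _ _) ?_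
      rw [ren_cost h.mem]
      exact Nat.le_mul_of_pos_left _ hD.one_le
  | measure C j A i =>
    intro s s' h
    -- the outcomes of both measurements are the same
    have himage : (s'.amp.support.image fun B => B.reg (3 * A) (i.ren.eval s'.mem)) =
        s.amp.support.image fun B => B.reg A (i.eval s.mem) := by
      classical
      rw [h.amp, support_mapDomain_embed, Finset.image_image, ren_eval h.mem]
      simp only [Function.comp_def, embed_reg]
    simp only [Cmd.sim, HSP.exec]
    rw [himage]
    refine exists_rel_map (S := Sim D) (p := (·.time ≤ D.T)) _
      fun z hz hT => ⟨?_, ?_, ?_, ?_, ?_, ?_⟩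
    · intro B
      simp only [ren_eval h.mem]
      exact put_renC h.mem C _ _ B
    · exact h.tab.put _ _ _
    · rw [add_assoc s.time, add_assoc s.time, ← add_assoc D.σ]
      obtain ⟨B, hB, rfl⟩ := Finset.mem_image.1 hz
      refine h.bits.put_time
        ((le_supCost (fun B => bitSize (B.reg A (i.eval s.mem))) hB).trans ?_)
      omega
    · simp only
      rw [h.amp]
      exact filter_mapDomain_embed _ _ _ fun B => by rw [embed_reg, ren_eval h.mem]
    · exact fun B hB => (h.lab B (Finset.mem_of_mem_filter _ hB)).mono (by simp only; omega)
    · refine Sim.le_cost h.time (by rw [add_assoc, add_assoc]) (by rw [add_assoc, add_assoc]) ?_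
      rw [ren_cost h.mem, ren_cost h.mem, h.amp, supCost_mapDomain_embed, ren_eval h.mem]
      simp only [embed_reg]
      exact Nat.le_mul_of_pos_left _ hD.one_le
  | query r A L j => exact fun s s' h => exists_rel_singleton fun hT => h.query hD hQ hN hT
  | labelAdd r L i M j => exact fun s s' h => exists_rel_singleton fun hT => h.labelAdd hQ hT
  | seq c d hc hd =>
    intro s s' h
    simp only [Cmd.simWeight, Nat.add_mul] at hQ
    simp only [Cmd.sim, HSP.exec]
    rw [filter_bind_eq (q := (·.time ≤ D.T)) _ fun a b hb hp => (le_time_of_mem_exec hb).trans hp]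
    exact exists_rel_bind (hc (by omega) _ _ h) fun a b hab => hd (by omega) a b hab
  | ite e c d hc hd =>
    intro s s' h
    simp only [Cmd.simWeight, Nat.add_mul] at hQ
    have hw := h.wait hD (e.cost s.mem)
    simp only [Cmd.sim, HSP.exec, ren_eval h.mem, ren_cost h.mem]
    split_ifs with he
    · exact hd (by omega) _ _ hw
    · exact hc (by omega) _ _ hw
  | whileDo e c hc =>
    exact Sim.loop hD (fun s t ht => le_time_of_mem_exec ht) (hc hQ) n N hn

end Sim

/-! ### Probabilities of success -/

lemma State.prob_nonneg (s : State) : 0 ≤ s.prob :=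
  Finset.sum_nonneg fun _ _ => by positivity

lemma Sim.prob_eq {D : SimData} {s s' : State} (h : Sim D s s') : s'.prob = s.prob := by
  rw [State.prob, h.amp, Finsupp.sum_mapDomain_index_inj embed_injective, State.prob]

lemma sum_map_le_of_le {α : Type*} {X Y : Multiset α} (h : X ≤ Y) {f : α → ℝ} (hf : ∀ a, 0 ≤ f a) :
    (X.map f).sum ≤ (Y.map f).sum := by
  obtain ⟨Z, rfl⟩ := Multiset.le_iff_exists_add.1 h
  rw [Multiset.map_add, Multiset.sum_add]
  refine le_add_of_nonneg_right (Multiset.sum_nonneg fun x hx => ?_)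
  obtain ⟨a, -, rfl⟩ := Multiset.mem_map.1 hx
  exact hf a

lemma sum_filter_le_of_rel {α β : Type*} {S : α → β → Prop} {X : Multiset α} {Y : Multiset β}
    (h : Multiset.Rel S X Y) {p : α → Prop} {q : β → Prop} [DecidablePred p] [DecidablePred q]
    {f : α → ℝ} {g : β → ℝ} (hg : ∀ b, 0 ≤ g b)
    (hS : ∀ a b, S a b → p a → q b ∧ f a = g b) :
    ((X.filter p).map f).sum ≤ ((Y.filter q).map g).sum := by
  induction h with
  | zero => simp
  | @cons a b X Y hab _ ih =>
    by_cases hp : p a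
    · obtain ⟨hq, hfg⟩ := hS a b hab hp
      rw [Multiset.filter_cons_of_pos _ hp, Multiset.filter_cons_of_pos _ hq]
      simp only [Multiset.map_cons, Multiset.sum_cons, hfg]
      gcongr
    · rw [Multiset.filter_cons_of_neg _ hp]
      exact ih.trans (sum_map_le_of_le (Multiset.filter_le_filter _ (Multiset.le_cons_self _ _)) hg)

lemma Succeeds.mono {O : Oracle} {c : Cmd} {input : Store} {t t' : ℕ} {P : Store → Prop}
    (h : Succeeds O c input t P) (ht : t ≤ t') : Succeeds O c input t' P := by
  classical
  obtain ⟨n, hn⟩ := h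
  refine ⟨n, hn.trans (sum_map_le_of_le ?_ State.prob_nonneg)⟩
  exact Multiset.monotone_filter_right _ fun s hs => ⟨hs.1.trans ht, hs.2⟩

/-- A program with oracle that succeeds in time `T` can be replaced by a preparation of tables,
followed by the translated program. -/
lemma Succeeds.sim {D : SimData} (hD : D.Valid) {c pre : Cmd} {input input' : Store} {N₀ : ℕ}
    (hQ : c.simWeight * D.step ≤ D.Q)
    (hpre : ∀ N, N₀ ≤ N → ∃ s', exec noOracle N pre (start input') = {s'} ∧ Sim D (start input) s')
    {P P' : Store → Prop} (hP : ∀ S S', (∀ A, S' (renC A) = S A) → P S → P' S')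
    (h : Succeeds D.O c input D.T P) :
    Succeeds noOracle (pre.seq c.sim) input' (D.τ + D.Q * D.T) P' := by
  classical
  obtain ⟨n, hn⟩ := h
  set N := N₀ + n + (D.σ + D.T) with hN
  obtain ⟨s', h1, h2⟩ := hpre N (by omega)
  obtain ⟨u, hu, hr⟩ := h2.exec (n := n) (N := N) hD (by omega) (by omega) c hQ
  refine ⟨N, hn.trans ?_⟩
  rw [exec, h1, Multiset.singleton_bind]
  refine le_trans (le_of_eq ?_) ((sum_filter_le_of_rel hr
    (p := fun s => s.time ≤ D.T ∧ P s.mem) (q := fun s => s.time ≤ D.τ + D.Q * D.T ∧ P' s.mem)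
    (f := State.prob) State.prob_nonneg ?_).trans
    (sum_map_le_of_le (Multiset.filter_le_filter _ hu) State.prob_nonneg))
  · rw [Multiset.filter_filter]
    congr 2
    refine Multiset.filter_congr fun s _ => ?_
    tauto
  · rintro s s' hs ⟨ht, hc⟩
    exact ⟨⟨hs.time.trans (Nat.add_le_add_left (Nat.mul_le_mul_left _ ht) _), hP _ _ hs.mem hc⟩,
      hs.prob_eq.symm⟩

/-! ### Polynomial bounds -/

/-- The function has a polynomial bound of the form that the time bounds have. -/
def PolyBound (g : ℕ → ℕ) : Prop := ∃ C, ∀ X, 1 ≤ X → g X ≤ C * X ^ C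

namespace PolyBound

variable {g h : ℕ → ℕ}

lemma const (c : ℕ) : PolyBound fun _ => c :=
  ⟨c, fun _ hX => Nat.le_mul_of_pos_right _ (Nat.pow_pos hX)⟩

lemma id : PolyBound fun X => X := ⟨1, fun X _ => by simp⟩

lemma add (hg : PolyBound g) (hh : PolyBound h) : PolyBound fun X => g X + h X := by
  obtain ⟨C, hC⟩ := hg
  obtain ⟨C', hC'⟩ := hh
  refine ⟨C + C', fun X hX => ?_⟩
  rw [Nat.add_mul]
  refine add_le_add ((hC X hX).trans ?_) ((hC' X hX).trans ?_) <;>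
    exact Nat.mul_le_mul_left _ (Nat.pow_le_pow_right hX (by omega))

lemma mul (hg : PolyBound g) (hh : PolyBound h) : PolyBound fun X => g X * h X := by
  obtain ⟨C, hC⟩ := hg
  obtain ⟨C', hC'⟩ := hh
  refine ⟨C * C' + C + C', fun X hX => ?_⟩
  calc g X * h X ≤ C * X ^ C * (C' * X ^ C') := Nat.mul_le_mul (hC X hX) (hC' X hX)
    _ = C * C' * X ^ (C + C') := by ring
    _ ≤ _ := Nat.mul_le_mul (by omega) (Nat.pow_le_pow_right hX (by omega))

lemma pow (hg : PolyBound g) (n : ℕ) : PolyBound fun X => g X ^ n := by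
  induction n with
  | zero => simpa using const 1
  | succ n ih => simpa only [pow_succ] using ih.mul hg

end PolyBound

/-- Points in which the fee is at most `T` have polynomially bounded 1-norm. -/
lemma PseudoPolynomial.exists_norm1_le {fee : (k : ℕ) → (Fin k → ℤ) → ℕ}
    (h : PseudoPolynomial fee) :
    ∃ E : ℕ, ∀ (k : ℕ) (x : Fin k → ℤ) (T : ℕ), fee k x ≤ T → norm1 x ≤ E * (T + 1) ^ E := by
  obtain ⟨N, c, α, _, _, hc, hα, h⟩ := h
  refine ⟨N + ⌈(1 / c) ^ (1 / α)⌉₊ + ⌈1 / α⌉₊, fun k x T hT => ?_⟩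
  set E := N + ⌈(1 / c) ^ (1 / α)⌉₊ + ⌈1 / α⌉₊ with hE
  rcases lt_or_ge (norm1 x + k) N with hN | hN
  · calc norm1 x ≤ E := by omega
      _ ≤ _ := Nat.le_mul_of_pos_right _ (by positivity)
  have h1 := (h k x hN).1
  have h2 : ((norm1 x + k : ℕ) : ℝ) ^ α ≤ 1 / c * (T + 1 : ℕ) := by
    rw [one_div, inv_mul_eq_div, le_div_iff₀ hc, mul_comm]
    exact h1.trans (by exact_mod_cast hT.trans (Nat.le_succ T))
  have h3 : ((norm1 x + k : ℕ) : ℝ) ≤ (1 / c) ^ (1 / α) * ((T + 1 : ℕ) : ℝ) ^ (1 / α) := by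
    have := Real.rpow_le_rpow (by positivity) h2 (show 0 ≤ 1 / α by positivity)
    rwa [← Real.rpow_mul (by positivity), mul_one_div_cancel hα.ne', Real.rpow_one,
      Real.mul_rpow (by positivity) (by positivity)] at this
  have h4 : ((T + 1 : ℕ) : ℝ) ^ (1 / α) ≤ ((T + 1 : ℕ) : ℝ) ^ E := by
    rw [← Real.rpow_natCast]
    refine Real.rpow_le_rpow_of_exponent_le (by exact_mod_cast Nat.succ_pos T) ?_
    refine (Nat.le_ceil _).trans ?_
    exact_mod_cast Nat.le_add_left _ _
  have h5 : (1 / c) ^ (1 / α) ≤ (E : ℝ) :=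
    (Nat.le_ceil _).trans (by rw [hE]; exact_mod_cast by omega)
  have h6 : ((norm1 x + k : ℕ) : ℝ) ≤ ((E * (T + 1) ^ E : ℕ) : ℝ) := by
    refine h3.trans ?_
    push_cast at h4 h5 ⊢
    gcongr
  have h7 : norm1 x + k ≤ E * (T + 1) ^ E := by exact_mod_cast h6
  omega

/-! ### The input and its size -/

section Input

variable {k l : ℕ} (M : Fin l → Fin k → ℤ)

/-- The entries of a basis, with natural numbers as indices. -/
def entry (i j : ℕ) : ℤ := if h : i < l ∧ j < k then M ⟨i, h.1⟩ ⟨j, h.2⟩ else 0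

lemma entry_val (i : Fin l) (j : Fin k) : entry M i j = M i j := by
  simp [entry]

lemma usvpInput_one (a : ℕ) {i j : ℕ} (hi : i < l) (hj : j < k) :
    usvpInput a M 1 (i * k + j) = entry M i j := by
  have h : ∀ (i' : Fin l) (j' : Fin k), ((i * k + j : ℤ) = (i' : ℕ) * k + (j' : ℕ)) ↔
      (⟨i, hi⟩ : Fin l) = i' ∧ (⟨j, hj⟩ : Fin k) = j' := by
    intro i' j'
    have hk : 0 < k := by omega
    constructor
    · intro h
      have h' : i * k + j = i' * k + j' := by exact_mod_cast h
      have hd : ∀ a b, b < k → (a * k + b) / k = a ∧ (a * k + b) % k = b := by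
        intro a b hb
        rw [mul_comm a]
        exact ⟨by rw [Nat.mul_add_div hk, Nat.div_eq_of_lt hb, add_zero],
          by rw [Nat.mul_add_mod, Nat.mod_eq_of_lt hb]⟩
      obtain ⟨h1, h2⟩ := hd i j hj
      obtain ⟨h3, h4⟩ := hd i' j' j'.2
      rw [h'] at h1 h2
      exact ⟨Fin.ext (h1.symm.trans h3), Fin.ext (h2.symm.trans h4)⟩
    · rintro ⟨rfl, rfl⟩; rfl
  rw [entry, dif_pos ⟨hi, hj⟩, usvpInput, if_neg (by norm_num), if_pos rfl]
  rw [Finset.sum_eq_single ⟨i, hi⟩, Finset.sum_eq_single ⟨j, hj⟩, if_pos rfl]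
  · intro j' _ hj'
    rw [if_neg]
    exact fun h' => hj' ((h _ _).1 h').2.symm
  · simp
  · intro i' _ hi'
    refine Finset.sum_eq_zero fun j' _ => ?_
    rw [if_neg]
    exact fun h' => hi' ((h _ _).1 h').1.symm
  · simp

lemma bitSize_le_bitComplexity (i : Fin l) (j : Fin k) : bitSize (M i j) ≤ bitComplexity M :=
  (Finset.single_le_sum (f := fun j => bitSize (M i j)) (fun _ _ => Nat.zero_le _)
    (Finset.mem_univ j)).trans
    (Finset.single_le_sum (f := fun i => ∑ j, bitSize (M i j)) (fun _ _ => Nat.zero_le _)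
      (Finset.mem_univ i))

lemma mul_le_bitComplexity : l * k ≤ bitComplexity M := by
  calc l * k = ∑ _i : Fin l, ∑ _j : Fin k, 1 := by simp
    _ ≤ _ := Finset.sum_le_sum fun i _ => Finset.sum_le_sum fun j _ => one_le_bitSize _

lemma abs_entry_le {X : ℕ} (hX : bitComplexity M ≤ X) (i j : ℕ) : |entry M i j| ≤ 2 ^ X := by
  rw [entry]
  split_ifs with h
  · exact (bitSize_le_iff.1 (((bitSize_le_bitComplexity M _ _).trans hX).trans
      (Nat.le_succ X))).le
  · simp

lemma memBits_usvpInput {a X σ : ℕ} (hX : a + k + bitComplexity M ≤ X) (hl : l ≤ X)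
    (hσ : 3 * X + 2 ≤ σ) : MemBits σ (usvpInput a M) := by
  have hn : ∀ n : ℕ, n ≤ X → bitSize n ≤ σ := fun n hn =>
    (bitSize_natCast_le n).trans (by omega)
  intro A n
  rw [usvpInput]
  split_ifs
  · exact hn k (by omega)
  · exact hn l hl
  · exact hn a (by omega)
  · exact hn 0 (by omega)
  · refine bitSize_le_of_abs_le (n := X + (X + X)) ?_ (by omega)
    have hsum : ∀ {m : ℕ} (f : Fin m → ℤ) (b : ℕ), m ≤ X → (∀ i, |f i| ≤ 2 ^ b) →
        |∑ i, f i| ≤ 2 ^ (X + b) := by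
      intro m f b hm hf
      have := abs_sum_range_le (E := fun i => if h : i < m then f ⟨i, h⟩ else 0) (n := b) (b := X)
        (j := m) (hm.trans Nat.lt_two_pow_self.le) fun r hr => by rw [dif_pos hr]; exact hf _
      rwa [Finset.sum_range, Finset.sum_congr rfl fun i _ => dif_pos i.2] at this
    refine hsum _ _ hl fun i => hsum _ _ (by omega) fun j => ?_
    split_ifs
    · rw [← entry_val M i j]; exact abs_entry_le M (by omega) _ _
    · simp
  · exact hn 0 (by omega)

end Input

/-! ### Short vectors from hidden subgroups -/

/-- The number of bits of the tables, in terms of the size of the input and the bounds for the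
simulated program. -/
def tableBits (X R : ℕ) : ℕ := 18 * (X * X) + 17 * X + 2 * R + 1

/-- The number of bits of the numbers in the classical memory. -/
def memBound (X R T : ℕ) : ℕ :=
  X * (X * X) + 2 * X * tableBits X R + 2 * tableBits X R + T + R + 3 * X + 5

/-- The number of bits of the simulated values of the hiding function. -/
def valueBits (X R : ℕ) : ℕ := 2 * X * tableBits X R + 2 * X + 1

/-- The time for the computation of the tables. -/
def prepTime (w X R T : ℕ) : ℕ :=
  (X + 2) * (memBound X R T * (12000 * memBound X R T)) +
    memBound X R T * (w * memBound X R T)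

/-- The factor by which the simulation is slower. -/
def slowdown (z X R T : ℕ) : ℕ :=
  z * ((memBound X R T + T) * (memBound X R T + T) + valueBits X R + T + 3) + 1

section Reduction

variable {k l a X R T : ℕ} {M : Fin l → Fin k → ℤ} {v : Fin k → ℤ} {b : ℕ} {p : ENNReal}

/-- The values of the simulated hiding function; they are even, so that the odd numbers are left
for an extension to the whole group. -/
def hidingValue (M : Fin l → Fin k → ℤ) (R : ℕ) (x : Fin k → ℤ) : ℤ :=
  2 * residueCode (levMod k l (entry M) R) (l + k) (levForm k l (entry M) R x)

lemma levForm_sub {E : ℕ → ℕ → ℤ} (x y : Fin k → ℤ) (r : ℕ) :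
    levForm k l E R (y - x) r = levForm k l E R y r - levForm k l E R x r := by
  simp only [levForm, Pi.sub_apply, mul_sub, Finset.sum_sub_distrib]

lemma hidingValue_eq_iff (hli : LinearIndependent ℤ M) (hl : 0 < l) {x y : Fin k → ℤ}
    (hx : norm1 x ≤ R) (hy : norm1 y ≤ R) :
    hidingValue M R x = hidingValue M R y ↔ y - x ∈ latticeOf M := by
  rw [hidingValue, hidingValue, mul_right_inj' (by norm_num),
    residueCode_eq_iff (levMod_ne_zero (entry_val M) hl hli R)]
  have hmod : ∀ r, levForm k l (entry M) R x r % levMod k l (entry M) R =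
      levForm k l (entry M) R y r % levMod k l (entry M) R ↔
      levMod k l (entry M) R ∣ levForm k l (entry M) R (y - x) r := fun r => by
    rw [levForm_sub]; exact Int.modEq_iff_dvd
  simp only [hmod]
  refine ⟨fun h => mem_latticeOf_of_levForm (entry_val M) hl hli R ?_ h,
    fun h r hr => levMod_dvd_levForm (entry_val M) hl hli R h hr⟩
  exact (norm1_sub_le x y).trans (by omega)

/-- The hiding function for the subgroup of the multiples of the shortest vector: in the ball of
radius `R`, the lattice has no other vectors. -/
lemma exists_hidingFunction (hp : 1 ≤ p) (hli : LinearIndependent ℤ M) (hl : 0 < l)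
    (hv : IsShortest p (latticeOf M) v) (hR : 2 * R ≤ b)
    (hb : ∀ x ∈ latticeOf M, ¬ Proportional x v → (b : ℝ) < pNorm p x) :
    ∃ f : (Fin k → ℤ) → ℤ, Hides f (AddSubgroup.zmultiples v) ∧
      ∀ x, norm1 x ≤ R → f x = hidingValue M R x := by
  refine exists_hides_extension (AddSubgroup.zmultiples v) (hidingValue M R) {x | norm1 x ≤ R}
    (fun x hx y hy => ?_) fun x => even_two_mul _
  rw [hidingValue_eq_iff hli hl hx hy]
  constructor
  · intro h
    refine hv.mem_zmultiples hp h ?_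
    by_contra hprop
    refine (hb _ h hprop).not_ge ((pNorm_le_norm1 hp _).trans ?_)
    have hx' : norm1 x ≤ R := hx
    have hy' : norm1 y ≤ R := hy
    exact_mod_cast (norm1_sub_le x y).trans (by omega)
  · exact fun h => (AddSubgroup.zmultiples_le_of_mem hv.1) h

lemma abs_levForm_le (hk : k ≤ X) (hl : l ≤ X) (hX : 1 ≤ X) (hl0 : 0 < l)
    (hM : ∀ i < l, ∀ j < k, |entry M i j| ≤ 2 ^ X) {x : Fin k → ℤ} (hx : norm1 x ≤ R) {r : ℕ}
    (hr : r < l + k) : |levForm k l (entry M) R x r| ≤ 2 ^ (tableBits X R + R) := by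
  calc |levForm k l (entry M) R x r| ≤ ∑ j : Fin k, 2 ^ tableBits X R * |x j| := by
        refine (Finset.abs_sum_le_sum_abs _ _).trans (Finset.sum_le_sum fun j _ => ?_)
        rw [abs_mul]
        exact mul_le_mul_of_nonneg_right (abs_levRow_le hk hl hX hM hl0 R hr j.2) (abs_nonneg _)
    _ = 2 ^ tableBits X R * (norm1 x : ℤ) := by
        rw [← Finset.mul_sum, norm1]
        push_cast
        rfl
    _ ≤ 2 ^ tableBits X R * 2 ^ R := by
        refine mul_le_mul_of_nonneg_left ?_ (by positivity)
        exact_mod_cast hx.trans Nat.lt_two_pow_self.le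
    _ = _ := (pow_add _ _ _).symm

lemma abs_hidingValue_le (hk : k ≤ X) (hl : l ≤ X) (hX : 1 ≤ X) (hl0 : 0 < l)
    (hli : LinearIndependent ℤ M)
    (hM : ∀ i < l, ∀ j < k, |entry M i j| ≤ 2 ^ X) (x : Fin k → ℤ) :
    |hidingValue M R x| ≤ 2 ^ valueBits X R := by
  have hm : |levMod k l (entry M) R| ≤ 2 ^ tableBits X R := abs_levMod_le hk hl hX hM hl0 R
  have h0 := levMod_ne_zero (entry_val M) hl0 hli R
  have h1 : |residueCode (levMod k l (entry M) R) (l + k) (levForm k l (entry M) R x)| ≤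
      2 ^ (2 * X + 2 * X * tableBits X R) := by
    refine abs_sum_range_le ?_ fun r hr => ?_
    · exact (show l + k ≤ 2 * X by omega).trans Nat.lt_two_pow_self.le
    · have h2 : |levForm k l (entry M) R x r % levMod k l (entry M) R| ≤ 2 ^ tableBits X R := by
        rw [abs_of_nonneg (Int.emod_nonneg _ h0)]
        exact (Int.emod_lt_abs _ h0).le.trans hm
      refine abs_le_two_pow_mono (abs_mul_le_two_pow (abs_pow_le_two_pow hm le_rfl) h2) ?_
      calc r * tableBits X R + tableBits X R = (r + 1) * tableBits X R := by ring
        _ ≤ _ := Nat.mul_le_mul_right _ (by omega)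
  exact abs_le_two_pow_mono (abs_mul_le_two_pow (m := 1) (by norm_num) h1)
    (by unfold valueBits; omega)

/-- The simulation of a program that finds the generator of the hidden subgroup. -/
lemma succeeds_reduction (hp : 1 ≤ p) {fee : (Fin k → ℤ) → ℕ} {Z : Cmd} {TE RE : CExp}
    (hli : LinearIndependent ℤ M) (hk0 : 0 < k) (hl0 : 0 < l) (hX : X = a + k + bitComplexity M)
    (hv : IsShortest p (latticeOf M) v) (hR : 2 * R ≤ b)
    (hb : ∀ x ∈ latticeOf M, ¬ Proportional x v → (b : ℝ) < pNorm p x)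
    (hfee : ∀ x, fee x ≤ T → norm1 x ≤ R)
    (hTE : ∀ S : Store, S 0 = usvpInput a M 0 → TE.eval S = T)
    (hRE : ∀ S : Store, S 0 = usvpInput a M 0 → RE.eval S = R)
    (hZ : ∀ f : (Fin k → ℤ) → ℤ, Hides f (AddSubgroup.zmultiples v) →
      Succeeds ⟨k, f, fee⟩ Z (hspInput k) T
        (fun S => AddSubgroup.zmultiples (outputVec S k) = AddSubgroup.zmultiples v)) :
    Succeeds noOracle ((tablesCmd TE RE).seq Z.sim) (usvpInput a M)
      (prepTime (tablesWeight TE RE) X R T + slowdown Z.simWeight X R T * T)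
      (fun S => IsShortest p (latticeOf M) (outputVec S k)) := by
  obtain ⟨f, hf, hfR⟩ := exists_hidingFunction hp hli hl0 hv hR hb
  have hlk : l ≤ l * k := Nat.le_mul_of_pos_right _ hk0
  have hbc := mul_le_bitComplexity M
  have hkX : k ≤ X := by omega
  have hlX : l ≤ X := by omega
  have hX1 : 1 ≤ X := by omega
  have hM : ∀ i < l, ∀ j < k, |entry M i j| ≤ 2 ^ X := fun i _ j _ =>
    abs_entry_le M (by omega) i j
  have hW : tableBits X R = 18 * (X * X) + 17 * X + 2 * R + 1 := rfl
  have hσ : memBound X R T =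
    X * (X * X) + 2 * X * tableBits X R + 2 * tableBits X R + T + R + 3 * X + 5 := rfl
  let D : SimData :=
    { O := ⟨k, f, fee⟩
      l := l
      M := entry M
      R := R
      T := T
      σ := memBound X R T
      φ := valueBits X R
      τ := prepTime (tablesWeight TE RE) X R T
      Q := slowdown Z.simWeight X R T }
  have hD : D.Valid :=
    { fee := hfee
      val := hfR
      abs_val := fun x hx => by
        change |f x| ≤ _
        rw [hfR x hx]; exact abs_hidingValue_le hkX hlX hX1 hl0 hli hM x
      form := fun x hx r hr => bitSize_le_of_abs_le (abs_levForm_le hkX hlX hX1 hl0 hM hx hr)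
        (show tableBits X R + R + 2 ≤ memBound X R T by omega)
      radius := show R + 1 ≤ memBound X R T by omega
      count := by
        have : (l + k) * k ≤ (2 * X) * X := Nat.mul_le_mul (by omega) hkX
        rw [mul_assoc] at this
        exact show (l + k) * k + 1 ≤ memBound X R T by omega
      count' := show l + k + 1 ≤ memBound X R T by omega
      one_le := Nat.le_add_left _ _ }
  refine Succeeds.sim (D := D) (input := hspInput k) (N₀ := memBound X R T) hD
    (Nat.le_succ _) ?_ ?_ (hZ f hf)
  · intro N hN
    obtain ⟨s', h1, ⟨μ, ⟨h2, h3, h4, h5⟩, h6, h7, h8⟩, h9⟩ :=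
      tables_run (ψ₀ := (start (usvpInput a M)).amp) (μ := usvpInput a M) hkX hlX hX1 hl0 hM
        (by omega) (by omega) (by rw [← hW]; omega) (by omega) hN hTE hRE
        (by simp [usvpInput]) (by simp [usvpInput])
        (fun i hi j hj => usvpInput_one M a hi hj)
        (fun B h0 h1 z => by simp [usvpInput, h0, h1]) (start (usvpInput a M))
        ⟨fun _ _ => rfl, memBits_usvpInput M hX.ge hlX (by omega), rfl⟩
    refine ⟨s', h1, ?_, h2.congr fun B hB _ => h6 B hB, h7, ?_, ?_, ?_⟩
    · intro A
      rw [h6 _ (renC_ne_of_odd (by norm_num)).symm]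
      funext z
      change _ = put (fun _ _ => 0) 0 0 (k : ℤ) A z
      rw [put_apply]
      by_cases hA : A = 0
      · subst hA
        by_cases hz : z = 0
        · rw [if_pos ⟨rfl, hz⟩, hz]; exact h3
        · rw [if_neg fun h => hz h.2]; exact h4 z hz
      · rw [if_neg fun h => hA h.1]
        exact h5 _ (renC_even A) (renC_ne_zero A) (fun h => hA (renC_injective h)) z
    · rw [h8, start, start, Finsupp.mapDomain_single, embed_zero]
    · intro B hB
      rw [Finset.mem_singleton.1 (Finsupp.support_single_subset hB)]
      intro L i
      simp only [abs_zero, zero_add]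
      exact le_rfl
    · exact h9.trans (by simp [start, D, prepTime])
  · intro S S' hS h
    have : outputVec S' k = outputVec S k := by
      funext i
      exact congrFun (hS 2) _
    rw [this]
    exact hv.of_zmultiples_eq hp h

end Reduction

/-! ### Polynomial time -/

lemma polyBound_memBound {R T : ℕ → ℕ} (hR : PolyBound R) (hT : PolyBound T) :
    PolyBound (fun X => tableBits X (R X)) ∧ PolyBound fun X => memBound X (R X) (T X) := by
  have hid := PolyBound.id
  have hc := PolyBound.const
  have hW : PolyBound fun X => tableBits X (R X) :=
    ((((hc 18).mul (hid.mul hid)).add ((hc 17).mul hid)).add ((hc 2).mul hR)).add (hc 1)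
  exact ⟨hW, (((((hid.mul (hid.mul hid)).add (((hc 2).mul hid).mul hW)).add ((hc 2).mul hW)).add
    hT).add hR).add ((hc 3).mul hid) |>.add (hc 5)⟩

lemma polyBound_time (w z : ℕ) {R T : ℕ → ℕ} (hR : PolyBound R) (hT : PolyBound T) :
    PolyBound fun X => prepTime w X (R X) (T X) + slowdown z X (R X) (T X) * T X := by
  obtain ⟨hW, hσ⟩ := polyBound_memBound hR hT
  have hid := PolyBound.id
  have hc := PolyBound.const
  have hφ : PolyBound fun X => valueBits X (R X) :=
    ((((hc 2).mul hid).mul hW).add ((hc 2).mul hid)).add (hc 1)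
  have hprep : PolyBound fun X => prepTime w X (R X) (T X) :=
    ((hid.add (hc 2)).mul (hσ.mul ((hc 12000).mul hσ))).add (hσ.mul ((hc w).mul hσ))
  have hslow : PolyBound fun X => slowdown z X (R X) (T X) :=
    ((hc z).mul (((((hσ.add hT).mul (hσ.add hT)).add hφ).add hT).add (hc 3))).add (hc 1)
  exact hprep.add (hslow.mul hT)

lemma time_mono (w z X : ℕ) {R R' T T' : ℕ} (hR : R ≤ R') (hT : T ≤ T') :
    prepTime w X R T + slowdown z X R T * T ≤ prepTime w X R' T' + slowdown z X R' T' * T' := by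
  unfold prepTime slowdown valueBits memBound tableBits
  gcongr

end HSP

end


theorem theorem4 (p : ENNReal) (hp : 1 ≤ p) (m : HSP.Mode)
    (fee : (k : ℕ) → (Fin k → ℤ) → ℕ) (hfee : HSP.PseudoPolynomial fee)
    (hZ : HSP.RankOneHSPSolvable m fee) :
    HSP.USVPSolvable m p := by
  open HSP in
  obtain ⟨Z, hwf, hmode, C, hZ⟩ := hZ
  obtain ⟨E, hE⟩ := hfee.exists_norm1_le
  let TE : CExp := .const C * CExp.pow (kE * aE + kE) C
  let RE : CExp := .const E * CExp.pow (TE + .const 1) E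
  let time : ℕ → ℕ := fun Y => C * (Y * Y + Y) ^ C
  let radius : ℕ → ℕ := fun Y => E * (time Y + 1) ^ E
  have htime : PolyBound time :=
    (PolyBound.const C).mul (((PolyBound.id.mul PolyBound.id).add PolyBound.id).pow C)
  have hradius : PolyBound radius :=
    (PolyBound.const E).mul ((htime.add (PolyBound.const 1)).pow E)
  obtain ⟨G, hG⟩ := (PolyBound.const 2).mul hradius
  obtain ⟨C', hC'⟩ := polyBound_time (tablesWeight TE RE) Z.simWeight hradius htime
  have hcl := classical_tablesCmd TE RE
  refine ⟨(tablesCmd TE RE).seq Z.sim, ⟨hcl.wellFormed, hwf.sim⟩, ⟨hcl.inMode m, hmode.sim⟩,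
    ⟨hcl.queryFree, Cmd.queryFree_sim Z⟩, G, C', ?_⟩
  rintro a b k l M hli ha hab hgap ⟨v, hv, hva, hb⟩
  have hk0 : 0 < k := by
    rcases Nat.eq_zero_or_pos k with rfl | h
    · exact absurd (Subsingleton.elim v 0) hv.2.1
    · exact h
  have hl0 : 0 < l := by
    rcases Nat.eq_zero_or_pos l with rfl | h
    · have := hv.1
      rw [latticeOf, Set.range_eq_empty, AddSubgroup.closure_empty, AddSubgroup.mem_bot] at this
      exact absurd this hv.2.1
    · exact h
  set X := a + k + bitComplexity M with hX
  set T := C * (k * a + k) ^ C with hT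
  set R := E * (T + 1) ^ E with hR
  have hTY : ∀ Y, a + k ≤ Y → T ≤ time Y := fun Y hY =>
    Nat.mul_le_mul_left _ (Nat.pow_le_pow_left
      (add_le_add (Nat.mul_le_mul (by omega) (by omega)) (by omega)) _)
  have hRY : ∀ Y, a + k ≤ Y → R ≤ radius Y := fun Y hY =>
    Nat.mul_le_mul_left _ (Nat.pow_le_pow_left (Nat.succ_le_succ (hTY Y hY)) _)
  have hRb : 2 * R ≤ b :=
    ((Nat.mul_le_mul_left 2 (hRY _ le_rfl)).trans (hG _ (by omega))).trans hgap
  have hTE : ∀ S : Store, S 0 = usvpInput a M 0 → TE.eval S = T := by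
    intro S hS
    simp only [TE, kE, aE, CExp.eval_mul, CExp.eval_pow, CExp.eval_add, CExp.eval_get,
      CExp.eval_const, hS, hT]
    simp [usvpInput]
  have hRE : ∀ S : Store, S 0 = usvpInput a M 0 → RE.eval S = R := by
    intro S hS
    simp only [RE, CExp.eval_mul, CExp.eval_pow, CExp.eval_add, CExp.eval_const, hTE S hS, hR]
    push_cast; rfl
  refine (succeeds_reduction hp hli hk0 hl0 hX hv hRb hb (fun x => hE k x T) hTE hRE
    fun f hf => (hZ k v f hv.2.1 hf).mono ?_).mono ?_
  · have := norm1_le_of_pNorm_le hp hva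
    rw [hT]
    gcongr
  · exact (time_mono _ _ X (hRY X (by omega)) (hTY X (by omega))).trans (hC' X (by omega))
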